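/- Let $\kappa=(k_1,\dots,k_\ell)$, $\ell\ge 1$, be a tuple of positive integers with $k_1+\dots+k_\ell=2g-2$. Let $X$ be a compact connected Riemann surface of genus $g$, and let $\omega$ be a holomorphic one-form on $X$ that has exactly $\ell$ distinct zeros, of orders $k_1,\dots,k_\ell$, and for which the singular flat metric $|\omega|$ has total area $\int_X \frac{i}{2}\,\omega\wedge\bar\omega = 1$; in other words, $(X,\omega)$ is a translation surface in the stratum $\mathcal H_1(\kappa)$. Let $\Sigma$ be the set of zeros of $\omega$, let $d(x,y)=\inf_\gamma\int_\gamma|\omega|$ be the distance of the flat metric, where $\gamma$ runs over the $C^1$ paths from $x$ to $y$, and let \[ \operatorname{crad}(X)=\max_{x\in X}\ \min_{\sigma\in\Sigma} d(x,\sigma) \] be the covering radius. Then \[ \operatorname{crad}(X)\ \ge\ \sqrt{\frac{2}{3\sqrt3\,(2g+\ell-2)}}. \] -/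

import Mathlib

open scoped Manifold ContDiff Bundle ENNReal

noncomputable section

/-- Holomorphic one-forms (Abelian differentials) on a Riemann surface `X`: the holomorphic
sections of the complex cotangent bundle, whose fibre at `x` is `T_x X →L[ℂ] ℂ`. -/
abbrev HolomorphicOneForm (X : Type*) [TopologicalSpace X] [ChartedSpace ℂ X]
    [IsManifold 𝓘(ℂ) ω X] : Type _ :=
  ContMDiffSection 𝓘(ℂ) (ℂ →L[ℂ] ℂ) ω
    (fun x : X => TangentSpace 𝓘(ℂ) x →L[ℂ] Bundle.Trivial X ℂ x)

/-- The genus of a compact Riemann surface: the complex dimension of its space of holomorphic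
one-forms. -/
def riemannSurfaceGenus (X : Type*) [TopologicalSpace X] [ChartedSpace ℂ X]
    [IsManifold 𝓘(ℂ) ω X] : ℕ :=
  Module.finrank ℂ (HolomorphicOneForm X)

namespace HolomorphicOneForm

variable {X : Type*} [TopologicalSpace X] [ChartedSpace ℂ X] [IsManifold 𝓘(ℂ) ω X]

/-- The value `η_x(v) ∈ ℂ` of a one-form on a (complex) tangent vector. -/
def eval (η : HolomorphicOneForm X) (x : X) (v : TangentSpace 𝓘(ℂ) x) : ℂ :=
  η x v

/-- The coefficient `f` of `η = f(z) dz` in the preferred chart `z` around `p`. It is meaningful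
on the target of this chart. -/
def coeff (η : HolomorphicOneForm X) (p : X) (z : ℂ) : ℂ :=
  η.eval ((chartAt ℂ p).symm z) (mfderiv 𝓘(ℂ) 𝓘(ℂ) (chartAt ℂ p).symm z (1 : ℂ))

/-- The order of vanishing of `η` at `p` (it is `⊤` if `η` vanishes identically near `p`). -/
def order (η : HolomorphicOneForm X) (p : X) : ℕ∞ :=
  analyticOrderAt (η.coeff p) (chartAt ℂ p p)

/-- The set `Σ` of singularities of `(X, η)`: the zeros of `η`. -/
def singularities (η : HolomorphicOneForm X) : Set X :=
  {x | η x = 0}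

/-- The area measure of the flat metric `|η|²` on the Borel sets of `X`. In the chart `z` around
`p`, with `η = f(z) dz`, it has density `|f|²` with respect to Lebesgue measure; these local
measures agree on overlaps, and the area measure is the smallest measure dominating all of them. -/
def areaMeasure (η : HolomorphicOneForm X) : @MeasureTheory.Measure X (borel X) :=
  letI : MeasurableSpace X := borel X
  ⨆ p : X, MeasureTheory.Measure.map (chartAt ℂ p).symm
    ((MeasureTheory.volume.restrict (chartAt ℂ p).target).withDensity
      (fun z => ‖η.coeff p z‖ₑ ^ 2))

/-- The total area of `(X, η)`. -/
def area (η : HolomorphicOneForm X) : ℝ≥0∞ :=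
  η.areaMeasure Set.univ

/-- The norm `|η_x(v)|` of a (real) tangent vector `v` in the singular flat metric `|η|`. The real
and the complex tangent space at `x` are the same copy of `ℂ`, namely the one given by the
preferred chart at `x`. -/
@[reducible] def flatENorm (η : HolomorphicOneForm X) (x : X) : ENorm (TangentSpace 𝓘(ℝ, ℂ) x) :=
  ⟨fun v => ‖η.eval x v‖ₑ⟩

/-- The distance of the singular flat metric: the infimum of the lengths `∫ |η(γ'(t))| dt` of the
`C¹` paths `γ` from `x` to `y`. -/
def flatEDist (η : HolomorphicOneForm X) (x y : X) : ℝ≥0∞ :=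
  letI : ∀ x : X, ENorm (TangentSpace 𝓘(ℝ, ℂ) x) := η.flatENorm
  Manifold.riemannianEDist 𝓘(ℝ, ℂ) x y

/-- The distance from `x` to the set of singularities. -/
def distToSingularities (η : HolomorphicOneForm X) (x : X) : ℝ≥0∞ :=
  ⨅ σ ∈ η.singularities, η.flatEDist x σ

/-- The covering radius of `(X, η)`: the maximal distance of a point of `X` to the set of
singularities, as a real number. -/
def coveringRadius (η : HolomorphicOneForm X) : ℝ :=
  (⨆ x : X, η.distToSingularities x).toReal

/-- `(X, η)` lies in the stratum `ℋ(κ)` of genus `g`, for a tuple `κ = (k₁, …, k_ℓ)`: the surface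
`X` has genus `g`, and `η` has exactly `ℓ` distinct zeros, of orders `k₁, …, k_ℓ`. -/
structure MemStratum (η : HolomorphicOneForm X) (g : ℕ) {ℓ : ℕ} (κ : Fin ℓ → ℕ) : Prop where
  genus_eq : riemannSurfaceGenus X = g
  exists_zeros : ∃ p : Fin ℓ → X, Function.Injective p ∧ Set.range p = η.singularities ∧
    ∀ i, η.order (p i) = κ i

/-- `(X, η)` lies in the stratum `ℋ₁(κ)` of translation surfaces of area one. -/
structure MemUnitStratum (η : HolomorphicOneForm X) (g : ℕ) {ℓ : ℕ} (κ : Fin ℓ → ℕ) : Prop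
    extends MemStratum η g κ where
  area_eq : η.area = 1

end HolomorphicOneForm

end

/-! Delaunay triangles cover the surface up to a null set; the proof bounds the area of each and
their number. Let R be the covering radius and N = Σ (kᵢ + 1) = 2g - 2 + ℓ.

Away from its zeros the form is dz in suitable coordinates, and the inverse coordinates ("flat
maps") continue along straight segments until these run into a zero. This gives an exponential map
at each regular point p, defined on an open subset of ℂ. A disk in that subset is an immersed flat
disk without zeros. Paths from its centre lift to the disk, so its radius is at most R
(`FlatOn.radius_le_coveringRadius`). A triangle inscribed in it has area at most that of the
equilateral one, 3√3/4 · R².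

Covering: among the flat disks around p take one of maximal power r² - |c|² at p. If p were outside
the convex hull of the singular points of its circle, the centre could be moved to increase the
power (`exists_larger_disk`). So p lies in that hull, hence in a triangle of its fan triangulation,
unless it lies on a line through two of the singular points. Such lines are locally finite, so the
exceptional points form a null set (`volume_compl_triangles_eq_zero`).

Disjointness: the difference of the powers with respect to two circles is affine. If two empty disks
have hulls that meet in an interior point of a triangle, this difference vanishes at the three
vertices and the disks coincide (`disk_eq_of_mem_openTriangle`).

Counting: a zero of order k has cone angle 2π(k + 1), and each triangle uses up an angle π at zeros,
so there are at most 2N triangles (`card_le_of_subset_delaunayTriangles`). Angles are measured by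
areas of small sectors; neither Euler characteristic nor the combinatorics of a cell complex enters.

Together, 1 ≤ 2N · 3√3/4 · R², which is the claim. -/

open Bundle Set Filter Topology MeasureTheory Metric

/-! ### Coefficients of a one-form in charts, and flat maps -/

namespace HolomorphicOneForm

variable {X : Type*} [TopologicalSpace X] [ChartedSpace ℂ X] [IsManifold 𝓘(ℂ) ω X]

/-- The coefficient of a one-form at `x` with respect to the preferred chart at `x`. -/
noncomputable def coeffAt (η : HolomorphicOneForm X) (x : X) : ℂ :=
  η.eval x (1 : ℂ)

theorem eval_eq (η : HolomorphicOneForm X) (x : X) (v : ℂ) :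
    η.eval x v = η.coeffAt x * v := by
  have h := (η x).map_smul v (1 : ℂ)
  have e : (v • (1 : ℂ) : ℂ) = v := by simp
  change (η x) v = (η x) (1 : ℂ) * v
  calc (η x) v = (η x) (v • (1 : ℂ) : ℂ) := by rw [e]
    _ = v * (η x) (1 : ℂ) := h
    _ = _ := mul_comm _ _

theorem mem_singularities_iff (η : HolomorphicOneForm X) (x : X) :
    x ∈ η.singularities ↔ η.coeffAt x = 0 := by
  constructor
  · intro h
    have h' : η x = 0 := h
    change (η x) (1 : ℂ) = 0
    rw [h']; rfl
  · intro h
    change η x = 0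
    refine ContinuousLinearMap.ext fun v => ?_
    have h2 := eval_eq η x v
    rw [h] at h2
    exact h2.trans (zero_mul (M₀ := ℂ) _)

theorem differentiableOn_transition (p q : X) :
    DifferentiableOn ℂ (chartAt ℂ p ∘ (chartAt ℂ q).symm)
      ((chartAt ℂ q).target ∩ (chartAt ℂ q).symm ⁻¹' (chartAt ℂ p).source) := by
  have h := (mem_groupoid_of_pregroupoid.mp ((contDiffGroupoid ω 𝓘(ℂ)).compatible
    (chart_mem_atlas ℂ q) (chart_mem_atlas ℂ p))).1
  simp only [contDiffPregroupoid, contDiffPregroupoid] at h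
  have h2 := ContDiffOn.differentiableOn h (by simp)
  simpa [OpenPartialHomeomorph.trans_source] using h2

omit [IsManifold 𝓘(ℂ) ω X] in
theorem isOpen_transition_source (p q : X) :
    IsOpen ((chartAt ℂ q).target ∩ (chartAt ℂ q).symm ⁻¹' (chartAt ℂ p).source) :=
  (chartAt ℂ q).isOpen_inter_preimage_symm (chartAt ℂ p).open_source

theorem hasDerivAt_transition (p q : X) {x : X} (hq : x ∈ (chartAt ℂ q).source)
    (hp : x ∈ (chartAt ℂ p).source) :
    HasDerivAt (chartAt ℂ p ∘ (chartAt ℂ q).symm)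
      (deriv (chartAt ℂ p ∘ (chartAt ℂ q).symm) (chartAt ℂ q x)) (chartAt ℂ q x) := by
  refine ((differentiableOn_transition p q).differentiableAt
    ((isOpen_transition_source p q).mem_nhds ?_)).hasDerivAt
  simp [hq, hp]

theorem deriv_transition_mul (p q : X) {x : X} (hq : x ∈ (chartAt ℂ q).source)
    (hp : x ∈ (chartAt ℂ p).source) :
    deriv (chartAt ℂ p ∘ (chartAt ℂ q).symm) (chartAt ℂ q x) *
      deriv (chartAt ℂ q ∘ (chartAt ℂ p).symm) (chartAt ℂ p x) = 1 := by
  have h1 := hasDerivAt_transition p q hq hp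
  have h2 := hasDerivAt_transition q p hp hq
  have h1' : HasDerivAt (chartAt ℂ p ∘ (chartAt ℂ q).symm)
      (deriv (chartAt ℂ p ∘ (chartAt ℂ q).symm) (chartAt ℂ q x))
      ((chartAt ℂ q ∘ (chartAt ℂ p).symm) (chartAt ℂ p x)) := by
    simpa [hp] using h1
  have h3 := h1'.comp _ h2
  refine h3.unique ((hasDerivAt_id _).congr_of_eventuallyEq ?_)
  filter_upwards [(isOpen_transition_source q p).mem_nhds (x := chartAt ℂ p x) (by simp [hp, hq])]
    with z hz
  have hz2 : (chartAt ℂ p).symm z ∈ (chartAt ℂ q).source := hz.2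
  simp [hz.1, hz2]

/-- Tangent vectors at `x` are recorded in the preferred chart at `x`, so pushing ∂/∂z forward from
the chart at `p` produces the derivative of the transition between the two charts. -/
theorem coeff_eq (η : HolomorphicOneForm X) (p : X) {x : X} (hx : x ∈ (chartAt ℂ p).source) :
    η.coeff p (chartAt ℂ p x) =
      η.coeffAt x * deriv (chartAt ℂ x ∘ (chartAt ℂ p).symm) (chartAt ℂ p x) := by
  have hz : chartAt ℂ p x ∈ (chartAt ℂ p).target := (chartAt ℂ p).map_source hx
  have hd : MDifferentiableAt 𝓘(ℂ) 𝓘(ℂ) (chartAt ℂ p).symm (chartAt ℂ p x) :=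
    mdifferentiableAt_atlas_symm (chart_mem_atlas ℂ p) hz
  unfold coeff
  refine (eval_eq η _ _).trans ?_
  rw [(chartAt ℂ p).left_inv hx]
  congr 1
  refine (DFunLike.congr_fun hd.mfderiv (1 : ℂ)).trans ?_
  simp only [writtenInExtChartAt, mfld_simps, fderivWithin_univ, (chartAt ℂ p).left_inv hx]
  rw [← fderiv_apply_one_eq_deriv]
  rfl

theorem coeff_eq_zero_iff (η : HolomorphicOneForm X) (p : X) {x : X}
    (hx : x ∈ (chartAt ℂ p).source) :
    η.coeff p (chartAt ℂ p x) = 0 ↔ x ∈ η.singularities := by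
  rw [coeff_eq η p hx, mem_singularities_iff]
  have h := deriv_transition_mul x p hx (mem_chart_source ℂ x)
  have : deriv (chartAt ℂ x ∘ (chartAt ℂ p).symm) (chartAt ℂ p x) ≠ 0 :=
    left_ne_zero_of_mul_eq_one h
  simp [this]

/-- The coefficient pairs a smooth section of the cotangent bundle with the coordinate vector field,
itself obtained from the tangent map of the inverse chart. Complex C¹ regularity is enough for
holomorphy. -/
theorem differentiableOn_coeff (η : HolomorphicOneForm X) (p : X) :
    DifferentiableOn ℂ (η.coeff p) (chartAt ℂ p).target := by
  intro z hz
  have hs : ContMDiffAt 𝓘(ℂ) 𝓘(ℂ) ω (chartAt ℂ p).symm z :=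
    (contMDiffOn_chart_symm z hz).contMDiffAt ((chartAt ℂ p).open_target.mem_nhds hz)
  have hη : ContMDiffAt 𝓘(ℂ) (𝓘(ℂ).prod 𝓘(ℂ, ℂ →L[ℂ] ℂ)) 1
      (fun m : ℂ => TotalSpace.mk' (ℂ →L[ℂ] ℂ)
        (E := fun x : X => TangentSpace 𝓘(ℂ) x →L[ℂ] Bundle.Trivial X ℂ x)
        ((chartAt ℂ p).symm m) (η ((chartAt ℂ p).symm m))) z :=
    ((η.contMDiff.contMDiffAt).comp z hs).of_le (by simp)
  have hv : ContMDiffAt 𝓘(ℂ) (𝓘(ℂ).prod 𝓘(ℂ)) 1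
      (fun m : ℂ => TotalSpace.mk' ℂ (E := fun x : X => TangentSpace 𝓘(ℂ) x)
        ((chartAt ℂ p).symm m) (mfderiv 𝓘(ℂ) 𝓘(ℂ) (chartAt ℂ p).symm m (1 : ℂ))) z := by
    have h1 : ContMDiffOn 𝓘(ℂ).tangent 𝓘(ℂ).tangent 1
        (tangentMapWithin 𝓘(ℂ) 𝓘(ℂ) (chartAt ℂ p).symm (chartAt ℂ p).target)
        (Bundle.TotalSpace.proj ⁻¹' (chartAt ℂ p).target) :=
      (contMDiffOn_chart_symm (n := ω)).contMDiffOn_tangentMapWithin (by simp)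
        (chartAt ℂ p).open_target.uniqueMDiffOn
    have h2 : ContMDiffAt 𝓘(ℂ) 𝓘(ℂ).tangent 1
        (fun m : ℂ => (⟨m, (1 : ℂ)⟩ : TangentBundle 𝓘(ℂ) ℂ)) z := by
      rw [contMDiffAt_totalSpace]
      refine ⟨contMDiffAt_id, ?_⟩
      simp only [trivializationAt_model_space_apply]
      exact contMDiffAt_const
    have h3 := (h1 ⟨z, (1 : ℂ)⟩ hz).comp_of_eq (x := z) (s := (chartAt ℂ p).target)
      (f := fun m : ℂ => (⟨m, (1 : ℂ)⟩ : TangentBundle 𝓘(ℂ) ℂ)) h2.contMDiffWithinAt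
      (fun m hm => hm) rfl
    have h4 := h3.contMDiffAt ((chartAt ℂ p).open_target.mem_nhds hz)
    refine h4.congr_of_eventuallyEq ?_
    filter_upwards [(chartAt ℂ p).open_target.mem_nhds hz] with m hm
    simp only [Function.comp, tangentMapWithin]
    rw [mfderivWithin_of_mem_nhds ((chartAt ℂ p).open_target.mem_nhds hm)]
  have h := hη.clm_bundle_apply (F₁ := ℂ) (F₂ := ℂ) (E₂ := fun x : X => Bundle.Trivial X ℂ x) hv
  rw [contMDiffAt_totalSpace] at h
  have h2 := h.2
  have h3 : ContMDiffAt 𝓘(ℂ) 𝓘(ℂ) 1 (η.coeff p) z := h2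
  exact (h3.contDiffAt.differentiableAt (by simp)).differentiableWithinAt

/-- `ψ` pulls the one-form `η` back to `dz` at the point `z`. -/
def FlatAt (η : HolomorphicOneForm X) (ψ : ℂ → X) (z : ℂ) : Prop :=
  ContinuousAt ψ z ∧ ∃ w, HasDerivAt (chartAt ℂ (ψ z) ∘ ψ) w z ∧ η.coeffAt (ψ z) * w = 1

variable {η : HolomorphicOneForm X} {ψ ψ' : ℂ → X} {z : ℂ}

theorem FlatAt.notMem_singularities (h : η.FlatAt ψ z) : ψ z ∉ η.singularities := by
  obtain ⟨-, w, -, hw⟩ := h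
  rw [mem_singularities_iff]
  exact left_ne_zero_of_mul_eq_one hw

theorem FlatAt.hasDerivAt (h : η.FlatAt ψ z) {p : X} (hp : ψ z ∈ (chartAt ℂ p).source) :
    ∃ w, HasDerivAt (chartAt ℂ p ∘ ψ) w z ∧ η.coeff p (chartAt ℂ p (ψ z)) * w = 1 := by
  obtain ⟨hc, w, hw, h1⟩ := h
  have hx := mem_chart_source ℂ (ψ z)
  have hT := hasDerivAt_transition p (ψ z) hx hp
  refine ⟨_, (hT.comp z hw).congr_of_eventuallyEq ?_, ?_⟩
  · filter_upwards [hc.preimage_mem_nhds ((chartAt ℂ (ψ z)).open_source.mem_nhds hx)] with y hy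
    simp [(chartAt ℂ (ψ z)).left_inv hy]
  · rw [coeff_eq η p hp]
    have := deriv_transition_mul p (ψ z) hx hp
    linear_combination h1 + η.coeffAt (ψ z) * w * this

theorem flatAt_of_hasDerivAt {p : X} {g : ℂ → ℂ} {w : ℂ} (hp : g z ∈ (chartAt ℂ p).target)
    (hg : HasDerivAt g w z) (h1 : η.coeff p (g z) * w = 1) :
    η.FlatAt ((chartAt ℂ p).symm ∘ g) z := by
  have hs : (chartAt ℂ p).symm (g z) ∈ (chartAt ℂ p).source := (chartAt ℂ p).map_target hp
  have hr : chartAt ℂ p ((chartAt ℂ p).symm (g z)) = g z := (chartAt ℂ p).right_inv hp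
  refine ⟨((chartAt ℂ p).continuousAt_symm hp).comp hg.continuousAt,
    deriv (chartAt ℂ ((chartAt ℂ p).symm (g z)) ∘ (chartAt ℂ p).symm) (g z) * w, ?_, ?_⟩
  · have hT := hasDerivAt_transition ((chartAt ℂ p).symm (g z)) p hs (mem_chart_source ℂ _)
    rw [hr] at hT
    exact hT.comp z hg
  · have := coeff_eq η p hs
    rw [hr] at this
    rw [this] at h1
    simp only [Function.comp]
    linear_combination h1

theorem FlatAt.congr (h : η.FlatAt ψ z) (he : ψ' =ᶠ[𝓝 z] ψ) : η.FlatAt ψ' z := by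
  obtain ⟨hc, w, hw, h1⟩ := h
  have e := he.eq_of_nhds
  refine ⟨hc.congr he.symm, w, ?_, by rw [e]; exact h1⟩
  rw [e]
  exact hw.congr_of_eventuallyEq (he.fun_comp _)

theorem FlatAt.comp_add (w : ℂ) (h : η.FlatAt ψ (z + w)) : η.FlatAt (fun y => ψ (y + w)) z := by
  obtain ⟨hc, d, hd, h1⟩ := h
  refine ⟨?_, d, ?_, h1⟩
  · exact ContinuousAt.comp (f := fun y => y + w) (x := z) hc (by fun_prop)
  · exact hd.comp_add_const z w

end HolomorphicOneForm

/-! ### Primitives; existence and uniqueness of flat maps -/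

namespace HolomorphicOneForm

variable {X : Type*} [TopologicalSpace X] [ChartedSpace ℂ X] [IsManifold 𝓘(ℂ) ω X]
variable {η : HolomorphicOneForm X} {ψ ψ' : ℂ → X} {z : ℂ}

/-- `G` is a primitive of `η`, in the preferred chart at `p`, on the set `D`. -/
def IsPrimitiveOn (η : HolomorphicOneForm X) (p : X) (G : ℂ → ℂ) (D : Set ℂ) : Prop :=
  D ⊆ (chartAt ℂ p).target ∧ ∀ w ∈ D, HasDerivAt G (η.coeff p w) w

theorem exists_isPrimitiveOn (η : HolomorphicOneForm X) (p : X) {w : ℂ} {ρ : ℝ}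
    (h : ball w ρ ⊆ (chartAt ℂ p).target) :
    ∃ G : ℂ → ℂ, G w = 0 ∧ η.IsPrimitiveOn p G (ball w ρ) := by
  obtain ⟨G, hG0, hG⟩ := (((η.differentiableOn_coeff p).mono h).isExactOn_ball).with_val_at w 0
  exact ⟨G, hG0, h, hG⟩

theorem exists_isPrimitiveOn_chartAt (η : HolomorphicOneForm X) (p : X) :
    ∃ ρ > 0, ∃ G : ℂ → ℂ, G (chartAt ℂ p p) = 0 ∧
      η.IsPrimitiveOn p G (ball (chartAt ℂ p p) ρ) := by
  obtain ⟨ρ, hρ, h⟩ := Metric.isOpen_iff.1 (chartAt ℂ p).open_target _ (mem_chart_target ℂ p)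
  exact ⟨ρ, hρ, exists_isPrimitiveOn η p h⟩

theorem IsPrimitiveOn.hasStrictDerivAt {p : X} {G : ℂ → ℂ} {D : Set ℂ}
    (hG : η.IsPrimitiveOn p G D) (hD : IsOpen D) {w : ℂ} (hw : w ∈ D) :
    HasStrictDerivAt G (η.coeff p w) w := by
  have hd : DifferentiableOn ℂ G D :=
    fun y hy => (hG.2 y hy).differentiableAt.differentiableWithinAt
  have ha : AnalyticAt ℂ G w := hd.analyticAt (hD.mem_nhds hw)
  have := ha.hasStrictDerivAt
  rwa [(hG.2 w hw).deriv] at this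

theorem FlatAt.hasDerivAt_primitive (h : η.FlatAt ψ z) {p : X} {G : ℂ → ℂ}
    (hp : ψ z ∈ (chartAt ℂ p).source)
    (hG : HasDerivAt G (η.coeff p (chartAt ℂ p (ψ z))) (chartAt ℂ p (ψ z))) :
    HasDerivAt (fun y => G (chartAt ℂ p (ψ y))) 1 z := by
  obtain ⟨w, hw, h1⟩ := h.hasDerivAt hp
  have := HasDerivAt.comp (h := chartAt ℂ p ∘ ψ) z hG hw
  rwa [h1] at this

/-- The composite of a primitive with a flat map has derivative f · ψ' = 1, hence is a translation:
flat maps are local inverses of primitives. -/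
theorem eventually_primitive_eq {p : X} {G : ℂ → ℂ} {D : Set ℂ} (hD : IsOpen D)
    (hG : η.IsPrimitiveOn p G D) (hp : ψ z ∈ (chartAt ℂ p).source)
    (hzD : chartAt ℂ p (ψ z) ∈ D) (h : ∀ᶠ y in 𝓝 z, η.FlatAt ψ y) :
    ∀ᶠ y in 𝓝 z, G (chartAt ℂ p (ψ y)) = G (chartAt ℂ p (ψ z)) + (y - z) := by
  have hc : ContinuousAt ψ z := h.self_of_nhds.1
  have h1 : ∀ᶠ y in 𝓝 z, ψ y ∈ (chartAt ℂ p).source :=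
    hc.preimage_mem_nhds ((chartAt ℂ p).open_source.mem_nhds hp)
  have h2 : ∀ᶠ y in 𝓝 z, chartAt ℂ p (ψ y) ∈ D :=
    (((chartAt ℂ p).continuousAt hp).comp hc).preimage_mem_nhds (hD.mem_nhds hzD)
  obtain ⟨ε, hε, hb⟩ := Metric.eventually_nhds_iff_ball.1 (h.and (h1.and h2))
  have hd : ∀ y ∈ ball z ε, HasDerivAt (fun y => G (chartAt ℂ p (ψ y)) - y) 0 y := by
    intro y hy
    obtain ⟨a, b, c⟩ := hb y hy
    have := (a.hasDerivAt_primitive b (hG.2 _ c)).sub (hasDerivAt_id y)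
    rw [sub_self] at this
    exact this
  filter_upwards [ball_mem_nhds z hε] with y hy
  have := (isOpen_ball (x := z) (ε := ε)).is_const_of_deriv_eq_zero
    (convex_ball z ε).isPreconnected
    (fun y hy => (hd y hy).differentiableAt.differentiableWithinAt)
    (fun y hy => (hd y hy).deriv) hy (mem_ball_self hε)
  linear_combination this

theorem exists_injOn_primitive {p x : X} {G : ℂ → ℂ} {D : Set ℂ} (hD : IsOpen D)
    (hG : η.IsPrimitiveOn p G D) (hp : x ∈ (chartAt ℂ p).source)
    (hxD : chartAt ℂ p x ∈ D) (hx : x ∉ η.singularities) :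
    ∃ N ∈ 𝓝 x, InjOn (fun y => G (chartAt ℂ p y)) N := by
  have h0 : η.coeff p (chartAt ℂ p x) ≠ 0 := by rwa [Ne, coeff_eq_zero_iff η p hp]
  have hs := (hG.hasStrictDerivAt hD hxD).hasStrictFDerivAt_equiv h0
  set Φ := hs.toOpenPartialHomeomorph G with hΦ
  have hmem : chartAt ℂ p x ∈ Φ.source := hs.mem_toOpenPartialHomeomorph_source
  refine ⟨(chartAt ℂ p).source ∩ chartAt ℂ p ⁻¹' Φ.source,
    inter_mem ((chartAt ℂ p).open_source.mem_nhds hp)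
      (((chartAt ℂ p).continuousAt hp).preimage_mem_nhds (Φ.open_source.mem_nhds hmem)), ?_⟩
  intro a ha b hb hab
  exact (chartAt ℂ p).injOn ha.1 hb.1 (Φ.injOn ha.2 hb.2 hab)

/-- Both sides have the same primitive value, and the primitive is injective near a regular point.
So a flat map is locally onto, with explicit inverse. -/
theorem eventually_apply_primitive_eq {p : X} {G : ℂ → ℂ} {D : Set ℂ} (hD : IsOpen D)
    (hG : η.IsPrimitiveOn p G D) (hp : ψ z ∈ (chartAt ℂ p).source)
    (hzD : chartAt ℂ p (ψ z) ∈ D) (h : ∀ᶠ y in 𝓝 z, η.FlatAt ψ y) :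
    ∀ᶠ x in 𝓝 (ψ z), ψ (z + (G (chartAt ℂ p x) - G (chartAt ℂ p (ψ z)))) = x := by
  obtain ⟨N, hN, hinj⟩ := exists_injOn_primitive hD hG hp hzD h.self_of_nhds.notMem_singularities
  have hc : ContinuousAt ψ z := h.self_of_nhds.1
  have hGc : ContinuousAt (fun x => z + (G (chartAt ℂ p x) - G (chartAt ℂ p (ψ z)))) (ψ z) := by
    have : ContinuousAt (fun x => G (chartAt ℂ p x)) (ψ z) :=
      ContinuousAt.comp (f := chartAt ℂ p) (hG.2 _ hzD).continuousAt ((chartAt ℂ p).continuousAt hp)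
    exact continuousAt_const.add (this.sub continuousAt_const)
  have ht : Tendsto (fun x => z + (G (chartAt ℂ p x) - G (chartAt ℂ p (ψ z)))) (𝓝 (ψ z)) (𝓝 z) := by
    simpa [ContinuousAt] using hGc
  have h1 := ht.eventually (eventually_primitive_eq hD hG hp hzD h)
  have h2 := ht.eventually (hc.eventually_mem hN)
  filter_upwards [h1, h2, hN] with x hx1 hx2 hx3
  refine hinj hx2 hx3 ?_
  simp only [hx1]
  ring

theorem eventuallyEq_of_flat (h : ∀ᶠ y in 𝓝 z, η.FlatAt ψ y) (h' : ∀ᶠ y in 𝓝 z, η.FlatAt ψ' y)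
    (he : ψ z = ψ' z) : ψ =ᶠ[𝓝 z] ψ' := by
  obtain ⟨ρ, hρ, G, -, hG⟩ := exists_isPrimitiveOn_chartAt η (ψ z)
  have hs := mem_chart_source ℂ (ψ z)
  have hm := mem_ball_self (x := chartAt ℂ (ψ z) (ψ z)) hρ
  have hs' : ψ' z ∈ (chartAt ℂ (ψ z)).source := he ▸ hs
  have hm' : chartAt ℂ (ψ z) (ψ' z) ∈ ball (chartAt ℂ (ψ z) (ψ z)) ρ := by rw [← he]; exact hm
  have h1 := eventually_primitive_eq isOpen_ball hG hs hm h
  have h2 := h'.self_of_nhds.1.eventually (by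
    rw [← he]; exact eventually_apply_primitive_eq isOpen_ball hG hs hm h)
  have h3 := eventually_primitive_eq isOpen_ball hG hs' hm' h'
  filter_upwards [h2, h3] with y hy2 hy3
  rw [← hy2, hy3, ← he]
  ring_nf

/-- Identity principle: the set where the germs agree is open, and local uniqueness together with
the Hausdorff property makes it closed in `V`. -/
theorem eqOn_of_flat [T2Space X] {V : Set ℂ} (hV : IsOpen V) (hc : IsPreconnected V)
    (h : ∀ y ∈ V, η.FlatAt ψ y) (h' : ∀ y ∈ V, η.FlatAt ψ' y) (hz : z ∈ V) (he : ψ z = ψ' z) :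
    EqOn ψ ψ' V := by
  have hl : ∀ y ∈ V, ψ y = ψ' y → ψ =ᶠ[𝓝 y] ψ' := fun y hy hyy =>
    eventuallyEq_of_flat (eventually_of_mem (hV.mem_nhds hy) h)
      (eventually_of_mem (hV.mem_nhds hy) h') hyy
  have hu : IsOpen {y | ψ =ᶠ[𝓝 y] ψ'} := isOpen_setOfPred_eventually_nhds
  have := hc.subset_of_closure_inter_subset hu ⟨z, hz, hl z hz he⟩ ?_
  · exact fun y hy => (this hy).eq_of_nhds
  · rintro y ⟨hy, hyV⟩
    refine hl y hyV ?_
    by_contra hne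
    have hev := (h y hyV).1.prodMk (h' y hyV).1
    have h3 : ∀ᶠ w in 𝓝 y, ψ w ≠ ψ' w := by
      have := hev.preimage_mem_nhds (isClosed_diagonal.isOpen_compl.mem_nhds
        (show (ψ y, ψ' y) ∈ (diagonal X)ᶜ from hne))
      exact this
    obtain ⟨w, hw1, hw2⟩ := (mem_closure_iff_frequently.1 hy).and_eventually h3 |>.exists
    exact hw2 hw1.eq_of_nhds

/-- Invert a primitive at `q` and translate. The radius is uniform for starting points near `q`;
this is what allows continuation past a boundary point at which a flat map accumulates on a regular
point. -/
theorem exists_flat_ball_of_notMem {q : X} (hq : q ∉ η.singularities) :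
    ∃ ε > 0, ∃ U ∈ 𝓝 q, ∀ x ∈ U, ∃ ψ : ℂ → X, ψ 0 = x ∧ ∀ y ∈ ball (0 : ℂ) ε, η.FlatAt ψ y := by
  obtain ⟨ρ, hρ, G, hG0, hG⟩ := exists_isPrimitiveOn_chartAt η q
  have hs := mem_chart_source ℂ q
  have hm := mem_ball_self (x := chartAt ℂ q q) hρ
  have h0 : η.coeff q (chartAt ℂ q q) ≠ 0 := by rwa [Ne, coeff_eq_zero_iff η q hs]
  have hstr := (hG.hasStrictDerivAt isOpen_ball hm).hasStrictFDerivAt_equiv h0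
  set O : Set ℂ := ball (chartAt ℂ q q) ρ ∩ {w | η.coeff q w ≠ 0} with hO
  have hOo : IsOpen O := by
    have : ContinuousOn (η.coeff q) (ball (chartAt ℂ q q) ρ) :=
      (η.differentiableOn_coeff q).continuousOn.mono hG.1
    exact this.isOpen_inter_preimage isOpen_ball isOpen_compl_singleton
  set Φ := (hstr.toOpenPartialHomeomorph G).restrOpen O hOo with hΦ
  have hΦG : ∀ w, Φ w = G w := fun w => rfl
  have hmem : chartAt ℂ q q ∈ Φ.source := ⟨hstr.mem_toOpenPartialHomeomorph_source, hm, h0⟩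
  have h0t : (0 : ℂ) ∈ Φ.target := by
    have := Φ.map_source hmem
    rwa [hΦG, hG0] at this
  obtain ⟨ε, hε, hb⟩ := Metric.isOpen_iff.1 Φ.open_target 0 h0t
  have hGc : ContinuousAt (fun x => G (chartAt ℂ q x)) q :=
    ContinuousAt.comp (f := chartAt ℂ q) (hG.2 _ hm).continuousAt ((chartAt ℂ q).continuousAt hs)
  refine ⟨ε / 2, by positivity, (chartAt ℂ q).source ∩ (chartAt ℂ q ⁻¹' Φ.source ∩
    (fun x => G (chartAt ℂ q x)) ⁻¹' ball 0 (ε / 2)), ?_, ?_⟩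
  · refine inter_mem ((chartAt ℂ q).open_source.mem_nhds hs) (inter_mem
      (((chartAt ℂ q).continuousAt hs).preimage_mem_nhds (Φ.open_source.mem_nhds hmem)) ?_)
    refine hGc.preimage_mem_nhds ?_
    simp only [hG0]
    exact ball_mem_nhds _ (by positivity)
  · rintro x ⟨hx1, hx2, hx3⟩
    refine ⟨(chartAt ℂ q).symm ∘ fun y => Φ.symm (y + G (chartAt ℂ q x)), ?_, fun y hy => ?_⟩
    · simp only [Function.comp, zero_add]
      rw [← hΦG, Φ.left_inv hx2, (chartAt ℂ q).left_inv hx1]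
    · have hyt : y + G (chartAt ℂ q x) ∈ Φ.target := by
        apply hb
        simp only [mem_ball_zero_iff, mem_preimage] at hy hx3 ⊢
        exact (norm_add_le _ _).trans_lt (by linarith)
      have hsrc := Φ.map_target hyt
      have hO' : Φ.symm (y + G (chartAt ℂ q x)) ∈ O := hsrc.2
      have hd := Φ.hasDerivAt_symm hyt hO'.2 (hG.2 _ hO'.1)
      refine flatAt_of_hasDerivAt (w := (η.coeff q (Φ.symm (y + G (chartAt ℂ q x))))⁻¹)
        (hG.1 hO'.1) (hd.comp_add_const _ _) (mul_inv_cancel₀ hO'.2)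

end HolomorphicOneForm

/-! ### The exponential map and singular boundary points of flat disks -/

namespace HolomorphicOneForm

variable {X : Type*} [TopologicalSpace X] [ChartedSpace ℂ X] [IsManifold 𝓘(ℂ) ω X]
variable {η : HolomorphicOneForm X} {ψ ψ' : ℂ → X} {z : ℂ}

/-- `ψ` is a flat map on `V`: it pulls `η` back to `dz` at every point of `V`. -/
def FlatOn (η : HolomorphicOneForm X) (ψ : ℂ → X) (V : Set ℂ) : Prop :=
  ∀ z ∈ V, η.FlatAt ψ z

theorem FlatOn.mono {V W : Set ℂ} (h : η.FlatOn ψ W) (hVW : V ⊆ W) : η.FlatOn ψ V :=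
  fun z hz => h z (hVW hz)

theorem FlatOn.continuousOn {V : Set ℂ} (h : η.FlatOn ψ V) : ContinuousOn ψ V :=
  fun z hz => (h z hz).1.continuousWithinAt

theorem FlatOn.comp_add {V : Set ℂ} (h : η.FlatOn ψ V) (w : ℂ) :
    η.FlatOn (fun y => ψ (y + w)) ((fun y => y + w) ⁻¹' V) :=
  fun z hz => (h (z + w) hz).comp_add w

theorem FlatOn.eventually {V : Set ℂ} (h : η.FlatOn ψ V) (hV : IsOpen V) (hz : z ∈ V) :
    ∀ᶠ y in 𝓝 z, η.FlatAt ψ y :=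
  eventually_of_mem (hV.mem_nhds hz) h

/-- Two flat maps that agree at a point of the intersection of two convex open sets have a common
extension to the union. -/
theorem FlatOn.exists_union [T2Space X] {V W : Set ℂ} (hV : IsOpen V) (hW : IsOpen W)
    (hVc : Convex ℝ V) (hWc : Convex ℝ W) (h : η.FlatOn ψ V) (h' : η.FlatOn ψ' W)
    (hzV : z ∈ V) (hzW : z ∈ W) (he : ψ z = ψ' z) :
    ∃ φ : ℂ → X, η.FlatOn φ (V ∪ W) ∧ EqOn φ ψ V ∧ EqOn φ ψ' W := by
  classical
  have hE : EqOn ψ ψ' (V ∩ W) := eqOn_of_flat (hV.inter hW) (hVc.inter hWc).isPreconnected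
    (h.mono inter_subset_left) (h'.mono inter_subset_right) ⟨hzV, hzW⟩ he
  have h1 : EqOn (V.piecewise ψ ψ') ψ V := V.piecewise_eqOn ψ ψ'
  have h2 : EqOn (V.piecewise ψ ψ') ψ' W := fun y hy => by
    by_cases hyV : y ∈ V
    · rw [h1 hyV, hE ⟨hyV, hy⟩]
    · exact Set.piecewise_eq_of_notMem _ _ _ hyV
  refine ⟨V.piecewise ψ ψ', ?_, h1, h2⟩
  rintro y (hy | hy)
  · exact (h y hy).congr (h1.eventuallyEq_of_mem (hV.mem_nhds hy))
  · exact (h' y hy).congr (h2.eventuallyEq_of_mem (hW.mem_nhds hy))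

/-- The domain of the exponential map at `p`: the vectors `z` such that there is a straight segment
with holonomy `z` starting at `p` and avoiding the singularities. -/
def expDomain (η : HolomorphicOneForm X) (p : X) : Set ℂ :=
  {z | ∃ V : Set ℂ, (IsOpen V ∧ Convex ℝ V ∧ (0 : ℂ) ∈ V ∧ z ∈ V) ∧
    ∃ ψ : ℂ → X, ψ 0 = p ∧ η.FlatOn ψ V}

open Classical in
/-- The exponential map of the flat structure at `p`. -/
noncomputable def expMap (η : HolomorphicOneForm X) (p : X) (z : ℂ) : X :=
  if h : z ∈ η.expDomain p then h.choose_spec.2.choose z else p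

theorem isOpen_expDomain (η : HolomorphicOneForm X) (p : X) : IsOpen (η.expDomain p) := by
  rw [isOpen_iff_mem_nhds]
  rintro z ⟨V, ⟨hV, hVc, h0, hz⟩, hψ⟩
  exact mem_of_superset (hV.mem_nhds hz) fun y hy => ⟨V, ⟨hV, hVc, h0, hy⟩, hψ⟩

/-- Independence of the choices in `expMap`: two convex neighbourhoods have a connected
intersection, so the identity principle applies. -/
theorem expMap_eq_of_convex [T2Space X] {p : X} {V : Set ℂ} (hV : IsOpen V) (hVc : Convex ℝ V)
    (h0 : (0 : ℂ) ∈ V) (hp : ψ 0 = p) (hψ : η.FlatOn ψ V) (hz : z ∈ V) :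
    η.expMap p z = ψ z := by
  have h : z ∈ η.expDomain p := ⟨V, ⟨hV, hVc, h0, hz⟩, ψ, hp, hψ⟩
  rw [expMap, dif_pos h]
  obtain ⟨hW, hWc, hW0, hWz⟩ := h.choose_spec.1
  obtain ⟨hp', hψ'⟩ := h.choose_spec.2.choose_spec
  exact eqOn_of_flat (hW.inter hV) (hWc.inter hVc).isPreconnected
    (hψ'.mono inter_subset_left) (hψ.mono inter_subset_right) ⟨hW0, h0⟩ (hp'.trans hp.symm)
    ⟨hWz, hz⟩

theorem flatOn_expMap [T2Space X] (η : HolomorphicOneForm X) (p : X) :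
    η.FlatOn (η.expMap p) (η.expDomain p) := by
  rintro z ⟨V, ⟨hV, hVc, h0, hz⟩, ψ, hp, hψ⟩
  refine (hψ z hz).congr ?_
  filter_upwards [hV.mem_nhds hz] with y hy
  exact expMap_eq_of_convex hV hVc h0 hp hψ hy

theorem zero_mem_expDomain {p : X} (hp : p ∉ η.singularities) : (0 : ℂ) ∈ η.expDomain p := by
  obtain ⟨ε, hε, U, hU, h⟩ := exists_flat_ball_of_notMem hp
  obtain ⟨ψ, h0, hψ⟩ := h p (mem_of_mem_nhds hU)
  exact ⟨ball 0 ε, ⟨isOpen_ball, convex_ball _ _, mem_ball_self hε, mem_ball_self hε⟩, ψ, h0, hψ⟩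

theorem expMap_zero [T2Space X] (η : HolomorphicOneForm X) (p : X) : η.expMap p 0 = p := by
  by_cases h : (0 : ℂ) ∈ η.expDomain p
  · obtain ⟨V, ⟨hV, hVc, h0, -⟩, ψ, hp, hψ⟩ := h
    rw [expMap_eq_of_convex hV hVc h0 hp hψ h0, hp]
  -- When 0 is outside the domain, the default value `p` of `expMap` is the right one.
  · rw [expMap, dif_neg h]

/-- `U` need not be convex: a thin thickening of the segment is convex and, by compactness, still
inside `U`. -/
theorem expMap_eq_of_segment [T2Space X] {p : X} {U : Set ℂ} (hU : IsOpen U)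
    (hψ : η.FlatOn ψ U) (hp : ψ 0 = p) (hz : segment ℝ 0 z ⊆ U) :
    z ∈ η.expDomain p ∧ η.expMap p z = ψ z := by
  have hcomp : IsCompact (segment ℝ 0 z) := by
    rw [segment_eq_image_lineMap]
    exact isCompact_Icc.image AffineMap.lineMap_continuous
  obtain ⟨δ, hδ, h⟩ := hcomp.exists_thickening_subset_open hU hz
  have hc : Convex ℝ (thickening δ (segment ℝ 0 z)) := (convex_segment 0 z).thickening δ
  have hsub := self_subset_thickening hδ (segment ℝ 0 z)
  have h0 := hsub (left_mem_segment ℝ 0 z)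
  have h1 := hsub (right_mem_segment ℝ 0 z)
  exact ⟨⟨_, ⟨isOpen_thickening, hc, h0, h1⟩, ψ, hp, hψ.mono h⟩,
    expMap_eq_of_convex isOpen_thickening hc h0 hp (hψ.mono h) h1⟩

/-- A flat map on the disk `ball c r` does not extend across the boundary point `s`. -/
def IsSingularAt (η : HolomorphicOneForm X) (ψ : ℂ → X) (c : ℂ) (r : ℝ) (s : ℂ) : Prop :=
  ¬ ∃ V : Set ℂ, IsOpen V ∧ Convex ℝ V ∧ s ∈ V ∧ (ball c r ∩ V).Nonempty ∧
    ∃ φ : ℂ → X, η.FlatOn φ V ∧ EqOn φ ψ (ball c r ∩ V)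

theorem segment_subset_of_mem_sphere {c s : ℂ} {r : ℝ} (hz : z ∈ ball c r) (hs : s ∈ sphere c r)
    {y : ℂ} (hy : y ∈ segment ℝ z s) : y ∈ ball c r ∨ y = s := by
  rw [← insert_endpoints_openSegment] at hy
  rcases hy with rfl | rfl | hy
  · exact Or.inl hz
  · exact Or.inr rfl
  · have hr : r ≠ 0 := (pos_of_mem_ball hz).ne'
    have h := (strictConvex_closedBall ℝ c r).openSegment_subset
      (ball_subset_closedBall hz) (sphere_subset_closedBall hs) (by
        rintro rfl
        simp only [mem_ball, mem_sphere] at hz hs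
        exact absurd hs hz.ne)
    rw [interior_closedBall _ hr] at h
    exact Or.inl (h hy)

/-- An extension across `s` could be glued to the map on the disk, and the segment from 0 to `s`
stays in the disk until its endpoint. -/
theorem isSingularAt_expMap [T2Space X] {p : X} {c s : ℂ} {r : ℝ} (hB : ball c r ⊆ η.expDomain p)
    (h0 : (0 : ℂ) ∈ ball c r) (hs : s ∈ sphere c r) (hsE : s ∉ η.expDomain p) :
    η.IsSingularAt (η.expMap p) c r s := by
  rintro ⟨V, hV, hVc, hsV, ⟨w, hwB, hwV⟩, φ, hφ, hE⟩
  obtain ⟨χ, hχ, hχ1, -⟩ := ((flatOn_expMap η p).mono hB).exists_union isOpen_ball hV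
    (convex_ball c r) hVc hφ hwB hwV (hE ⟨hwB, hwV⟩).symm
  refine hsE (expMap_eq_of_segment (isOpen_ball.union hV) hχ ?_ ?_).1
  · rw [hχ1 h0, expMap_zero]
  · intro y hy
    rcases segment_subset_of_mem_sphere h0 hs hy with h | h
    · exact Or.inl h
    · exact Or.inr (h ▸ hsV)

/-- Converse of `isSingularAt_expMap`. Together they make being singular a property of the flat disk
alone, so that the base point can be moved (`recenter`). -/
theorem IsSingularAt.notMem_expDomain [T2Space X] {p : X} {c s : ℂ} {r : ℝ}
    (h : η.IsSingularAt ψ c r s) (hψ : η.FlatOn ψ (ball c r)) (h0 : (0 : ℂ) ∈ ball c r)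
    (hp : ψ 0 = p) : s ∉ η.expDomain p := by
  rintro ⟨V, ⟨hV, hVc, h0V, hs⟩, φ, hφ0, hφ⟩
  refine h ⟨V, hV, hVc, hs, ⟨0, h0, h0V⟩, φ, hφ, ?_⟩
  exact eqOn_of_flat (isOpen_ball.inter hV) ((convex_ball c r).inter hVc).isPreconnected
    (hφ.mono inter_subset_right) (hψ.mono inter_subset_left) ⟨h0, h0V⟩ (hφ0.trans hp.symm)

theorem IsSingularAt.comp_add {c s : ℂ} {r : ℝ} (h : η.IsSingularAt ψ c r s) (w : ℂ) :
    η.IsSingularAt (fun y => ψ (y + w)) (c - w) r (s - w) := by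
  rintro ⟨V, hV, hVc, hs, ⟨a, haB, haV⟩, φ, hφ, hE⟩
  have hb : ∀ y, y - w ∈ ball (c - w) r ↔ y ∈ ball c r := fun y => by simp [mem_ball]
  refine h ⟨(fun y => y + -w) ⁻¹' V, hV.preimage (by fun_prop), ?_, by simpa [← sub_eq_add_neg],
    ⟨a + w, ?_, by simpa⟩, fun y => φ (y + -w), hφ.comp_add (-w), ?_⟩
  · exact hVc.translate_preimage_left (-w)
  · rw [← hb, add_sub_cancel_right]; exact haB
  · rintro y ⟨hy1, hy2⟩
    have := hE ⟨(hb y).2 hy1, by simpa [← sub_eq_add_neg] using hy2⟩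
    simpa [← sub_eq_add_neg] using this

end HolomorphicOneForm

/-! ### Behaviour near the zeros -/

/-- Compare `f` with its leading term, and `G` with the primitive of that term. The constants are
sharp up to `δ` because the cone angle 2π(k + 1) is later read off from them. -/
theorem exists_bounds_of_analyticOrderAt_eq {f G : ℂ → ℂ} {z₀ : ℂ} {k : ℕ}
    (hf : AnalyticAt ℂ f z₀) (hk : analyticOrderAt f z₀ = k)
    (hG : ∀ᶠ z in 𝓝 z₀, HasDerivAt G (f z) z) (hG0 : G z₀ = 0) :
    ∃ A > 0, ∀ δ > 0, ∀ᶠ z in 𝓝 z₀,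
      (1 - δ) * A * ‖z - z₀‖ ^ k ≤ ‖f z‖ ∧ ‖f z‖ ≤ (1 + δ) * A * ‖z - z₀‖ ^ k ∧
      (1 - δ) * A / (k + 1) * ‖z - z₀‖ ^ (k + 1) ≤ ‖G z‖ := by
  obtain ⟨g, hg, hg0, hfg⟩ := (hf.analyticOrderAt_eq_natCast).1 hk
  refine ⟨‖g z₀‖, norm_pos_iff.2 hg0, fun δ hδ => ?_⟩
  set A := ‖g z₀‖
  have hA : 0 < A := norm_pos_iff.2 hg0
  have hk1 : (0 : ℝ) < k + 1 := by positivity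
  -- The mean value inequality bounds the error of `f` by its maximum on the closed disk and so
  -- loses a factor k + 1 against true integration; shrinking `δ` makes up for it.
  set δ' := δ / (k + 1) with hδ'
  have hδ'0 : 0 < δ' := by positivity
  have hδ'le : δ' ≤ δ := div_le_self hδ.le (by simp)
  have hgc : ∀ᶠ z in 𝓝 z₀, ‖g z - g z₀‖ < δ' * A := by
    have := hg.continuousAt.eventually (ball_mem_nhds (g z₀) (mul_pos hδ'0 hA))
    filter_upwards [this] with z hz using by simpa [dist_eq_norm] using hz
  obtain ⟨ρ, hρ, hb⟩ := Metric.eventually_nhds_iff_ball.1 (hfg.and (hgc.and hG))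
  have hmain : ∀ z ∈ ball z₀ ρ, ‖f z - g z₀ * (z - z₀) ^ k‖ ≤ δ' * A * ‖z - z₀‖ ^ k := by
    intro z hz
    obtain ⟨h1, h2, -⟩ := hb z hz
    rw [h1, smul_eq_mul, mul_comm, ← sub_mul, norm_mul, norm_pow]
    gcongr
  filter_upwards [ball_mem_nhds z₀ hρ] with z hz
  have h1 := hmain z hz
  have hn : ‖g z₀ * (z - z₀) ^ k‖ = A * ‖z - z₀‖ ^ k := by rw [norm_mul, norm_pow]
  have hmono : δ' * A * ‖z - z₀‖ ^ k ≤ δ * A * ‖z - z₀‖ ^ k := by gcongr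
  refine ⟨?_, ?_, ?_⟩
  · have := norm_sub_norm_le (g z₀ * (z - z₀) ^ k) (f z)
    rw [norm_sub_rev, hn] at this
    linarith
  · have := norm_sub_norm_le (f z) (g z₀ * (z - z₀) ^ k)
    rw [hn] at this
    linarith
  · have hsub : closedBall z₀ ‖z - z₀‖ ⊆ ball z₀ ρ :=
      closedBall_subset_ball (by simpa [dist_eq_norm] using hz)
    have hd : ∀ w ∈ closedBall z₀ ‖z - z₀‖, HasDerivWithinAt
        (fun w => G w - g z₀ * ((w - z₀) ^ (k + 1) / (k + 1))) (f w - g z₀ * (w - z₀) ^ k)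
        (closedBall z₀ ‖z - z₀‖) w := by
      intro w hw
      have h2 : HasDerivAt (fun w : ℂ => (w - z₀) ^ (k + 1) / (k + 1)) ((w - z₀) ^ k) w := by
        have := (((hasDerivAt_id w).sub_const z₀).pow (k + 1)).div_const ((k : ℂ) + 1)
        convert! this using 1
        have : (k : ℂ) + 1 ≠ 0 := by exact_mod_cast k.succ_ne_zero
        simp
        field_simp
      exact (((hb w (hsub hw)).2.2).sub (h2.const_mul (g z₀))).hasDerivWithinAt
    have hbd : ∀ w ∈ closedBall z₀ ‖z - z₀‖,
        ‖f w - g z₀ * (w - z₀) ^ k‖ ≤ δ' * A * ‖z - z₀‖ ^ k := by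
      intro w hw
      refine (hmain w (hsub hw)).trans ?_
      have : ‖w - z₀‖ ≤ ‖z - z₀‖ := by simpa [dist_eq_norm] using hw
      gcongr
    have hmv := (convex_closedBall z₀ ‖z - z₀‖).norm_image_sub_le_of_norm_hasDerivWithin_le hd hbd
      (x := z₀) (y := z) (by simp) (by simp [dist_eq_norm])
    simp only [hG0, sub_self, ne_eq, Nat.add_eq_zero_iff, one_ne_zero, and_false,
      not_false_eq_true, zero_pow, zero_div, mul_zero, sub_zero] at hmv
    have h3 := norm_sub_norm_le (g z₀ * ((z - z₀) ^ (k + 1) / (k + 1))) (G z)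
    rw [norm_sub_rev] at h3
    have h4 : ‖g z₀ * ((z - z₀) ^ (k + 1) / ((k : ℂ) + 1))‖
        = A / (k + 1) * ‖z - z₀‖ ^ (k + 1) := by
      rw [norm_mul, norm_div, norm_pow]
      have : ‖(k : ℂ) + 1‖ = k + 1 := by
        have := Complex.norm_natCast (k + 1)
        push_cast at this
        exact this
      rw [this]
      ring
    rw [h4] at h3
    have h5 : δ' * A * ‖z - z₀‖ ^ k * ‖z - z₀‖ = δ * A / (k + 1) * ‖z - z₀‖ ^ (k + 1) := by
      rw [hδ']; ring
    rw [h5] at hmv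
    have h6 : (1 - δ) * A / (k + 1) * ‖z - z₀‖ ^ (k + 1) = A / (k + 1) * ‖z - z₀‖ ^ (k + 1)
      - δ * A / (k + 1) * ‖z - z₀‖ ^ (k + 1) := by ring
    linarith

namespace HolomorphicOneForm

variable {X : Type*} [TopologicalSpace X] [ChartedSpace ℂ X] [IsManifold 𝓘(ℂ) ω X]
variable {η : HolomorphicOneForm X} {ψ ψ' : ℂ → X} {z : ℂ}

/-- The radius of a chart disk around `p` on which a primitive of `η` is chosen. -/
noncomputable def primRadius (η : HolomorphicOneForm X) (p : X) : ℝ :=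
  (exists_isPrimitiveOn_chartAt η p).choose

/-- A primitive of `η` in the preferred chart around `p` that vanishes at `p`. -/
noncomputable def prim (η : HolomorphicOneForm X) (p : X) : ℂ → ℂ :=
  (exists_isPrimitiveOn_chartAt η p).choose_spec.2.choose

theorem primRadius_pos (η : HolomorphicOneForm X) (p : X) : 0 < η.primRadius p :=
  (exists_isPrimitiveOn_chartAt η p).choose_spec.1

theorem prim_apply_self (η : HolomorphicOneForm X) (p : X) : η.prim p (chartAt ℂ p p) = 0 :=
  (exists_isPrimitiveOn_chartAt η p).choose_spec.2.choose_spec.1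

theorem isPrimitiveOn_prim (η : HolomorphicOneForm X) (p : X) :
    η.IsPrimitiveOn p (η.prim p) (ball (chartAt ℂ p p) (η.primRadius p)) :=
  (exists_isPrimitiveOn_chartAt η p).choose_spec.2.choose_spec.2

/-- The open chart disk of radius `ρ` around `p`. -/
def chartBall (p : X) (ρ : ℝ) : Set X :=
  (chartAt ℂ p).source ∩ chartAt ℂ p ⁻¹' ball (chartAt ℂ p p) ρ

omit [IsManifold 𝓘(ℂ) ω X] in
theorem isOpen_chartBall (p : X) (ρ : ℝ) : IsOpen (chartBall p ρ) :=
  (chartAt ℂ p).isOpen_inter_preimage isOpen_ball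

omit [IsManifold 𝓘(ℂ) ω X] in
theorem self_mem_chartBall (p : X) {ρ : ℝ} (hρ : 0 < ρ) : p ∈ chartBall p ρ :=
  ⟨mem_chart_source ℂ p, mem_ball_self hρ⟩

omit [IsManifold 𝓘(ℂ) ω X] in
theorem closure_chartBall_subset [T2Space X] {p : X} {ρ : ℝ}
    (h : closedBall (chartAt ℂ p p) ρ ⊆ (chartAt ℂ p).target) :
    closure (chartBall p ρ) ⊆
      (chartAt ℂ p).source ∩ chartAt ℂ p ⁻¹' closedBall (chartAt ℂ p p) ρ := by
  have hK : IsCompact ((chartAt ℂ p).symm '' closedBall (chartAt ℂ p p) ρ) :=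
    (isCompact_closedBall _ _).image_of_continuousOn ((chartAt ℂ p).continuousOn_symm.mono h)
  refine (closure_minimal ?_ hK.isClosed).trans ?_
  · rintro x ⟨hx1, hx2⟩
    exact ⟨chartAt ℂ p x, ball_subset_closedBall hx2, (chartAt ℂ p).left_inv hx1⟩
  · rintro _ ⟨w, hw, rfl⟩
    exact ⟨(chartAt ℂ p).map_target (h hw), by simpa [(chartAt ℂ p).right_inv (h hw)] using hw⟩

omit [IsManifold 𝓘(ℂ) ω X] in
theorem hasBasis_chartBall (p : X) : (𝓝 p).HasBasis (fun ρ : ℝ => 0 < ρ) (chartBall p) := by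
  have h := (chartAt ℂ p).nhds_eq_comap_inf_principal (mem_chart_source ℂ p)
  rw [h]
  refine ((nhds_basis_ball.comap _).inf_principal _).to_hasBasis ?_ ?_
  · exact fun ρ hρ => ⟨ρ, hρ, fun x hx => ⟨hx.2, hx.1⟩⟩
  · exact fun ρ hρ => ⟨ρ, hρ, fun x hx => ⟨hx.2, hx.1⟩⟩

/-- A chart disk around `σ` in which `η` has no zero except possibly `σ`, and such that `m` is a
lower bound of the primitive of `η` on the boundary. -/
structure IsZeroDisk (η : HolomorphicOneForm X) (σ : X) (ρ m : ℝ) : Prop where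
  radius_pos : 0 < ρ
  bound_pos : 0 < m
  subset : closedBall (chartAt ℂ σ σ) ρ ⊆ ball (chartAt ℂ σ σ) (η.primRadius σ)
  ne_zero : ∀ w ∈ closedBall (chartAt ℂ σ σ) ρ, w ≠ chartAt ℂ σ σ → η.coeff σ w ≠ 0
  le_norm : ∀ w ∈ sphere (chartAt ℂ σ σ) ρ, m ≤ ‖η.prim σ w‖

theorem exists_bounds_prim {σ : X} {k : ℕ} (hk : η.order σ = k) :
    ∃ A > 0, ∀ δ > 0, ∀ᶠ z in 𝓝 (chartAt ℂ σ σ),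
      (1 - δ) * A * ‖z - chartAt ℂ σ σ‖ ^ k ≤ ‖η.coeff σ z‖ ∧
      ‖η.coeff σ z‖ ≤ (1 + δ) * A * ‖z - chartAt ℂ σ σ‖ ^ k ∧
      (1 - δ) * A / (k + 1) * ‖z - chartAt ℂ σ σ‖ ^ (k + 1) ≤ ‖η.prim σ z‖ := by
  refine exists_bounds_of_analyticOrderAt_eq ?_ hk ?_ (prim_apply_self η σ)
  · exact (η.differentiableOn_coeff σ).analyticAt
      ((chartAt ℂ σ).open_target.mem_nhds (mem_chart_target ℂ σ))
  · exact eventually_of_mem (ball_mem_nhds _ (η.primRadius_pos σ)) (η.isPrimitiveOn_prim σ).2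

theorem exists_isZeroDisk {σ : X} {k : ℕ} (hk : η.order σ = k) {ρ₀ : ℝ} (hρ₀ : 0 < ρ₀) :
    ∃ ρ ≤ ρ₀, ∃ m, η.IsZeroDisk σ ρ m := by
  obtain ⟨A, hA, h⟩ := exists_bounds_prim hk
  obtain ⟨ρ, hρ, hb⟩ := Metric.eventually_nhds_iff_ball.1 ((h (1 / 2) (by norm_num)).and
    (ball_mem_nhds _ (η.primRadius_pos σ)))
  set ρ' := min (ρ / 2) ρ₀ with hρ'
  have hρ'0 : 0 < ρ' := by positivity
  have hlt : ρ' < ρ := (min_le_left _ _).trans_lt (by linarith)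
  have hsub := closedBall_subset_ball (x := chartAt ℂ σ σ) hlt
  refine ⟨ρ', min_le_right _ _, (1 - 1 / 2) * A / (k + 1) * ρ' ^ (k + 1), hρ'0, ?_,
    fun w hw => (hb w (hsub hw)).2, fun w hw hne => ?_, fun w hw => ?_⟩
  · norm_num
    positivity
  · have h1 := (hb w (hsub hw)).1.1
    have h2 : 0 < ‖w - chartAt ℂ σ σ‖ := norm_pos_iff.2 (sub_ne_zero.2 hne)
    rw [← norm_pos_iff]
    refine lt_of_lt_of_le ?_ h1
    norm_num
    positivity
  · have h1 := (hb w (hsub (sphere_subset_closedBall hw))).1.2.2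
    rwa [mem_sphere_iff_norm.1 hw] at h1

theorem IsZeroDisk.closure_subset [T2Space X] {σ : X} {ρ m : ℝ} (h : η.IsZeroDisk σ ρ m) :
    closure (chartBall σ ρ) ⊆
      (chartAt ℂ σ).source ∩ chartAt ℂ σ ⁻¹' closedBall (chartAt ℂ σ σ) ρ :=
  closure_chartBall_subset (h.subset.trans (η.isPrimitiveOn_prim σ).1)

theorem IsZeroDisk.eq_of_mem [T2Space X] {σ τ : X} {ρ m : ℝ} (h : η.IsZeroDisk σ ρ m)
    (hτ : τ ∈ closure (chartBall σ ρ)) (hτs : τ ∈ η.singularities) : τ = σ := by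
  obtain ⟨h1, h2⟩ := h.closure_subset hτ
  by_contra hne
  refine h.ne_zero _ h2 (fun he => hne ?_) ((coeff_eq_zero_iff η σ h1).2 hτs)
  exact (chartAt ℂ σ).injOn h1 (mem_chart_source ℂ σ) he

/-- A flat map cannot leave the zero disk: on the rim the primitive has norm at least `m`, but it
equals z - s, which is shorter than `m` on `W`. Hence the set where both conclusions hold is open
and closed in `W`. -/
theorem IsZeroDisk.forall_mem [T2Space X] {σ : X} {ρ m : ℝ} (h : η.IsZeroDisk σ ρ m) {W : Set ℂ}
    (hW : IsOpen W) (hWc : IsPreconnected W) (hψ : η.FlatOn ψ W) {s z₀ : ℂ} (hWs : W ⊆ ball s m)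
    (hz₀ : z₀ ∈ W) (h1 : ψ z₀ ∈ chartBall σ ρ)
    (h2 : η.prim σ (chartAt ℂ σ (ψ z₀)) = z₀ - s) :
    ∀ z ∈ W, ψ z ∈ chartBall σ ρ ∧ η.prim σ (chartAt ℂ σ (ψ z)) = z - s := by
  have hP := η.isPrimitiveOn_prim σ
  set u : Set ℂ := {z | z ∈ W ∧ ψ z ∈ chartBall σ ρ ∧ η.prim σ (chartAt ℂ σ (ψ z)) = z - s} with hu
  have huo : IsOpen u := by
    rw [isOpen_iff_mem_nhds]
    rintro z ⟨hzW, hz1, hz2⟩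
    have e1 := eventually_primitive_eq isOpen_ball hP hz1.1
      (h.subset (ball_subset_closedBall hz1.2)) (hψ.eventually hW hzW)
    have e2 := (hψ z hzW).1.preimage_mem_nhds ((isOpen_chartBall σ ρ).mem_nhds hz1)
    filter_upwards [hW.mem_nhds hzW, e1, e2] with y hy1 hy2 hy3
    exact ⟨hy1, hy3, by rw [hy2, hz2]; ring⟩
  have hsub : W ⊆ u := by
    refine hWc.subset_of_closure_inter_subset huo ⟨z₀, hz₀, hz₀, h1, h2⟩ ?_
    rintro z ⟨hzu, hzW⟩
    have hc := (hψ z hzW).1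
    have hfr := mem_closure_iff_frequently.1 hzu
    have hcl : ψ z ∈ closure (chartBall σ ρ) := by
      rw [mem_closure_iff_frequently]
      exact hc.tendsto.frequently (hfr.mono fun y hy => hy.2.1)
    obtain ⟨hs, hb⟩ := h.closure_subset hcl
    have hcont : ContinuousAt (fun y => η.prim σ (chartAt ℂ σ (ψ y)) - (y - s)) z := by
      have h3 : ContinuousAt (chartAt ℂ σ ∘ ψ) z := ((chartAt ℂ σ).continuousAt hs).comp hc
      have h4 : ContinuousAt (fun y => η.prim σ (chartAt ℂ σ (ψ y))) z :=
        ContinuousAt.comp (f := chartAt ℂ σ ∘ ψ) (hP.2 _ (h.subset hb)).continuousAt h3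
      exact h4.sub (by fun_prop)
    have heq : η.prim σ (chartAt ℂ σ (ψ z)) - (z - s) = 0 := by
      by_contra hne
      obtain ⟨y, hy1, hy2⟩ := (hfr.and_eventually (hcont.eventually_ne hne)).exists
      exact hy2 (by rw [hy1.2.2]; ring)
    have heq' := sub_eq_zero.1 heq
    refine ⟨hzW, ⟨hs, ?_⟩, heq'⟩
    by_contra hnb
    have hsph : chartAt ℂ σ (ψ z) ∈ sphere (chartAt ℂ σ σ) ρ := by
      simp only [mem_preimage, mem_closedBall, mem_ball, mem_sphere, not_lt] at hb hnb ⊢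
      exact le_antisymm hb hnb
    have := h.le_norm _ hsph
    rw [heq'] at this
    have h5 := hWs hzW
    rw [mem_ball_iff_norm] at h5
    linarith
  exact fun z hz => (hsub hz).2

/-- A flat map on a disk converges to a zero of `η` at every singular boundary point. -/
theorem IsSingularAt.exists_limit [T2Space X] [CompactSpace X] {c s : ℂ} {r : ℝ} (hr : 0 < r)
    (h : η.IsSingularAt ψ c r s) (hψ : η.FlatOn ψ (ball c r)) (hs : s ∈ sphere c r) :
    ∃ σ ∈ η.singularities, ∀ ρ m, η.IsZeroDisk σ ρ m →
      ∀ z ∈ ball c r ∩ ball s m, ψ z ∈ chartBall σ ρ ∧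
        η.prim σ (chartAt ℂ σ (ψ z)) = z - s := by
  have hpB : ∀ᶠ t : ℝ in 𝓝[<] 1, AffineMap.lineMap c s t ∈ ball c r := by
    filter_upwards [Ioo_mem_nhdsLT (show (0 : ℝ) < 1 by norm_num)] with t ht
    rw [mem_ball, dist_lineMap_left, dist_comm, mem_sphere.1 hs, Real.norm_of_nonneg ht.1.le]
    nlinarith [ht.2]
  have hps : Tendsto (fun t : ℝ => AffineMap.lineMap c s t) (𝓝[<] 1) (𝓝 s) := by
    have : Continuous (fun t : ℝ => (AffineMap.lineMap c s t : ℂ)) := AffineMap.lineMap_continuous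
    have h1 := this.tendsto 1
    rw [AffineMap.lineMap_apply_one] at h1
    exact h1.mono_left nhdsWithin_le_nhds
  -- The candidate is a cluster point along the radius from `c` to `s`. At a regular cluster point,
  -- the uniform flat ball around a late point of the radius would contain `s` and extend the map.
  obtain ⟨σ, hσ⟩ := exists_clusterPt_of_compactSpace
    (map (fun t : ℝ => ψ (AffineMap.lineMap c s t)) (𝓝[<] 1))
  have hfr : ∀ U ∈ 𝓝 σ, ∃ᶠ t : ℝ in 𝓝[<] 1, ψ (AffineMap.lineMap c s t) ∈ U := fun U hU =>
    (mapClusterPt_iff_frequently.1 hσ) U hU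
  have hσs : σ ∈ η.singularities := by
    by_contra hreg
    obtain ⟨ε, hε, U, hU, hfl⟩ := exists_flat_ball_of_notMem hreg
    obtain ⟨t, htU, htB, hts⟩ := ((hfr U hU).and_eventually
      (hpB.and (hps.eventually (ball_mem_nhds s hε)))).exists
    set y : ℂ := AffineMap.lineMap c s t
    obtain ⟨φ, hφ0, hφ⟩ := hfl _ htU
    have hφ' : η.FlatOn (fun w => φ (w + -y)) (ball y ε) := by
      refine (FlatOn.comp_add hφ (-y)).mono fun w hw => ?_
      rw [mem_ball_iff_norm] at hw
      simpa [← sub_eq_add_neg] using hw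
    refine h ⟨ball y ε, isOpen_ball, convex_ball _ _, by rwa [mem_ball_comm], ⟨y, htB,
      mem_ball_self hε⟩, _, hφ', ?_⟩
    exact eqOn_of_flat (isOpen_ball.inter isOpen_ball)
      ((convex_ball c r).inter (convex_ball y ε)).isPreconnected
      (hφ'.mono inter_subset_right) (hψ.mono inter_subset_left) ⟨htB, mem_ball_self hε⟩
      (by simpa using hφ0)
  refine ⟨σ, hσs, fun ρ m hρ => ?_⟩
  have hP := η.isPrimitiveOn_prim σ
  have hGc : ContinuousAt (fun x => η.prim σ (chartAt ℂ σ x)) σ :=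
    ContinuousAt.comp (f := chartAt ℂ σ)
      (hP.2 _ (mem_ball_self (η.primRadius_pos σ))).continuousAt
      ((chartAt ℂ σ).continuousAt (mem_chart_source ℂ σ))
  have hsmall : ∀ ε > 0, ∀ᶠ x in 𝓝 σ, ‖η.prim σ (chartAt ℂ σ x)‖ < ε := by
    intro ε hε
    have := hGc.eventually (ball_mem_nhds _ hε)
    simpa [prim_apply_self] using this
  have hm := hρ.bound_pos
  obtain ⟨t, ⟨htU, htG⟩, htB, hts⟩ := ((hfr _ (((isOpen_chartBall σ ρ).eventually_mem
    (self_mem_chartBall σ hρ.radius_pos)).and (hsmall (m / 3) (by positivity)))).and_eventually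
      (hpB.and (hps.eventually (ball_mem_nhds s (show 0 < m / 3 by positivity))))).exists
  set y : ℂ := AffineMap.lineMap c s t
  -- On the disk near `s'` the primitive is z - s'. Along the radius it becomes arbitrarily small
  -- while z tends to `s`, so s' = s. The two bounds m/3 guarantee that `s` lies within `m` of `s'`.
  set s' : ℂ := y - η.prim σ (chartAt ℂ σ (ψ y)) with hs'
  have hyW : y ∈ ball c r ∩ ball s' m := by
    refine ⟨htB, ?_⟩
    rw [mem_ball_iff_norm, hs', sub_sub_cancel]
    linarith
  have hall := hρ.forall_mem (W := ball c r ∩ ball s' m) (isOpen_ball.inter isOpen_ball)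
    ((convex_ball c r).inter (convex_ball s' m)).isPreconnected (hψ.mono inter_subset_left)
    inter_subset_right hyW htU (by rw [hs']; ring)
  have hss : s' = s := by
    by_contra hne
    have hpos : 0 < ‖s' - s‖ := norm_pos_iff.2 (sub_ne_zero.2 hne)
    have hsW : s ∈ ball s' m := by
      rw [mem_ball_iff_norm, hs']
      rw [dist_eq_norm] at hts
      calc ‖s - (y - η.prim σ (chartAt ℂ σ (ψ y)))‖
          = ‖η.prim σ (chartAt ℂ σ (ψ y)) - (y - s)‖ := by ring_nf
        _ ≤ _ := norm_sub_le _ _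
        _ < m := by linarith
    obtain ⟨t', htG', htB', hts', hts''⟩ := ((hfr _ (hsmall (‖s' - s‖ / 2) (by positivity))).and_eventually
      (hpB.and ((hps.eventually (isOpen_ball.mem_nhds hsW)).and
        (hps.eventually (ball_mem_nhds s (show 0 < ‖s' - s‖ / 2 by positivity)))))).exists
    have h3 := (hall _ ⟨htB', hts'⟩).2
    rw [mem_ofPred_eq, h3] at htG'
    rw [dist_eq_norm] at hts''
    have := norm_sub_le (AffineMap.lineMap c s t' - s) (AffineMap.lineMap c s t' - s')
    rw [sub_sub_sub_cancel_left] at this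
    linarith
  rwa [hss] at hall

end HolomorphicOneForm

/-! ### The flat distance and the covering radius -/

namespace HolomorphicOneForm

variable {X : Type*} [TopologicalSpace X] [ChartedSpace ℂ X] [IsManifold 𝓘(ℂ) ω X]
variable {η : HolomorphicOneForm X} {ψ ψ' : ℂ → X} {z : ℂ}

variable (X) in
theorem isManifold_real : IsManifold 𝓘(ℝ, ℂ) 1 X := by
  refine isManifold_of_contDiffOn _ _ _ fun e e' he he' => ?_
  have h := (mem_groupoid_of_pregroupoid.mp
    ((contDiffGroupoid ω 𝓘(ℂ)).compatible he he')).1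
  have h' : ContDiffOn ℂ ω (e.symm.trans e') (e.symm.trans e').source := by
    simpa [contDiffPregroupoid] using h
  simpa using (h'.of_le (m := 1) (by simp)).restrict_scalars ℝ

theorem eval_mfderiv_curve (η : HolomorphicOneForm X) {γ : ℝ → X} {t : ℝ} {p : X}
    (hγ : MDifferentiableAt 𝓘(ℝ, ℝ) 𝓘(ℝ, ℂ) γ t) (hp : γ t ∈ (chartAt ℂ p).source) :
    η.eval (γ t) (mfderiv 𝓘(ℝ, ℝ) 𝓘(ℝ, ℂ) γ t (1 : ℝ)) =
      η.coeff p (chartAt ℂ p (γ t)) * deriv (chartAt ℂ p ∘ γ) t := by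
  have hx := mem_chart_source ℂ (γ t)
  have h1 : DifferentiableAt ℝ (chartAt ℂ (γ t) ∘ γ) t := by
    have := hγ.2
    simp only [mfld_simps, DifferentiableWithinAtProp,
      differentiableWithinAt_univ] at this
    exact this
  have h2 : mfderiv 𝓘(ℝ, ℝ) 𝓘(ℝ, ℂ) γ t (1 : ℝ) = deriv (chartAt ℂ (γ t) ∘ γ) t := by
    refine (DFunLike.congr_fun hγ.mfderiv (1 : ℝ)).trans ?_
    simp only [writtenInExtChartAt, mfld_simps, fderivWithin_univ]
    rw [← fderiv_apply_one_eq_deriv]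
    rfl
  have hT := hasDerivAt_transition p (γ t) hx hp
  have h3 : HasDerivAt (chartAt ℂ p ∘ γ)
      (deriv (chartAt ℂ p ∘ (chartAt ℂ (γ t)).symm) (chartAt ℂ (γ t) (γ t)) *
        deriv (chartAt ℂ (γ t) ∘ γ) t) t := by
    refine (HasDerivAt.comp (h := chartAt ℂ (γ t) ∘ γ) t hT h1.hasDerivAt).congr_of_eventuallyEq ?_
    filter_upwards [hγ.continuousAt.preimage_mem_nhds
      ((chartAt ℂ (γ t)).open_source.mem_nhds hx)] with s hs
    simp [(chartAt ℂ (γ t)).left_inv hs]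
  refine (eval_eq η (γ t) _).trans ?_
  rw [h3.deriv, coeff_eq η p hp]
  have := deriv_transition_mul p (γ t) hx hp
  refine (congrArg (fun v : ℂ => η.coeffAt (γ t) * v) h2).trans ?_
  linear_combination (-η.coeffAt (γ t) * deriv (chartAt ℂ (γ t) ∘ γ) t) * this

/-- The primitive along `γ` moves at the flat speed of `γ`, so its displacement is at most the flat
length. -/
theorem enorm_prim_sub_le (η : HolomorphicOneForm X) {γ : ℝ → X} {a b : ℝ} (hab : a ≤ b) {p : X}
    (hγ : ContMDiffOn 𝓘(ℝ, ℝ) 𝓘(ℝ, ℂ) 1 γ (Icc a b))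
    (hmem : ∀ t ∈ Icc a b, γ t ∈ chartBall p (η.primRadius p)) :
    ‖η.prim p (chartAt ℂ p (γ b)) - η.prim p (chartAt ℂ p (γ a))‖ₑ ≤
      letI : ∀ x : X, ENorm (TangentSpace 𝓘(ℝ, ℂ) x) := η.flatENorm
      Manifold.pathELength 𝓘(ℝ, ℂ) γ a b := by
  have := isManifold_real X
  let _ : ∀ x : X, ENorm (TangentSpace 𝓘(ℝ, ℂ) x) := η.flatENorm
  have hP := η.isPrimitiveOn_prim p
  have hc1 : ContDiffOn ℝ 1 (chartAt ℂ p ∘ γ) (Icc a b) := by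
    have h := (contMDiffOn_chart (I := 𝓘(ℝ, ℂ)) (n := 1) (x := p)).comp hγ fun t ht => (hmem t ht).1
    exact contMDiffOn_iff_contDiffOn.1 h
  have hc2 : ContDiffOn ℝ 1 (η.prim p) (ball (chartAt ℂ p p) (η.primRadius p)) := by
    have hd : DifferentiableOn ℂ (η.prim p) (ball (chartAt ℂ p p) (η.primRadius p)) :=
      fun y hy => (hP.2 y hy).differentiableAt.differentiableWithinAt
    exact (hd.contDiffOn isOpen_ball).restrict_scalars ℝ
  have hc : ContDiffOn ℝ 1 (η.prim p ∘ (chartAt ℂ p ∘ γ)) (Icc a b) :=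
    hc2.comp hc1 fun t ht => (hmem t ht).2
  refine (enorm_sub_le_lintegral_deriv_of_contDiffOn_Icc hc hab).trans (le_of_eq ?_)
  rw [Manifold.pathELength_eq_lintegral_mfderiv_Icc, ← restrict_Ioo_eq_restrict_Icc]
  refine setLIntegral_congr_fun measurableSet_Ioo fun t ht => ?_
  have htI := Ioo_subset_Icc_self ht
  have hnhds := Icc_mem_nhds ht.1 ht.2
  have hdγ : MDifferentiableAt 𝓘(ℝ, ℝ) 𝓘(ℝ, ℂ) γ t :=
    ((hγ t htI).contMDiffAt hnhds).mdifferentiableAt (by simp)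
  have hd1 : HasDerivAt (chartAt ℂ p ∘ γ) (deriv (chartAt ℂ p ∘ γ) t) t :=
    ((hc1.contDiffAt hnhds).differentiableAt (by simp)).hasDerivAt
  have h2 := HasDerivAt.comp t (hP.2 _ (hmem t htI).2) hd1
  have h3 := eval_mfderiv_curve η hdγ (hmem t htI).1
  rw [h2.deriv]
  exact congrArg (fun v : ℂ => ‖v‖ₑ) h3.symm

/-- The centre of an embedded flat disk of radius `r` has distance at least `r` from the zeros. -/
theorem FlatOn.ofReal_le_flatEDist [T2Space X] {c : ℂ} {r : ℝ} (hψ : η.FlatOn ψ (ball c r)) {σ : X}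
    (hσ : σ ∈ η.singularities) : ENNReal.ofReal r ≤ η.flatEDist (ψ c) σ := by
  let _ : ∀ x : X, ENorm (TangentSpace 𝓘(ℝ, ℂ) x) := η.flatENorm
  by_contra! hlt
  have hr : 0 < r := by
    by_contra! h
    rw [ENNReal.ofReal_of_nonpos h] at hlt
    exact not_lt_bot hlt
  obtain ⟨γ, hγ0, hγ1, hγ, hL⟩ := Manifold.exists_lt_of_riemannianEDist_lt hlt
  set L : ℝ → ℝ≥0∞ := fun t => Manifold.pathELength 𝓘(ℝ, ℂ) γ 0 t with hLdef
  -- Path lifting by continuous induction: `γ t` has a preimage no farther from the centre than the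
  -- length travelled. Neither continuity of the lift nor injectivity of `ψ` is needed.
  set P : ℝ → Prop := fun t => ∃ z, ψ z = γ t ∧ ‖z - c‖ₑ ≤ L t with hPdef
  have hLr : ∀ t ≤ 1, L t < ENNReal.ofReal r := fun t ht =>
    (Manifold.pathELength_mono le_rfl ht).trans_lt hL
  have hball : ∀ z, ‖z - c‖ₑ < ENNReal.ofReal r → z ∈ ball c r := fun z hz => by
    rw [mem_ball_iff_norm]
    rwa [← ofReal_norm, ENNReal.ofReal_lt_ofReal_iff hr] at hz
  have hP0 : P 0 := ⟨c, hγ0.symm, by simp⟩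
  set S : Set ℝ := {t | ∀ t' ∈ Icc 0 t, P t'} with hS
  have hcl : IsClosed (S ∩ Icc 0 1) := by
    refine isClosed_of_closure_subset fun t ht => ?_
    have htI : t ∈ Icc (0 : ℝ) 1 := closure_minimal inter_subset_right isClosed_Icc ht
    have hlt' : ∀ t' ∈ Ico 0 t, P t' := by
      intro t' ht'
      obtain ⟨u, hu1, hu2⟩ := mem_closure_iff.1 ht (Ioi t') isOpen_Ioi ht'.2
      exact hu2.1 t' ⟨ht'.1, le_of_lt hu1⟩
    refine ⟨fun t' ht' => ?_, htI⟩
    rcases ht'.2.lt_or_eq with h | rfl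
    · exact hlt' t' ⟨ht'.1, h⟩
    rcases ht'.1.lt_or_eq with h0 | rfl
    swap
    · exact hP0
    choose! w hw1 hw2 using hlt'
    have hev : ∀ᶠ u in 𝓝[<] t', u ∈ Ico 0 t' := by
      filter_upwards [Ioo_mem_nhdsLT h0] with u hu using ⟨hu.1.le, hu.2⟩
    have hwK : ∀ᶠ u in 𝓝[<] t', w u ∈ closedBall c (L t').toReal := by
      filter_upwards [hev] with u hu
      have h1 := (hw2 u hu).trans (Manifold.pathELength_mono le_rfl hu.2.le : L u ≤ L t')
      rw [mem_closedBall_iff_norm]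
      rw [← ofReal_norm] at h1
      exact (ENNReal.ofReal_le_iff_le_toReal (hLr t' htI.2).ne_top).1 h1
    -- Earlier preimages stay in a closed disk of radius `L t'` < r; a cluster point of them is a
    -- preimage of `γ t'`.
    obtain ⟨y, hyK, hy⟩ := (isCompact_closedBall c (L t').toReal).exists_mapClusterPt_of_frequently
      hwK.frequently
    have hyL : ‖y - c‖ₑ ≤ L t' := by
      rw [mem_closedBall_iff_norm] at hyK
      rw [← ofReal_norm]
      exact (ENNReal.ofReal_le_iff_le_toReal (hLr t' htI.2).ne_top).2 hyK
    have hyB := hball y (hyL.trans_lt (hLr t' htI.2))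
    refine ⟨y, ?_, hyL⟩
    have h3 : MapClusterPt (ψ y) (𝓝[<] t') (ψ ∘ w) := hy.continuousAt_comp (hψ y hyB).1
    have hγc : Tendsto γ (𝓝[<] t') (𝓝 (γ t')) := by
      have := hγ.continuousOn t' htI
      refine this.mono_left ?_
      rw [nhdsWithin_le_iff]
      filter_upwards [hev] with u hu using ⟨hu.1, hu.2.le.trans htI.2⟩
    have h4 : Tendsto (ψ ∘ w) (𝓝[<] t') (𝓝 (γ t')) :=
      hγc.congr' (by filter_upwards [hev] with u hu using (hw1 u hu).symm)
    have : (𝓝 (ψ y) ⊓ 𝓝 (γ t')).NeBot := h3.clusterPt.mono h4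
    exact eq_of_nhds_neBot this
  have hsub : Icc (0 : ℝ) 1 ⊆ S := by
    refine hcl.Icc_subset_of_forall_exists_gt (fun t' ht' => ?_) ?_
    · rwa [le_antisymm ht'.2 ht'.1]
    rintro t ⟨htS, ht0, ht1⟩ y hy
    obtain ⟨w, hw1, hw2⟩ := htS t ⟨ht0, le_rfl⟩
    have hwB := hball w (hw2.trans_lt (hLr t ht1.le))
    have hs : ψ w ∈ (chartAt ℂ (γ t)).source := by rw [hw1]; exact mem_chart_source ℂ _
    have hP := η.isPrimitiveOn_prim (γ t)
    have e1 := eventually_apply_primitive_eq isOpen_ball hP hs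
      (by rw [hw1]; exact mem_ball_self (η.primRadius_pos _)) (hψ.eventually isOpen_ball hwB)
    rw [hw1] at e1
    have e2 := (isOpen_chartBall (γ t) (η.primRadius (γ t))).eventually_mem
      (self_mem_chartBall (γ t) (η.primRadius_pos _))
    have hγc : Tendsto γ (𝓝[Icc 0 1] t) (𝓝 (γ t)) := hγ.continuousOn t ⟨ht0, ht1.le⟩
    obtain ⟨δ, hδ, hb⟩ := Metric.mem_nhdsWithin_iff.1 (hγc.eventually (e1.and e2))
    set t₁ := min (min (t + δ / 2) y) 1 with ht₁
    have hlt1 : t < t₁ := lt_min (lt_min (by linarith) hy) ht1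
    have hle1 : t₁ ≤ 1 := min_le_right _ _
    have hleδ : t₁ ≤ t + δ / 2 := (min_le_left _ _).trans (min_le_left _ _)
    have hgood : ∀ u ∈ Icc t t₁, ψ (w + (η.prim (γ t) (chartAt ℂ (γ t) (γ u)) -
        η.prim (γ t) (chartAt ℂ (γ t) (γ t)))) = γ u ∧
        γ u ∈ chartBall (γ t) (η.primRadius (γ t)) := by
      intro u hu
      refine hb ⟨?_, ht0.trans hu.1, hu.2.trans hle1⟩
      rw [mem_ball, Real.dist_eq, abs_of_nonneg (by linarith [hu.1])]
      linarith [hu.2]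
    refine ⟨t₁, fun u hu => ?_, hlt1, (min_le_left _ _).trans (min_le_right _ _)⟩
    rcases le_or_gt u t with hut | hut
    · exact htS u ⟨hu.1, hut⟩
    · refine ⟨_, (hgood u ⟨hut.le, hu.2⟩).1, ?_⟩
      have h5 := enorm_prim_sub_le η hut.le (p := γ t)
        (hγ.mono (Icc_subset_Icc ht0 (hu.2.trans hle1)))
        fun v hv => (hgood v ⟨hv.1, hv.2.trans hu.2⟩).2
      have h6 : L u = L t + Manifold.pathELength 𝓘(ℝ, ℂ) γ t u :=
        (Manifold.pathELength_add ht0 hut.le).symm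
      rw [h6, add_sub_right_comm]
      exact (enorm_add_le _ _).trans (add_le_add hw2 h5)
  -- At time 1 a point of the disk would map to a zero, but flat maps avoid the zeros.
  obtain ⟨w, hw1, hw2⟩ := hsub (right_mem_Icc.2 zero_le_one) 1 ⟨zero_le_one, le_rfl⟩
  refine (hψ w (hball w (hw2.trans_lt hL))).notMem_singularities ?_
  rwa [hw1, hγ1]

theorem enormSMulClass (η : HolomorphicOneForm X) :
    let _ : ∀ x : X, ENorm (TangentSpace 𝓘(ℝ, ℂ) x) := η.flatENorm
    ∀ x : X, ENormSMulClass ℝ (TangentSpace 𝓘(ℝ, ℂ) x) := by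
  intro _ x
  refine ⟨fun c v => ?_⟩
  have h : η.eval x (c • v) = (c : ℂ) * η.eval x v := by
    refine (eval_eq η x _).trans ?_
    rw [eval_eq η x v]
    exact mul_left_comm (G := ℂ) _ _ _
  change ‖η.eval x (c • v)‖ₑ = ‖c‖ₑ * ‖η.eval x v‖ₑ
  rw [h, enorm_mul]
  congr 1
  simp [enorm_eq_nnnorm]

theorem eventually_flatEDist_le (η : HolomorphicOneForm X) (p : X) :
    ∃ C < ⊤, ∀ᶠ x in 𝓝 p, η.flatEDist p x ≤ C := by
  have := isManifold_real X
  let _ : ∀ x : X, ENorm (TangentSpace 𝓘(ℝ, ℂ) x) := η.flatENorm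
  have := η.enormSMulClass
  obtain ⟨ρ, hρ, hsub⟩ := Metric.isOpen_iff.1 (chartAt ℂ p).open_target _ (mem_chart_target ℂ p)
  have hsub' : closedBall (chartAt ℂ p p) (ρ / 2) ⊆ (chartAt ℂ p).target :=
    (closedBall_subset_ball (by linarith)).trans hsub
  obtain ⟨C, hC⟩ := (isCompact_closedBall (chartAt ℂ p p) (ρ / 2)).exists_bound_of_continuousOn
    ((η.differentiableOn_coeff p).continuousOn.mono hsub')
  refine ⟨ENNReal.ofReal (C * (ρ / 2)), ENNReal.ofReal_lt_top, ?_⟩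
  filter_upwards [(isOpen_chartBall p (ρ / 2)).mem_nhds
    (self_mem_chartBall p (show 0 < ρ / 2 by positivity))] with x hx
  set w := chartAt ℂ p x with hw
  set w₀ := chartAt ℂ p p with hw₀
  have hwb : ‖w - w₀‖ ≤ ρ / 2 := (mem_closedBall_iff_norm.1 (ball_subset_closedBall hx.2))
  have hmem : ∀ t ∈ Icc (0 : ℝ) 1, w₀ + t * (w - w₀) ∈ closedBall w₀ (ρ / 2) := by
    intro t ht
    rw [mem_closedBall_iff_norm, add_sub_cancel_left, norm_mul, Complex.norm_real,
      Real.norm_of_nonneg ht.1]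
    nlinarith [ht.1, ht.2, norm_nonneg (w - w₀)]
  have hd : ∀ t : ℝ, HasDerivAt (fun t : ℝ => w₀ + t * (w - w₀)) (w - w₀) t := by
    intro t
    simpa using ((Complex.ofRealCLM.hasDerivAt (x := t)).mul_const (w - w₀)).const_add w₀
  set γ : ℝ → X := fun t => (chartAt ℂ p).symm (w₀ + t * (w - w₀)) with hγ
  have hγs : ContMDiffOn 𝓘(ℝ, ℝ) 𝓘(ℝ, ℂ) 1 γ (Icc 0 1) := by
    refine (contMDiffOn_chart_symm (I := 𝓘(ℝ, ℂ)) (n := 1) (x := p)).comp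
      (g := (chartAt ℂ p).symm) (f := fun t : ℝ => w₀ + t * (w - w₀)) ?_
      fun t ht => hsub' (hmem t ht)
    rw [contMDiffOn_iff_contDiffOn]
    have : ContDiff ℝ 1 (fun t : ℝ => w₀ + t * (w - w₀)) :=
      contDiff_const.add (Complex.ofRealCLM.contDiff.mul contDiff_const)
    exact this.contDiffOn
  have hle := Manifold.riemannianEDist_le_pathELength hγs (x := p) (y := x)
    (by simp [hγ, hw₀]) (by simp [hγ, hw, (chartAt ℂ p).left_inv hx.1]) zero_le_one
  refine le_trans hle ?_
  rw [Manifold.pathELength_eq_lintegral_mfderiv_Ioo]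
  have hpt : ∀ t ∈ Ioo (0 : ℝ) 1, ‖mfderiv 𝓘(ℝ, ℝ) 𝓘(ℝ, ℂ) γ t (1 : ℝ)‖ₑ ≤
      ENNReal.ofReal (C * (ρ / 2)) := by
    intro t ht
    have htI := Ioo_subset_Icc_self ht
    have hdγ : MDifferentiableAt 𝓘(ℝ, ℝ) 𝓘(ℝ, ℂ) γ t :=
      ((hγs t htI).contMDiffAt (Icc_mem_nhds ht.1 ht.2)).mdifferentiableAt (by simp)
    have hs : γ t ∈ (chartAt ℂ p).source := (chartAt ℂ p).map_target (hsub' (hmem t htI))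
    have hD : deriv (chartAt ℂ p ∘ γ) t = w - w₀ := by
      refine ((hd t).congr_of_eventuallyEq ?_).deriv
      filter_upwards [Icc_mem_nhds ht.1 ht.2] with u hu
      exact (chartAt ℂ p).right_inv (hsub' (hmem u hu))
    have h3 := eval_mfderiv_curve η hdγ hs
    rw [hD] at h3
    refine (congrArg (fun v : ℂ => ‖v‖ₑ) h3).trans_le ?_
    rw [← ofReal_norm, norm_mul]
    refine ENNReal.ofReal_le_ofReal ?_
    have h4 : ‖η.coeff p (chartAt ℂ p (γ t))‖ ≤ C := by
      refine hC _ ?_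
      simp only [hγ, (chartAt ℂ p).right_inv (hsub' (hmem t htI))]
      exact hmem t htI
    exact mul_le_mul h4 hwb (norm_nonneg _) ((norm_nonneg _).trans h4)
  refine (setLIntegral_mono' measurableSet_Ioo hpt).trans ?_
  simp

theorem flatEDist_comm (η : HolomorphicOneForm X) (x y : X) :
    η.flatEDist x y = η.flatEDist y x := by
  let _ : ∀ x : X, ENorm (TangentSpace 𝓘(ℝ, ℂ) x) := η.flatENorm
  have := η.enormSMulClass
  exact Manifold.riemannianEDist_comm

theorem flatEDist_triangle (η : HolomorphicOneForm X) (x y z : X) :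
    η.flatEDist x z ≤ η.flatEDist x y + η.flatEDist y z := by
  let _ : ∀ x : X, ENorm (TangentSpace 𝓘(ℝ, ℂ) x) := η.flatENorm
  have := η.enormSMulClass
  have := isManifold_real X
  exact Manifold.riemannianEDist_triangle

theorem flatEDist_lt_top [ConnectedSpace X] (η : HolomorphicOneForm X) (x y : X) :
    η.flatEDist x y < ⊤ := by
  have hcl : IsClopen {y | η.flatEDist x y < ⊤} := by
    have key : ∀ y, ∀ᶠ w in 𝓝 y, (η.flatEDist x w < ⊤ ↔ η.flatEDist x y < ⊤) := by
      intro y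
      obtain ⟨C, hC, h⟩ := eventually_flatEDist_le η y
      filter_upwards [h] with w hw
      have hyw : η.flatEDist y w < ⊤ := hw.trans_lt hC
      refine ⟨fun h1 => (flatEDist_triangle η x w y).trans_lt ?_,
        fun h1 => (flatEDist_triangle η x y w).trans_lt ?_⟩
      · rw [flatEDist_comm η w y]
        exact ENNReal.add_lt_top.2 ⟨h1, hyw⟩
      · exact ENNReal.add_lt_top.2 ⟨h1, hyw⟩
    refine ⟨?_, ?_⟩
    · rw [← isOpen_compl_iff, isOpen_iff_mem_nhds]
      intro y hy
      filter_upwards [key y] with w hw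
      exact fun h => hy (hw.1 h)
    · rw [isOpen_iff_mem_nhds]
      intro y hy
      filter_upwards [key y] with w hw using hw.2 hy
  obtain ⟨C, hC, h⟩ := eventually_flatEDist_le η x
  have hx : x ∈ {y | η.flatEDist x y < ⊤} := (h.self_of_nhds).trans_lt hC
  have := hcl.eq_univ ⟨x, hx⟩
  exact (this ▸ mem_univ y : y ∈ {y | η.flatEDist x y < ⊤})

/-- Guards against the `toReal` in `coveringRadius`, which would turn an infinite supremum into 0.
-/
theorem iSup_distToSingularities_lt_top [CompactSpace X] [ConnectedSpace X]
    (hne : η.singularities.Nonempty) : ⨆ x, η.distToSingularities x < ⊤ := by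
  obtain ⟨σ, hσ⟩ := hne
  have h : ∃ C < ⊤, ∀ x ∈ (univ : Set X), η.flatEDist x σ ≤ C := by
    refine isCompact_univ.induction_on (p := fun s => ∃ C < ⊤, ∀ x ∈ s, η.flatEDist x σ ≤ C)
      ⟨0, by simp, by simp⟩ ?_ ?_ ?_
    · rintro s t hst ⟨C, hC, h⟩
      exact ⟨C, hC, fun x hx => h x (hst hx)⟩
    · rintro s t ⟨C, hC, h⟩ ⟨D, hD, h'⟩
      refine ⟨max C D, max_lt hC hD, ?_⟩
      rintro x (hx | hx)
      · exact (h x hx).trans (le_max_left _ _)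
      · exact (h' x hx).trans (le_max_right _ _)
    · intro p _
      obtain ⟨C, hC, h⟩ := eventually_flatEDist_le η p
      refine ⟨_, mem_nhdsWithin_of_mem_nhds h, C + η.flatEDist p σ,
        ENNReal.add_lt_top.2 ⟨hC, flatEDist_lt_top η p σ⟩, fun x hx => ?_⟩
      refine (flatEDist_triangle η x p σ).trans (add_le_add_left ?_ _)
      rw [flatEDist_comm]
      exact hx
  obtain ⟨C, hC, h⟩ := h
  exact (iSup_le fun x => (iInf₂_le σ hσ).trans (h x (mem_univ x))).trans_lt hC

/-- The radius of an embedded flat disk is at most the covering radius. -/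
theorem FlatOn.radius_le_coveringRadius [T2Space X] [CompactSpace X] [ConnectedSpace X]
    (hne : η.singularities.Nonempty) {c : ℂ} {r : ℝ} (hψ : η.FlatOn ψ (ball c r)) :
    r ≤ η.coveringRadius := by
  have h1 : ENNReal.ofReal r ≤ ⨆ x, η.distToSingularities x :=
    le_iSup_of_le (ψ c) (le_iInf₂ fun σ hσ => hψ.ofReal_le_flatEDist hσ)
  exact (ENNReal.ofReal_le_iff_le_toReal (iSup_distToSingularities_lt_top hne).ne).1 h1

end HolomorphicOneForm

/-! ### Plane geometry: empty disks of maximal power -/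

/-- The power of the point `z` with respect to the circle with centre `c` and radius `r`. -/
noncomputable def circlePower (c : ℂ) (r : ℝ) (z : ℂ) : ℝ := ‖z - c‖ ^ 2 - r ^ 2

/-- The quadratic terms cancel: the difference of two powers is affine, and its zero set is the
radical axis. -/
theorem circlePower_sub (c c' : ℂ) (r r' : ℝ) (z : ℂ) :
    circlePower c' r' z - circlePower c r z =
      2 * inner ℝ (c - c') z + (circlePower c' r' 0 - circlePower c r 0) := by
  simp only [circlePower, norm_sub_sq_real, inner_sub_left, zero_sub, norm_neg]
  rw [real_inner_comm c z, real_inner_comm c' z]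
  ring

theorem circlePower_eq_zero {c z : ℂ} {r : ℝ} (h : z ∈ sphere c r) : circlePower c r z = 0 := by
  rw [circlePower, mem_sphere_iff_norm.1 h, sub_self]

theorem circlePower_nonneg {c z : ℂ} {r : ℝ} (hr : 0 ≤ r) (h : z ∉ ball c r) :
    0 ≤ circlePower c r z := by
  rw [mem_ball_iff_norm, not_lt] at h
  rw [circlePower]
  nlinarith

theorem isClosed_setOf_ball_subset (E : Set ℂ) : IsClosed {p : ℂ × ℝ | ball p.1 p.2 ⊆ E} := by
  have : {p : ℂ × ℝ | ball p.1 p.2 ⊆ E} = ⋂ z ∈ Eᶜ, {p : ℂ × ℝ | p.2 ≤ dist z p.1} := by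
    ext p
    simp only [mem_ofPred_eq, mem_iInter, mem_compl_iff]
    constructor
    · intro h z hz
      by_contra! h'
      exact hz (h h')
    · intro h z hz
      by_contra h'
      exact absurd (mem_ball.1 hz) (not_lt.2 (h z h'))
  rw [this]
  exact isClosed_biInter fun z _ => isClosed_le continuous_snd (by fun_prop)

theorem isCompact_setOf_disk (E : Set ℂ) (R P : ℝ) :
    IsCompact {p : ℂ × ℝ | ball p.1 p.2 ⊆ E ∧ 0 ≤ p.2 ∧ p.2 ≤ R ∧ P ≤ p.2 ^ 2 - ‖p.1‖ ^ 2} := by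
  have hcl : IsClosed {p : ℂ × ℝ | ball p.1 p.2 ⊆ E ∧ 0 ≤ p.2 ∧ p.2 ≤ R ∧
      P ≤ p.2 ^ 2 - ‖p.1‖ ^ 2} :=
    (isClosed_setOf_ball_subset E).and ((isClosed_le continuous_const continuous_snd).and
      ((isClosed_le continuous_snd continuous_const).and
        (isClosed_le continuous_const
          ((continuous_snd.pow 2).sub (continuous_fst.norm.pow 2)))))
  refine ((isCompact_closedBall (0 : ℂ) (R ^ 2 - P + 1)).prod (isCompact_Icc (a := (0 : ℝ))
    (b := R))).of_isClosed_subset hcl ?_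
  rintro ⟨c, r⟩ ⟨-, h0, h1, h2⟩
  refine ⟨?_, h0, h1⟩
  simp only [mem_closedBall_zero_iff] at h0 h1 h2 ⊢
  nlinarith [sq_nonneg (‖c‖ - 1), norm_nonneg c]

/-- Separate 0 from the bad boundary points by `f` = ⟨u, ·⟩, at most -2δ on them. With centre c + tu
and power P + 2tδ, the new disk is |z - c|² < r² + 2t(f z + δ), so outside the old disk it only
gains points with f z > -δ, away from the bad ones. -/
theorem exists_larger_disk {E : Set ℂ} (hE : IsOpen E) {c : ℂ} {r : ℝ} (hr : 0 ≤ r)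
    (hB : ball c r ⊆ E) (hS : (sphere c r \ E).Finite) (hP : 0 < r ^ 2 - ‖c‖ ^ 2)
    (h : (0 : ℂ) ∉ convexHull ℝ (sphere c r \ E)) :
    ∃ c' r', 0 ≤ r' ∧ ball c' r' ⊆ E ∧ r ^ 2 - ‖c‖ ^ 2 < r' ^ 2 - ‖c'‖ ^ 2 := by
  obtain ⟨f, δ, hδ, hf⟩ : ∃ f : StrongDual ℝ ℂ, ∃ δ > 0, ∀ s ∈ sphere c r \ E, f s ≤ -(2 * δ) := by
    obtain ⟨f, b, h0, h1⟩ := geometric_hahn_banach_point_closed (convex_convexHull ℝ _)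
      (hS.isCompact_convexHull ℝ).isClosed h
    rw [map_zero] at h0
    refine ⟨-f, b / 2, by positivity, fun s hs => ?_⟩
    have := h1 s (subset_convexHull ℝ _ hs)
    simp only [neg_apply]
    linarith
  set u : ℂ := (InnerProductSpace.toDual ℝ ℂ).symm f with hu
  have hfu : ∀ z, f z = inner ℝ u z := fun z => by simp [hu]
  set P := r ^ 2 - ‖c‖ ^ 2 with hPdef
  set M : ℝ := ‖c‖ + ‖u‖ + (P + 2 * δ + (‖c‖ + ‖u‖) ^ 2 + 1) with hM
  -- Obstructions to the parameter t. They form a compact set without a point over t = 0, so all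
  -- small t are admissible; `M` only serves to bound them.
  set Bad : Set (ℝ × ℂ) := {p | p.1 ∈ Icc (0 : ℝ) 1 ∧ p.2 ∈ closedBall (0 : ℂ) M ∧ p.2 ∈ Eᶜ ∧
    ‖p.2 - c‖ ^ 2 ≤ r ^ 2 + 2 * p.1 * (f p.2 + δ) ∧ -δ ≤ f p.2} with hBad
  have hcl : IsClosed Bad := by
    have h1 : IsClosed {p : ℝ × ℂ | ‖p.2 - c‖ ^ 2 ≤ r ^ 2 + 2 * p.1 * (f p.2 + δ)} :=
      isClosed_le (by fun_prop) (by fun_prop)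
    have h2 : IsClosed {p : ℝ × ℂ | -δ ≤ f p.2} := isClosed_le (by fun_prop) (by fun_prop)
    exact (isClosed_Icc.preimage continuous_fst).inter ((isClosed_closedBall.preimage
      continuous_snd).inter ((hE.isClosed_compl.preimage continuous_snd).inter (h1.inter h2)))
  have hcomp : IsCompact Bad := (isCompact_Icc.prod (isCompact_closedBall (0 : ℂ) M)).of_isClosed_subset
    hcl fun p hp => ⟨hp.1, hp.2.1⟩
  have h0 : (0 : ℝ) ∉ Prod.fst '' Bad := by
    rintro ⟨⟨t, z⟩, ⟨-, -, hz1, hz2, hz3⟩, rfl⟩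
    simp only [mul_zero, zero_mul, add_zero] at hz1 hz2 hz3
    have hle : ‖z - c‖ ≤ r := abs_le_of_sq_le_sq' hz2 hr |>.2
    have hsph : z ∈ sphere c r := by
      rw [mem_sphere_iff_norm]
      refine le_antisymm hle ?_
      by_contra! hlt
      exact hz1 (hB (mem_ball_iff_norm.2 hlt))
    have := hf z ⟨hsph, hz1⟩
    linarith
  have hev : ∀ᶠ t : ℝ in 𝓝 0, t ∉ Prod.fst '' Bad :=
    ((hcomp.image continuous_fst).isClosed.isOpen_compl).mem_nhds h0
  obtain ⟨t, ht, ht0, ht1⟩ : ∃ t : ℝ, t ∉ Prod.fst '' Bad ∧ 0 < t ∧ t < 1 := by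
    obtain ⟨ε, hε, hb⟩ := Metric.eventually_nhds_iff_ball.1 hev
    refine ⟨min (ε / 2) (1 / 2), hb _ ?_, by positivity, (min_le_right _ _).trans_lt (by norm_num)⟩
    rw [mem_ball, Real.dist_eq, sub_zero, abs_of_pos (by positivity)]
    exact (min_le_left _ _).trans_lt (by linarith)
  have hrad : 0 ≤ P + 2 * t * δ + ‖c + t • u‖ ^ 2 := by positivity
  refine ⟨c + t • u, Real.sqrt (P + 2 * t * δ + ‖c + t • u‖ ^ 2), Real.sqrt_nonneg _, ?_, ?_⟩
  · intro z hz
    rw [mem_ball_iff_norm] at hz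
    by_contra hzE
    have hcu : ‖c + t • u‖ ≤ ‖c‖ + ‖u‖ := by
      refine (norm_add_le _ _).trans ?_
      rw [norm_smul, Real.norm_of_nonneg ht0.le]
      nlinarith [norm_nonneg u]
    have hsq : ‖z - (c + t • u)‖ ^ 2 < P + 2 * t * δ + ‖c + t • u‖ ^ 2 := by
      have := pow_lt_pow_left₀ hz (norm_nonneg _) two_ne_zero
      rwa [Real.sq_sqrt hrad] at this
    have hexp : ‖z - c‖ ^ 2 < r ^ 2 + 2 * t * (f z + δ) := by
      rw [norm_sub_sq_real, inner_add_right, inner_smul_right, real_inner_comm u, ← hfu] at hsq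
      rw [norm_sub_sq_real]
      linarith
    have hge : r ≤ ‖z - c‖ := by
      by_contra! hlt
      exact hzE (hB (mem_ball_iff_norm.2 hlt))
    refine ht ⟨⟨t, z⟩, ⟨⟨ht0.le, ht1.le⟩, ?_, hzE, hexp.le, ?_⟩, rfl⟩
    · rw [mem_closedBall_zero_iff]
      have h1 : ‖z‖ ≤ ‖z - (c + t • u)‖ + ‖c + t • u‖ := by
        simpa using norm_add_le (z - (c + t • u)) (c + t • u)
      have h2 : ‖z - (c + t • u)‖ ≤ P + 2 * δ + (‖c‖ + ‖u‖) ^ 2 + 1 := by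
        nlinarith [norm_nonneg (z - (c + t • u)), sq_nonneg (‖z - (c + t • u)‖ - 1),
          norm_nonneg (c + t • u), norm_nonneg c, norm_nonneg u]
      simp only [hM]
      linarith
    · change -δ ≤ f z
      have h3 : r ^ 2 ≤ ‖z - c‖ ^ 2 := by gcongr
      have h4 : 0 < t * (f z + δ) := by linarith
      have := (pos_iff_pos_of_mul_pos h4).1 ht0
      linarith
  · rw [Real.sq_sqrt hrad]
    have : 0 < 2 * t * δ := by positivity
    linarith

/-- In an open set, the disks around a point whose circle has maximal power at that point have the
point in the convex hull of the boundary points outside the set. -/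
theorem exists_disk_maximal_power {E : Set ℂ} (hE : IsOpen E) (h0 : (0 : ℂ) ∈ E) {R : ℝ}
    (hR : ∀ c r, ball c r ⊆ E → r ≤ R)
    (hfin : ∀ c r, (0 : ℂ) ∈ ball c r → ball c r ⊆ E → (sphere c r \ E).Finite) :
    ∃ c r, (0 : ℂ) ∈ ball c r ∧ ball c r ⊆ E ∧ (0 : ℂ) ∈ convexHull ℝ (sphere c r \ E) ∧
      ∀ ε, 0 ≤ ε → ball (0 : ℂ) ε ⊆ E → ε ^ 2 ≤ r ^ 2 - ‖c‖ ^ 2 := by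
  obtain ⟨ε₀, hε₀, hb⟩ := Metric.isOpen_iff.1 hE 0 h0
  have hK := isCompact_setOf_disk E R (ε₀ ^ 2)
  obtain ⟨⟨c, r⟩, ⟨hB, hr0, hrR, hP⟩, hmax⟩ := hK.exists_isMaxOn
    ⟨(0, ε₀), hb, hε₀.le, hR 0 ε₀ hb, by simp⟩
    (f := fun p : ℂ × ℝ => p.2 ^ 2 - ‖p.1‖ ^ 2) (by fun_prop)
  simp only at hB hr0 hrR hP
  have hPpos : 0 < r ^ 2 - ‖c‖ ^ 2 := lt_of_lt_of_le (by positivity) hP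
  have hmax' : ∀ c' r', 0 ≤ r' → ball c' r' ⊆ E → r' ^ 2 - ‖c'‖ ^ 2 ≤ r ^ 2 - ‖c‖ ^ 2 := by
    intro c' r' hr' hB'
    by_contra! hlt
    exact absurd (hmax (a := (c', r')) ⟨hB', hr', hR c' r' hB', hP.trans hlt.le⟩) (not_le.2 hlt)
  have hmem : (0 : ℂ) ∈ ball c r := by
    rw [mem_ball_iff_norm, zero_sub, norm_neg]
    exact lt_of_pow_lt_pow_left₀ 2 hr0 (by linarith)
  refine ⟨c, r, hmem, hB, ?_, fun ε hε hεE => ?_⟩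
  · by_contra hn
    obtain ⟨c', r', hr', hB', hlt⟩ := exists_larger_disk hE hr0 hB
      (hfin c r hmem hB) hPpos hn
    exact absurd (hmax' c' r' hr' hB') (not_le.2 hlt)
  · simpa using hmax' 0 ε hε hεE

/-! ### Plane geometry: uniqueness of the disk and fan triangulations -/

/-- The open triangle with vertices `a`, `b`, `c`. -/
def openTriangle (a b c : ℂ) : Set ℂ :=
  {z | ∃ α β γ : ℝ, 0 < α ∧ 0 < β ∧ 0 < γ ∧ α + β + γ = 1 ∧ z = α • a + β • b + γ • c}

/-- A line meets a circle in at most two points: a second point is a + l · id, and the circle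
equation determines l ≠ 0. -/
theorem eq_of_mem_sphere_of_inner_eq {c d a b₁ b₂ : ℂ} {r : ℝ} (hd : d ≠ 0) (ha : a ∈ sphere c r)
    (hb₁ : b₁ ∈ sphere c r) (hb₂ : b₂ ∈ sphere c r) (h₁ : inner ℝ d b₁ = inner ℝ d a)
    (h₂ : inner ℝ d b₂ = inner ℝ d a) (hne₁ : b₁ ≠ a) (hne₂ : b₂ ≠ a) : b₁ = b₂ := by
  have key : ∀ b ∈ sphere c r, inner ℝ d b = inner ℝ d a → b ≠ a →
      ∃ l : ℝ, b - a = l • (Complex.I * d) ∧ l * ‖d‖ ^ 2 = -2 * inner ℝ (Complex.I * d) (a - c) := by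
    intro b hb hdb hne
    have hd2 : d.re * d.re + d.im * d.im ≠ 0 := by
      have := Complex.normSq_pos.2 hd
      rw [Complex.normSq_apply] at this
      exact this.ne'
    have hd3 : d.re ^ 2 + d.im ^ 2 ≠ 0 := by rwa [sq, sq]
    have hperp : d.re * (b.re - a.re) + d.im * (b.im - a.im) = 0 := by
      simp only [Complex.inner, Complex.mul_re, Complex.conj_re, Complex.conj_im] at hdb
      linarith
    have hl : b - a = (((d.re * (b.im - a.im) - d.im * (b.re - a.re)) /
        (d.re * d.re + d.im * d.im) : ℝ)) • (Complex.I * d) := by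
      apply Complex.ext
      · rw [Complex.real_smul, Complex.re_ofReal_mul]
        simp
        field_simp
        linear_combination d.re * hperp
      · rw [Complex.real_smul, Complex.im_ofReal_mul]
        simp
        field_simp
        linear_combination d.im * hperp
    set l := (d.re * (b.im - a.im) - d.im * (b.re - a.re)) / (d.re * d.re + d.im * d.im)
    refine ⟨l, hl, ?_⟩
    have hl0 : l ≠ 0 := by
      rintro h0
      rw [h0, zero_smul] at hl
      exact hne (sub_eq_zero.1 hl)
    have e : ‖(a - c) + l • (Complex.I * d)‖ ^ 2 = ‖a - c‖ ^ 2 := by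
      rw [← hl, mem_sphere_iff_norm.1 ha]
      have := mem_sphere_iff_norm.1 hb
      rw [← this]
      congr 2
      ring
    rw [norm_add_sq_real, inner_smul_right, norm_smul, real_inner_comm] at e
    have hI : ‖Complex.I * d‖ = ‖d‖ := by simp
    rw [hI, mul_pow, Real.norm_eq_abs, sq_abs] at e
    have : l * (l * ‖d‖ ^ 2 + 2 * inner ℝ (Complex.I * d) (a - c)) = 0 := by linarith
    rcases mul_eq_zero.1 this with h | h
    · exact absurd h hl0
    · linarith
  obtain ⟨l₁, e₁, f₁⟩ := key b₁ hb₁ h₁ hne₁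
  obtain ⟨l₂, e₂, f₂⟩ := key b₂ hb₂ h₂ hne₂
  have hl : l₁ = l₂ := by
    have : ‖d‖ ^ 2 ≠ 0 := by positivity
    exact mul_right_cancel₀ this (f₁.trans f₂.symm)
  rw [hl, ← e₂] at e₁
  exact sub_left_injective e₁

/-- Two empty disks whose polygons of boundary points share a point, interior to one of them, are
equal. -/
theorem disk_eq_of_mem_openTriangle {E : Set ℂ} {c c' a₁ a₂ a₃ : ℂ} {r r' : ℝ} (hr : 0 ≤ r)
    (hr' : 0 ≤ r') (hB : ball c r ⊆ E) (hB' : ball c' r' ⊆ E) (h₁ : a₁ ∈ sphere c r \ E)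
    (h₂ : a₂ ∈ sphere c r \ E) (h₃ : a₃ ∈ sphere c r \ E) (h₁₂ : a₂ ≠ a₁) (h₁₃ : a₃ ≠ a₁)
    (h₂₃ : a₂ ≠ a₃) (h0 : (0 : ℂ) ∈ openTriangle a₁ a₂ a₃)
    (h0' : (0 : ℂ) ∈ convexHull ℝ (sphere c' r' \ E)) : c' = c ∧ r' = r := by
  set k := circlePower c' r' 0 - circlePower c r 0 with hk
  set d := c - c' with hd
  -- Emptiness makes this affine function nonnegative at the singular points of the first circle and
  -- nonpositive at those of the second. Its value `k` at 0 is then both, and the positive weights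
  -- of the triangle force it to vanish at all three vertices, which are not collinear.
  have hdiff : ∀ z, circlePower c' r' z - circlePower c r z = 2 * inner ℝ d z + k :=
    circlePower_sub c c' r r'
  have hS : ∀ s ∈ sphere c r \ E, 0 ≤ 2 * inner ℝ d s + k := by
    intro s hs
    rw [← hdiff, circlePower_eq_zero hs.1, sub_zero]
    exact circlePower_nonneg hr' fun h => hs.2 (hB' h)
  have hk0 : k ≤ 0 := by
    have hsub : convexHull ℝ (sphere c' r' \ E) ⊆ {z : ℂ | inner ℝ d z ≤ -k / 2} := by
      refine convexHull_min (fun s hs => ?_) ?_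
      · have h1 := hdiff s
        rw [circlePower_eq_zero hs.1] at h1
        have h2 := circlePower_nonneg hr fun h => hs.2 (hB h)
        simp only [mem_ofPred_eq]
        linarith
      · exact convex_halfSpace_le (innerₛₗ ℝ d).isLinear _
    have := hsub h0'
    simp only [mem_ofPred_eq, inner_zero_right] at this
    linarith
  obtain ⟨α, β, γ, hα, hβ, hγ, hsum, h0e⟩ := h0
  have hlin : α * (2 * inner ℝ d a₁ + k) + β * (2 * inner ℝ d a₂ + k) +
      γ * (2 * inner ℝ d a₃ + k) = k := by
    have := congrArg (fun z => inner ℝ d z) h0e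
    simp only [inner_zero_right, inner_add_right, inner_smul_right] at this
    linear_combination (-2) * this + k * hsum
  have g₁ := mul_nonneg hα.le (hS _ h₁)
  have g₂ := mul_nonneg hβ.le (hS _ h₂)
  have g₃ := mul_nonneg hγ.le (hS _ h₃)
  have e₁ : 2 * inner ℝ d a₁ + k = 0 := by
    rcases mul_eq_zero.1 (show α * (2 * inner ℝ d a₁ + k) = 0 by linarith) with h | h
    · exact absurd h hα.ne'
    · exact h
  have e₂ : 2 * inner ℝ d a₂ + k = 0 := by
    rcases mul_eq_zero.1 (show β * (2 * inner ℝ d a₂ + k) = 0 by linarith) with h | h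
    · exact absurd h hβ.ne'
    · exact h
  have e₃ : 2 * inner ℝ d a₃ + k = 0 := by
    rcases mul_eq_zero.1 (show γ * (2 * inner ℝ d a₃ + k) = 0 by linarith) with h | h
    · exact absurd h hγ.ne'
    · exact h
  have hk00 : k = 0 := by linarith
  have hd0 : d = 0 := by
    by_contra hne
    exact h₂₃ (eq_of_mem_sphere_of_inner_eq hne h₁.1 h₂.1 h₃.1 (by linarith) (by linarith) h₁₂ h₁₃)
  have hcc : c = c' := sub_eq_zero.1 hd0
  refine ⟨hcc.symm, ?_⟩
  rw [hk, ← hcc] at hk00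
  simp only [circlePower] at hk00
  have : r' ^ 2 = r ^ 2 := by linarith
  exact (pow_left_inj₀ hr' hr two_ne_zero).1 this

/-- The triangle `s₀ a b` belongs to the fan triangulation of the convex hull of `S` with apex
`s₀`: the line `a b` supports `S` and does not pass through `s₀`. -/
def IsFanTriangle (S : Set ℂ) (s₀ a b : ℂ) : Prop :=
  a ∈ S ∧ b ∈ S ∧ a ≠ b ∧ ∃ (u : ℂ) (k : ℝ), inner ℝ u s₀ < k ∧ inner ℝ u a = k ∧ inner ℝ u b = k ∧
    ∀ s ∈ S, inner ℝ u s ≤ k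

/-- A convex combination that attains the maximum of a linear functional only has weight on points
attaining it. -/
theorem mem_convexHull_inter_of_inner_le {S : Set ℂ} {u y : ℂ} (hy : y ∈ convexHull ℝ S)
    (h : ∀ s ∈ S, inner ℝ u s ≤ inner ℝ u y) :
    y ∈ convexHull ℝ (S ∩ {s | inner ℝ u s = inner ℝ u y}) := by
  rw [mem_convexHull_iff_exists_fintype] at hy
  obtain ⟨ι, _, w, z, hw0, hw1, hz, hwz⟩ := hy
  have hsum : ∑ i, w i * (inner ℝ u y - inner ℝ u (z i)) = 0 := by
    have h1 : inner ℝ u y = ∑ i, w i * inner ℝ u (z i) := by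
      conv_lhs => rw [← hwz]
      rw [inner_sum]
      simp only [inner_smul_right]
    simp only [mul_sub, Finset.sum_sub_distrib, ← Finset.sum_mul, hw1, ← h1]
    ring
  have hz0 := (Finset.sum_eq_zero_iff_of_nonneg fun i _ =>
    mul_nonneg (hw0 i) (sub_nonneg.2 (h _ (hz i)))).1 hsum
  classical
  have hfilter : ∀ f : ι → ℂ, ∑ i ∈ Finset.univ.filter (fun i => w i ≠ 0), w i • f i =
      ∑ i, w i • f i := by
    intro f
    refine Finset.sum_subset (Finset.subset_univ _) fun i _ hi => ?_
    simp only [Finset.mem_filter, Finset.mem_univ, true_and, not_not] at hi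
    rw [hi, zero_smul]
  rw [← hwz, ← hfilter]
  refine (convex_convexHull ℝ _).sum_mem (fun i _ => hw0 i) ?_ fun i hi => ?_
  · rw [← hw1]
    exact Finset.sum_filter_ne_zero _
  · refine subset_convexHull ℝ _ ⟨hz i, ?_⟩
    have := hz0 i (Finset.mem_univ i)
    simp only [Finset.mem_filter, Finset.mem_univ, true_and] at hi
    have := (mul_eq_zero.1 this).resolve_left hi
    rw [mem_ofPred_eq, hfilter, hwz]
    linarith

/-- The ray from `s₀` through `z` leaves the hull at parameter `τ`. Points just beyond are strictly
separated from the hull, and by compactness normalised separating vectors yield a supporting one at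
the exit point. No interior of the hull is required. -/
theorem exists_supporting_inner {S : Set ℂ} (hS : S.Finite) {s₀ z : ℂ} (hz : z ∈ convexHull ℝ S)
    (hne : z ≠ s₀) :
    ∃ (τ : ℝ) (u : ℂ), 1 ≤ τ ∧ ‖u‖ = 1 ∧ s₀ + τ • (z - s₀) ∈ convexHull ℝ S ∧
      ∀ s ∈ S, inner ℝ u s ≤ inner ℝ u (s₀ + τ • (z - s₀)) := by
  have hH := hS.isCompact_convexHull ℝ
  have hcont : Continuous fun t : ℝ => s₀ + t • (z - s₀) := by fun_prop
  have hT : IsCompact {t : ℝ | s₀ + t • (z - s₀) ∈ convexHull ℝ S ∧ 1 ≤ t} := by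
    obtain ⟨M, hM⟩ := hH.isBounded.exists_norm_le
    have hpos : 0 < ‖z - s₀‖ := norm_pos_iff.2 (sub_ne_zero.2 hne)
    refine (isCompact_Icc (a := (1 : ℝ)) (b := (M + ‖s₀‖) / ‖z - s₀‖)).of_isClosed_subset
      ((hH.isClosed.preimage hcont).inter isClosed_Ici) ?_
    rintro t ⟨ht, ht1⟩
    refine ⟨ht1, ?_⟩
    rw [le_div_iff₀ hpos]
    have h1 := norm_sub_le (s₀ + t • (z - s₀)) s₀
    rw [add_sub_cancel_left, norm_smul, Real.norm_of_nonneg (by linarith)] at h1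
    linarith [hM _ ht]
  obtain ⟨τ, ⟨hτH, hτ1⟩, hmax⟩ := hT.exists_isMaxOn ⟨1, by simpa, le_rfl⟩ continuousOn_id
  set Q : Set (ℝ × ℂ) := {p | p.1 ∈ Icc τ (τ + 1) ∧ p.2 ∈ sphere (0 : ℂ) 1 ∧
    ∀ s ∈ S, inner ℝ p.2 s ≤ inner ℝ p.2 (s₀ + p.1 • (z - s₀))} with hQ
  have hQc : IsCompact Q := by
    refine (isCompact_Icc.prod (isCompact_sphere (0 : ℂ) 1)).of_isClosed_subset ?_
      fun p hp => ⟨hp.1, hp.2.1⟩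
    have h1 : IsClosed {p : ℝ × ℂ | ∀ s ∈ S, inner ℝ p.2 s ≤ inner ℝ p.2 (s₀ + p.1 • (z - s₀))} := by
      simp only [ofPred_forall]
      exact isClosed_biInter fun s _ => isClosed_le (by fun_prop) (by fun_prop)
    exact (isClosed_Icc.preimage continuous_fst).inter
      ((isClosed_sphere.preimage continuous_snd).inter h1)
  have hsub : Ioc τ (τ + 1) ⊆ Prod.fst '' Q := by
    intro t ht
    have htH : s₀ + t • (z - s₀) ∉ convexHull ℝ S := fun h =>
      absurd (hmax (a := t) ⟨h, hτ1.trans ht.1.le⟩) (not_le.2 ht.1)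
    obtain ⟨f, b, h0, h1⟩ := geometric_hahn_banach_closed_point (convex_convexHull ℝ S)
      hH.isClosed htH
    set u : ℂ := (InnerProductSpace.toDual ℝ ℂ).symm f with hu
    have hfu : ∀ z, f z = inner ℝ u z := fun z => by simp [hu]
    have hu0 : u ≠ 0 := by
      intro h
      have h2 := h0 _ hz
      rw [hfu, h, inner_zero_left] at h2
      rw [hfu, h, inner_zero_left] at h1
      linarith
    have hupos : 0 < ‖u‖ := norm_pos_iff.2 hu0
    refine ⟨(t, ‖u‖⁻¹ • u), ⟨⟨ht.1.le, ht.2⟩, ?_, fun s hs => ?_⟩, rfl⟩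
    · rw [mem_sphere_zero_iff_norm, norm_smul, norm_inv, norm_norm, inv_mul_cancel₀ hupos.ne']
    · simp only [real_inner_smul_left, ← hfu]
      exact mul_le_mul_of_nonneg_left ((h0 s (subset_convexHull ℝ S hs)).trans h1).le (by positivity)
  have hτQ : τ ∈ Prod.fst '' Q := by
    have h1 : closure (Ioc τ (τ + 1)) ⊆ Prod.fst '' Q :=
      closure_minimal hsub (hQc.image continuous_fst).isClosed
    rw [closure_Ioc (by linarith)] at h1
    exact h1 ⟨le_rfl, by linarith⟩
  obtain ⟨⟨t, u⟩, ⟨-, hu, hs⟩, rfl⟩ := hτQ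
  exact ⟨t, u, hτ1, mem_sphere_zero_iff_norm.1 hu, hτH, hs⟩

/-- The ray from `s₀` through `z` exits through an edge `a b`, because a supporting line carries at
most two points of the circle; `hline` keeps `z` off all sides and diagonals. -/
theorem exists_isFanTriangle {S : Set ℂ} (hS : S.Finite) {c s₀ z : ℂ} {r : ℝ} (hSc : S ⊆ sphere c r)
    (hs₀ : s₀ ∈ S) (hz : z ∈ convexHull ℝ S) (hzB : z ∈ ball c r)
    (hline : ∀ a ∈ S, ∀ b ∈ S, a ≠ b → ∀ t : ℝ, z ≠ a + t • (b - a)) :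
    ∃ a b, IsFanTriangle S s₀ a b ∧ z ∈ openTriangle s₀ a b := by
  have hSB : ∀ s ∈ S, z ≠ s := by
    rintro s hs rfl
    exact (mem_sphere.1 (hSc hs)).not_lt (mem_ball.1 hzB)
  obtain ⟨τ, u, hτ, hu, hy, hmax⟩ := exists_supporting_inner hS hz (hSB s₀ hs₀)
  set y := s₀ + τ • (z - s₀) with hydef
  have hτ0 : τ ≠ 0 := by linarith
  have hu0 : u ≠ 0 := by
    rintro rfl
    simp at hu
  have hzy : z = s₀ + τ⁻¹ • (y - s₀) := by
    rw [hydef, add_sub_cancel_left, smul_smul, inv_mul_cancel₀ hτ0, one_smul, add_sub_cancel]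
  have hy' := mem_convexHull_inter_of_inner_le hy hmax
  set T := S ∩ {s | inner ℝ u s = inner ℝ u y} with hT
  have hyS : ∀ s ∈ S, y ≠ s := by
    rintro s hs h
    by_cases h0 : s = s₀
    · rw [h, h0, sub_self, smul_zero, add_zero] at hzy
      exact hSB s₀ hs₀ hzy
    · exact hline s₀ hs₀ s hs (Ne.symm h0) τ⁻¹ (by rw [← h]; exact hzy)
  obtain ⟨a, ha⟩ : T.Nonempty := convexHull_nonempty_iff.1 ⟨y, hy'⟩
  obtain ⟨b, hb, hba⟩ : ∃ b ∈ T, b ≠ a := by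
    by_contra! h
    have : T ⊆ {a} := fun s hs => h s hs
    have h2 := convexHull_mono this hy'
    rw [convexHull_singleton] at h2
    exact hyS a ha.1 h2
  have hTab : T ⊆ {a, b} := by
    intro s hs
    by_cases hsa : s = a
    · exact Or.inl hsa
    · exact Or.inr (eq_of_mem_sphere_of_inner_eq hu0 (hSc ha.1) (hSc hs.1) (hSc hb.1)
        (hs.2.trans ha.2.symm) (hb.2.trans ha.2.symm) hsa hba)
  have hyab := convexHull_mono hTab hy'
  rw [convexHull_pair] at hyab
  obtain ⟨p, q, hp, hq, hpq, hyeq⟩ := hyab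
  have hp0 : 0 < p := by
    refine lt_of_le_of_ne hp fun h => hyS b hb.1 ?_
    rw [← hyeq, ← h, zero_smul, zero_add, show q = 1 by linarith, one_smul]
  have hq0 : 0 < q := by
    refine lt_of_le_of_ne hq fun h => hyS a ha.1 ?_
    rw [← hyeq, ← h, zero_smul, add_zero, show p = 1 by linarith, one_smul]
  have hyline : y = a + q • (b - a) := by
    rw [← hyeq, show p = 1 - q by linarith, sub_smul, smul_sub, one_smul]
    abel
  have hs₀T : s₀ ∉ T := by
    intro h
    rcases hTab h with h | h
    · refine hline a ha.1 b hb.1 hba.symm (τ⁻¹ * q) ?_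
      rw [hzy, h, hyline, add_sub_cancel_left, smul_smul]
    · rw [mem_singleton_iff] at h
      refine hline a ha.1 b hb.1 hba.symm (1 + τ⁻¹ * (q - 1)) ?_
      rw [hzy, h, hyline]
      module
  have hτ1 : 1 < τ := by
    refine lt_of_le_of_ne hτ fun h => hline a ha.1 b hb.1 hba.symm q ?_
    rw [← hyline, hzy, ← h, inv_one, one_smul, add_sub_cancel]
  have hτi : τ⁻¹ < 1 := inv_lt_one_of_one_lt₀ hτ1
  have hτi0 : 0 < τ⁻¹ := by positivity
  refine ⟨a, b, ⟨ha.1, hb.1, hba.symm, u, inner ℝ u y, ?_, ha.2, hb.2, hmax⟩,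
    1 - τ⁻¹, τ⁻¹ * p, τ⁻¹ * q, by linarith, by positivity, by positivity, ?_, ?_⟩
  · exact lt_of_le_of_ne (hmax s₀ hs₀) fun h => hs₀T ⟨hs₀, h⟩
  · linear_combination τ⁻¹ * hpq
  · rw [hzy, ← hyeq]
    module

/-- The weight β + γ opposite `s₀` locates `z` on its ray relative to the exit point. Each
supporting functional bounds one such weight by the other, so they agree and both edges lie on one
line. -/
theorem IsFanTriangle.eq_or_eq {S : Set ℂ} {c s₀ a b a' b' z : ℂ} {r : ℝ} (hSc : S ⊆ sphere c r)
    (h : IsFanTriangle S s₀ a b) (h' : IsFanTriangle S s₀ a' b') (hz : z ∈ openTriangle s₀ a b)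
    (hz' : z ∈ openTriangle s₀ a' b') : (a = a' ∧ b = b') ∨ (a = b' ∧ b = a') := by
  obtain ⟨ha, hb, hab, u, k, hk, hua, hub, hS⟩ := h
  obtain ⟨ha', hb', hab', u', k', hk', hua', hub', hS'⟩ := h'
  obtain ⟨α, β, γ, hα, hβ, hγ, hsum, he⟩ := hz
  obtain ⟨α', β', γ', hα', hβ', hγ', hsum', he'⟩ := hz'
  have hpos : 0 < k - inner ℝ u s₀ := by linarith
  have hpos' : 0 < k' - inner ℝ u' s₀ := by linarith
  -- the two normalised affine functionals, evaluated at the common point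
  have e1 : inner ℝ u z - inner ℝ u s₀ = (β + γ) * (k - inner ℝ u s₀) := by
    rw [he]
    simp only [inner_add_right, inner_smul_right, hua, hub]
    linear_combination inner ℝ u s₀ * hsum
  have e2 : inner ℝ u' z - inner ℝ u' s₀ = (β' + γ') * (k' - inner ℝ u' s₀) := by
    rw [he']
    simp only [inner_add_right, inner_smul_right, hua', hub']
    linear_combination inner ℝ u' s₀ * hsum'
  have e3 : inner ℝ u z - inner ℝ u s₀ = β' * (inner ℝ u a' - inner ℝ u s₀) +
      γ' * (inner ℝ u b' - inner ℝ u s₀) := by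
    rw [he']
    simp only [inner_add_right, inner_smul_right]
    linear_combination inner ℝ u s₀ * hsum'
  have e4 : inner ℝ u' z - inner ℝ u' s₀ = β * (inner ℝ u' a - inner ℝ u' s₀) +
      γ * (inner ℝ u' b - inner ℝ u' s₀) := by
    rw [he]
    simp only [inner_add_right, inner_smul_right]
    linear_combination inner ℝ u' s₀ * hsum
  have i1 : β + γ ≤ β' + γ' := by
    refine le_of_mul_le_mul_right ?_ hpos
    rw [← e1, e3]
    nlinarith [mul_le_mul_of_nonneg_left (hS a' ha') hβ'.le,
      mul_le_mul_of_nonneg_left (hS b' hb') hγ'.le]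
  have i2 : (β' + γ') * (k' - inner ℝ u' s₀) ≤ (β + γ) * (k' - inner ℝ u' s₀) - 0 := by
    rw [← e2, e4]
    nlinarith [mul_le_mul_of_nonneg_left (hS' a ha) hβ.le,
      mul_le_mul_of_nonneg_left (hS' b hb) hγ.le]
  have i3 : β + γ = β' + γ' := le_antisymm i1 (le_of_mul_le_mul_right (by linarith) hpos')
  have e5 : β * (k' - inner ℝ u' a) + γ * (k' - inner ℝ u' b) = 0 := by
    rw [← i3] at e2
    linear_combination e4 - e2
  have j1 := mul_nonneg hβ.le (sub_nonneg.2 (hS' a ha))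
  have j2 := mul_nonneg hγ.le (sub_nonneg.2 (hS' b hb))
  have u1 : inner ℝ u' a = k' := by
    have := (mul_eq_zero.1 (show β * (k' - inner ℝ u' a) = 0 by linarith)).resolve_left hβ.ne'
    linarith
  have u2 : inner ℝ u' b = k' := by
    have := (mul_eq_zero.1 (show γ * (k' - inner ℝ u' b) = 0 by linarith)).resolve_left hγ.ne'
    linarith
  have hu0 : u' ≠ 0 := by
    rintro rfl
    simp only [inner_zero_left] at hk' hua'
    linarith
  have hline : ∀ s ∈ S, inner ℝ u' s = k' → s = a' ∨ s = b' := by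
    intro s hs hsk
    by_cases hsa : s = a'
    · exact Or.inl hsa
    · exact Or.inr (eq_of_mem_sphere_of_inner_eq hu0 (hSc ha') (hSc hs) (hSc hb')
        (hsk.trans hua'.symm) (hub'.trans hua'.symm) hsa hab'.symm)
  rcases hline a ha u1 with h1 | h1 <;> rcases hline b hb u2 with h2 | h2
  · exact absurd (h1.trans h2.symm) hab
  · exact Or.inl ⟨h1, h2⟩
  · exact Or.inr ⟨h1, h2⟩
  · exact absurd (h1.trans h2.symm) hab

/-! ### Change of base point and finiteness of singular points -/

namespace HolomorphicOneForm

variable {X : Type*} [TopologicalSpace X] [ChartedSpace ℂ X] [IsManifold 𝓘(ℂ) ω X]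
variable {η : HolomorphicOneForm X} {ψ ψ' : ℂ → X} {z : ℂ}

theorem recenter [T2Space X] {p : X} {c w : ℂ} {r : ℝ} (h0 : (0 : ℂ) ∈ ball c r)
    (hB : ball c r ⊆ η.expDomain p) (hw : w ∈ ball c r) :
    ball (c - w) r ⊆ η.expDomain (η.expMap p w) ∧
    (∀ z ∈ ball c r, η.expMap (η.expMap p w) (z - w) = η.expMap p z) ∧
    ∀ s ∈ sphere c r, s ∉ η.expDomain p → s - w ∉ η.expDomain (η.expMap p w) := by
  have hb : ∀ y, y - w ∈ ball (c - w) r ↔ y ∈ ball c r := fun y => by simp [mem_ball]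
  have h0' : (0 : ℂ) ∈ ball (c - w) r := by rwa [← sub_self w, hb]
  have hf : η.FlatOn (fun y => η.expMap p (y + w)) (ball (c - w) r) :=
    (FlatOn.comp_add ((flatOn_expMap η p).mono hB) w).mono fun y hy => by
      rw [mem_preimage, ← hb]; simpa using hy
  have hzero : η.expMap p (0 + w) = η.expMap p w := by rw [zero_add]
  refine ⟨fun y hy => ⟨_, ⟨isOpen_ball, convex_ball _ _, h0', hy⟩, _, hzero, hf⟩, fun z hz => ?_,
    fun s hs hsE => ?_⟩
  · rw [expMap_eq_of_convex isOpen_ball (convex_ball _ _) h0' hzero hf ((hb z).2 hz), sub_add_cancel]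
  · exact ((isSingularAt_expMap hB h0 hs hsE).comp_add w).notMem_expDomain hf h0' hzero

/-- Nearby disks overlap near `s`, so both maps run into one zero disk. There the same primitive
equals z - s and z - s', whence s' = s. -/
theorem eq_of_near_singular [T2Space X] [CompactSpace X]
    (hord : ∀ σ ∈ η.singularities, ∃ k : ℕ, η.order σ = k) {p : X} {c s : ℂ} {r : ℝ}
    (h0 : (0 : ℂ) ∈ ball c r) (hB : ball c r ⊆ η.expDomain p)
    (hs : s ∈ sphere c r \ η.expDomain p) :
    ∀ᶠ q : (ℂ × ℝ) × ℂ in 𝓝 ((c, r), s), (0 : ℂ) ∈ ball q.1.1 q.1.2 →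
      ball q.1.1 q.1.2 ⊆ η.expDomain p → q.2 ∈ sphere q.1.1 q.1.2 \ η.expDomain p → q.2 = s := by
  have hfl := flatOn_expMap η p
  have key : ∀ {c s : ℂ} {r : ℝ}, (0 : ℂ) ∈ ball c r → ball c r ⊆ η.expDomain p →
      s ∈ sphere c r \ η.expDomain p → ∃ σ ∈ η.singularities, ∀ ρ m, η.IsZeroDisk σ ρ m →
      ∀ z ∈ ball c r ∩ ball s m, η.expMap p z ∈ chartBall σ ρ ∧
        η.prim σ (chartAt ℂ σ (η.expMap p z)) = z - s := fun h0 hB hs =>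
    (isSingularAt_expMap hB h0 hs.1 hs.2).exists_limit (pos_of_mem_ball h0) (hfl.mono hB) hs.1
  have hcl : ∀ {c s : ℂ} {r : ℝ}, (0 : ℂ) ∈ ball c r → s ∈ sphere c r → s ∈ closure (ball c r) :=
    fun h0 hs => by
      rw [closure_ball _ (pos_of_mem_ball h0).ne']
      exact sphere_subset_closedBall hs
  obtain ⟨σ, hσ, hlim⟩ := key h0 hB hs
  obtain ⟨k, hk⟩ := hord σ hσ
  obtain ⟨ρ, -, m, hρ⟩ := exists_isZeroDisk hk one_pos
  have hm := hρ.bound_pos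
  obtain ⟨z₀, hz₀s, hz₀B⟩ := mem_closure_iff.1 (hcl h0 hs.1) (ball s m) isOpen_ball
    (mem_ball_self hm)
  have e1 : ∀ᶠ q : (ℂ × ℝ) × ℂ in 𝓝 ((c, r), s), dist z₀ q.1.1 < q.1.2 :=
    (isOpen_lt (by fun_prop) (by fun_prop)).mem_nhds hz₀B
  have e2 : ∀ᶠ q : (ℂ × ℝ) × ℂ in 𝓝 ((c, r), s), dist q.2 s < m :=
    (isOpen_lt (by fun_prop) (by fun_prop)).mem_nhds (show dist s s < m by rwa [dist_self])
  filter_upwards [e1, e2]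
  rintro ⟨⟨c', r'⟩, s'⟩ hz₀B' hs's h0' hB' hs'
  simp only at hz₀B' hs's h0' hB' hs'
  obtain ⟨h1, h2⟩ := hlim ρ m hρ z₀ ⟨hz₀B, hz₀s⟩
  have hall := hρ.forall_mem (W := ball c' r' ∩ ball s m) (isOpen_ball.inter isOpen_ball)
    ((convex_ball _ _).inter (convex_ball _ _)).isPreconnected
    (hfl.mono (inter_subset_left.trans hB')) inter_subset_right ⟨hz₀B', hz₀s⟩ h1 h2
  obtain ⟨σ', hσ', hlim'⟩ := key h0' hB' hs'
  have hcl' := hcl h0' hs'.1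
  -- Points of the second disk near `s'` tend to `σ'` while staying in the zero disk of `σ`, whose
  -- closure contains no other zero.
  have hσσ : σ' = σ := by
    refine hρ.eq_of_mem ?_ hσ'
    rw [mem_closure_iff_nhds_basis (hasBasis_chartBall σ')]
    intro ρ₀ hρ₀
    obtain ⟨k', hk'⟩ := hord σ' hσ'
    obtain ⟨ρ', hρ'le, m', hρ'⟩ := exists_isZeroDisk hk' hρ₀
    obtain ⟨y, ⟨hy1, hy2⟩, hyB⟩ := mem_closure_iff.1 hcl' (ball s' m' ∩ ball s m)
      (isOpen_ball.inter isOpen_ball) ⟨mem_ball_self hρ'.bound_pos, hs's⟩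
    have h3 := (hlim' ρ' m' hρ' y ⟨hyB, hy1⟩).1
    exact ⟨_, (hall y ⟨hyB, hy2⟩).1, h3.1, ball_subset_ball hρ'le h3.2⟩
  subst hσσ
  obtain ⟨y, ⟨hy1, hy2⟩, hyB⟩ := mem_closure_iff.1 hcl' (ball s' m ∩ ball s m)
    (isOpen_ball.inter isOpen_ball) ⟨mem_ball_self hm, hs's⟩
  have h3 := (hlim' ρ m hρ y ⟨hyB, hy1⟩).2
  have h4 := (hall y ⟨hyB, hy2⟩).2
  exact sub_right_injective (h3.symm.trans h4)

theorem zero_mem_ball_of_power_pos {c : ℂ} {r P : ℝ} (hr : 0 ≤ r) (hP : 0 < P)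
    (h : P ≤ r ^ 2 - ‖c‖ ^ 2) : (0 : ℂ) ∈ ball c r := by
  rw [mem_ball_iff_norm, zero_sub, norm_neg]
  exact lt_of_pow_lt_pow_left₀ 2 hr (by linarith)

/-- Pairs of a disk and a singular point on its circle form a compact set on which the singular
point is locally constant. The bound `P` keeps 0 inside the limiting disks. -/
theorem finite_singular_endpoints [T2Space X] [CompactSpace X]
    (hord : ∀ σ ∈ η.singularities, ∃ k : ℕ, η.order σ = k) (p : X) (R : ℝ) {P : ℝ} (hP : 0 < P) :
    {s : ℂ | ∃ c r, (ball c r ⊆ η.expDomain p ∧ 0 ≤ r ∧ r ≤ R ∧ P ≤ r ^ 2 - ‖c‖ ^ 2) ∧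
      s ∈ sphere c r \ η.expDomain p}.Finite := by
  set E := η.expDomain p
  have hE : IsOpen E := isOpen_expDomain η p
  set K : Set ((ℂ × ℝ) × ℂ) := {q | (ball q.1.1 q.1.2 ⊆ E ∧ 0 ≤ q.1.2 ∧ q.1.2 ≤ R ∧
    P ≤ q.1.2 ^ 2 - ‖q.1.1‖ ^ 2) ∧ q.2 ∈ sphere q.1.1 q.1.2 \ E} with hK
  have hD := isCompact_setOf_disk E R P
  obtain ⟨M, hM⟩ := hD.isBounded.exists_norm_le
  have hKc : IsCompact K := by
    refine (hD.prod (isCompact_closedBall (0 : ℂ) (M + R))).of_isClosed_subset ?_ ?_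
    · have h1 : IsClosed {q : (ℂ × ℝ) × ℂ | dist q.2 q.1.1 = q.1.2} :=
        isClosed_eq (by fun_prop) (by fun_prop)
      exact (hD.isClosed.preimage continuous_fst).inter
        (h1.inter (hE.isClosed_compl.preimage continuous_snd))
    · rintro ⟨⟨c, r⟩, s⟩ ⟨hd, hs, -⟩
      refine ⟨hd, ?_⟩
      have h1 := hM (c, r) hd
      have h2 : ‖c‖ ≤ M := (norm_fst_le (c, r)).trans h1
      simp only [mem_sphere_iff_norm] at hs
      rw [mem_closedBall_zero_iff]
      have := norm_add_le (s - c) c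
      rw [sub_add_cancel] at this
      have h3 : r ≤ R := hd.2.2.1
      linarith
  have hfin : (Prod.snd '' (K ∩ K)).Finite := by
    refine hKc.induction_on (p := fun t => (Prod.snd '' (t ∩ K)).Finite) (by simp) ?_ ?_ ?_
    · exact fun s t hst ht => ht.subset (image_mono (inter_subset_inter_left _ hst))
    · intro s t hs ht
      rw [union_inter_distrib_right, image_union]
      exact hs.union ht
    · rintro ⟨⟨c, r⟩, s⟩ ⟨⟨hB, hr, hrR, hPr⟩, hs⟩
      refine ⟨_, mem_nhdsWithin_of_mem_nhds (eq_of_near_singular hord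
        (zero_mem_ball_of_power_pos hr hP hPr) hB hs), ?_⟩
      refine (finite_singleton s).subset ?_
      rintro _ ⟨⟨⟨c', r'⟩, s'⟩, ⟨h1, ⟨hB', hr', hrR', hPr'⟩, hs'⟩, rfl⟩
      exact h1 (zero_mem_ball_of_power_pos hr' hP hPr') hB' hs'
  rw [inter_self] at hfin
  refine hfin.subset ?_
  rintro s ⟨c, r, hd, hs⟩
  exact ⟨((c, r), s), ⟨hd, hs⟩, rfl⟩

theorem finite_sphere_diff_expDomain [T2Space X] [CompactSpace X]
    (hord : ∀ σ ∈ η.singularities, ∃ k : ℕ, η.order σ = k) (p : X) {c : ℂ} {r : ℝ}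
    (h0 : (0 : ℂ) ∈ ball c r) (hB : ball c r ⊆ η.expDomain p) :
    (sphere c r \ η.expDomain p).Finite := by
  have hr := pos_of_mem_ball h0
  have hP : 0 < r ^ 2 - ‖c‖ ^ 2 := by
    rw [mem_ball_iff_norm, zero_sub, norm_neg] at h0
    nlinarith [norm_nonneg c]
  exact (finite_singular_endpoints hord p r hP).subset fun s hs =>
    ⟨c, r, ⟨hB, hr.le, le_rfl, le_rfl⟩, hs⟩

open Classical in
/-- A chosen singular boundary point of the maximal flat disk around `v`. -/
noncomputable def apex (η : HolomorphicOneForm X) (v : X) : ℂ :=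
  if h : ∃ s, ball (0 : ℂ) ‖s‖ ⊆ η.expDomain v ∧ s ∉ η.expDomain v then h.choose else 0

/-- The condition defining `apex` forces its norm to be the maximal radius at `v`. Since `apex`
depends on `v` only, all points with the same Delaunay disk use the same fan. -/
theorem apex_spec {v : X} {r : ℝ} (hB : ball (0 : ℂ) r ⊆ η.expDomain v) {s : ℂ}
    (hs : s ∈ sphere (0 : ℂ) r \ η.expDomain v) : η.apex v ∈ sphere (0 : ℂ) r \ η.expDomain v := by
  have hsr : ‖s‖ = r := mem_sphere_zero_iff_norm.1 hs.1
  have h : ∃ s, ball (0 : ℂ) ‖s‖ ⊆ η.expDomain v ∧ s ∉ η.expDomain v := ⟨s, by rwa [hsr], hs.2⟩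
  rw [apex, dif_pos h]
  obtain ⟨h1, h2⟩ := h.choose_spec
  refine ⟨?_, h2⟩
  rw [mem_sphere_zero_iff_norm]
  refine le_antisymm ?_ ?_
  · by_contra! hlt
    exact hs.2 (h1 (by rwa [mem_ball_zero_iff, hsr]))
  · by_contra! hlt
    exact h2 (hB (by rwa [mem_ball_zero_iff]))

end HolomorphicOneForm

/-! ### Orientation and translation of triangles -/

/-- The oriented area of the parallelogram spanned by two plane vectors. -/
noncomputable def cross (u v : ℂ) : ℝ := u.re * v.im - u.im * v.re

theorem IsFanTriangle.cross_ne_zero {S : Set ℂ} {s₀ a b : ℂ} (h : IsFanTriangle S s₀ a b) :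
    cross (a - s₀) (b - s₀) ≠ 0 := by
  obtain ⟨-, -, hab, u, k, h0, ha, hb, -⟩ := h
  intro hc
  have e1 : inner ℝ u (a - s₀) = inner ℝ u (b - s₀) := by rw [inner_sub_right, inner_sub_right, ha, hb]
  have e2 : 0 < inner ℝ u (b - s₀) := by rw [inner_sub_right, hb]; linarith
  have key : (inner ℝ u (b - s₀) : ℝ) • (a - s₀ - (b - s₀)) = 0 := by
    simp only [Complex.inner, cross, Complex.mul_re, Complex.conj_re, Complex.conj_im] at e1 hc ⊢
    apply Complex.ext
    · simp only [Complex.real_smul, Complex.re_ofReal_mul, Complex.zero_re, Complex.sub_re,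
        Complex.sub_im] at *
      linear_combination u.im * hc + (b.re - s₀.re) * e1
    · simp only [Complex.real_smul, Complex.im_ofReal_mul, Complex.zero_im, Complex.sub_re,
        Complex.sub_im] at *
      linear_combination (-u.re) * hc + (b.im - s₀.im) * e1
  rcases smul_eq_zero.1 key with h | h
  · exact e2.ne' h
  · exact hab (by linear_combination h)

theorem IsFanTriangle.symm {S : Set ℂ} {s₀ a b : ℂ} (h : IsFanTriangle S s₀ a b) :
    IsFanTriangle S s₀ b a := by
  obtain ⟨ha, hb, hab, u, k, h0, hua, hub, hS⟩ := h
  exact ⟨hb, ha, hab.symm, u, k, h0, hub, hua, hS⟩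

theorem IsFanTriangle.sub {S S' : Set ℂ} {s₀ a b w : ℂ} (h : IsFanTriangle S s₀ a b)
    (hS : ∀ s ∈ S, s - w ∈ S') (hS' : ∀ s ∈ S', s + w ∈ S) :
    IsFanTriangle S' (s₀ - w) (a - w) (b - w) := by
  obtain ⟨ha, hb, hab, u, k, h0, hua, hub, hk⟩ := h
  refine ⟨hS a ha, hS b hb, fun h => hab (sub_left_injective h), u, k - inner ℝ u w, ?_, ?_, ?_,
    fun s hs => ?_⟩
  · rw [inner_sub_right]; linarith
  · rw [inner_sub_right, hua]
  · rw [inner_sub_right, hub]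
  · have := hk _ (hS' s hs)
    rw [inner_add_right] at this
    linarith

theorem IsFanTriangle.ne {S : Set ℂ} {s₀ a b : ℂ} (h : IsFanTriangle S s₀ a b) :
    a ≠ s₀ ∧ b ≠ s₀ := by
  obtain ⟨-, -, -, u, k, h0, hua, hub, -⟩ := h
  constructor
  · rintro rfl
    exact h0.ne hua
  · rintro rfl
    exact h0.ne hub

theorem openTriangle_swap {a b c z : ℂ} (h : z ∈ openTriangle a b c) : z ∈ openTriangle a c b := by
  obtain ⟨α, β, γ, hα, hβ, hγ, hs, he⟩ := h
  exact ⟨α, γ, β, hα, hγ, hβ, by linarith, by rw [he]; abel⟩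

theorem sub_mem_openTriangle {a b c z : ℂ} (h : z ∈ openTriangle a b c) (w : ℂ) :
    z - w ∈ openTriangle (a - w) (b - w) (c - w) := by
  obtain ⟨α, β, γ, hα, hβ, hγ, hs, he⟩ := h
  refine ⟨α, β, γ, hα, hβ, hγ, hs, ?_⟩
  have : w = (α + β + γ) • w := by rw [hs, one_smul]
  rw [he]
  nth_rewrite 1 [this]
  module

theorem openTriangle_subset_convexHull {S : Set ℂ} {a b c : ℂ} (ha : a ∈ S) (hb : b ∈ S)
    (hc : c ∈ S) : openTriangle a b c ⊆ convexHull ℝ S := by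
  rintro z ⟨α, β, γ, hα, hβ, hγ, hs, rfl⟩
  have := (convex_convexHull ℝ S).sum_mem (t := Finset.univ) (w := ![α, β, γ]) (z := ![a, b, c])
    (by intro i _; fin_cases i <;> simp [hα.le, hβ.le, hγ.le])
    (by simp [Fin.sum_univ_three, hs])
    (by intro i _; fin_cases i
        · exact subset_convexHull ℝ S ha
        · exact subset_convexHull ℝ S hb
        · exact subset_convexHull ℝ S hc)
  simpa [Fin.sum_univ_three] using this

theorem openTriangle_subset_ball {a b c o : ℂ} {r : ℝ} (ha : a ∈ sphere o r) (hb : b ∈ sphere o r)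
    (hc : c ∈ sphere o r) (hbc : b ≠ c) : openTriangle a b c ⊆ ball o r := by
  rintro z ⟨α, β, γ, hα, hβ, hγ, hs, he⟩
  have hr : r ≠ 0 := by
    rintro rfl
    rw [sphere_zero, mem_singleton_iff] at hb hc
    exact hbc (hb.trans hc.symm)
  have hβγ : 0 < β + γ := by linarith
  have hm : (β / (β + γ)) • b + (γ / (β + γ)) • c ∈ ball o r := by
    have := (strictConvex_closedBall ℝ o r) (sphere_subset_closedBall hb)
      (sphere_subset_closedBall hc) hbc (div_pos hβ hβγ) (div_pos hγ hβγ)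
      (by field_simp)
    rwa [interior_closedBall _ hr] at this
  have hz : z = (β + γ) • ((β / (β + γ)) • b + (γ / (β + γ)) • c) + α • a := by
    rw [he, smul_add, smul_smul, smul_smul, mul_div_cancel₀ _ hβγ.ne', mul_div_cancel₀ _ hβγ.ne']
    abel
  rw [← interior_closedBall _ hr] at hm ⊢
  rw [hz]
  exact (convex_closedBall o r).combo_interior_self_mem_interior hm (sphere_subset_closedBall ha)
    hβγ hα.le (by linarith)

/-! ### Delaunay triangles: disjointness and covering -/

namespace HolomorphicOneForm

variable {X : Type*} [TopologicalSpace X] [ChartedSpace ℂ X] [IsManifold 𝓘(ℂ) ω X]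
variable {η : HolomorphicOneForm X} {ψ ψ' : ℂ → X} {z : ℂ}

/-- The triangles of a Delaunay triangulation of the flat surface: `(v, a, b)` stands for the
triangle with vertices `apex v`, `a`, `b` inscribed in the maximal flat disk around `v`. -/
def delaunayTriangles (η : HolomorphicOneForm X) : Set (X × ℂ × ℂ) :=
  {t | ball (0 : ℂ) ‖η.apex t.1‖ ⊆ η.expDomain t.1 ∧ 0 < ‖η.apex t.1‖ ∧
    η.apex t.1 ∉ η.expDomain t.1 ∧
    IsFanTriangle (sphere (0 : ℂ) ‖η.apex t.1‖ \ η.expDomain t.1) (η.apex t.1) t.2.1 t.2.2 ∧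
    0 < cross (t.2.1 - η.apex t.1) (t.2.2 - η.apex t.1)}

/-- The open triangle, in the tangent plane of `v`, of a Delaunay triangle `(v, a, b)`. -/
def flatTriangle (η : HolomorphicOneForm X) (t : X × ℂ × ℂ) : Set ℂ :=
  openTriangle (η.apex t.1) t.2.1 t.2.2

theorem flatTriangle_subset_ball {t : X × ℂ × ℂ} (ht : t ∈ η.delaunayTriangles) :
    η.flatTriangle t ⊆ ball 0 ‖η.apex t.1‖ :=
  openTriangle_subset_ball (by simp) ht.2.2.2.1.1.1 ht.2.2.2.1.2.1.1 ht.2.2.2.1.2.2.1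

theorem flatOn_flatTriangle [T2Space X] {t : X × ℂ × ℂ} (ht : t ∈ η.delaunayTriangles) :
    η.FlatOn (η.expMap t.1) (η.flatTriangle t) :=
  (flatOn_expMap η t.1).mono ((flatTriangle_subset_ball ht).trans ht.1)

/-- Recentred at the common image point, both disks are empty and have 0 in the hull of their
singular points, so they coincide. Then the centres agree, and so do the fan triangles. -/
theorem delaunayTriangles_injective [T2Space X] {t t' : X × ℂ × ℂ} {z z' : ℂ}
    (ht : t ∈ η.delaunayTriangles) (ht' : t' ∈ η.delaunayTriangles) (hz : z ∈ η.flatTriangle t)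
    (hz' : z' ∈ η.flatTriangle t') (h : η.expMap t.1 z = η.expMap t'.1 z') : t = t' ∧ z = z' := by
  have hzB := flatTriangle_subset_ball ht hz
  have hzB' := flatTriangle_subset_ball ht' hz'
  obtain ⟨v, a, b⟩ := t
  obtain ⟨v', a', b'⟩ := t'
  obtain ⟨hB, hr, hs, hfan, hor⟩ := ht
  obtain ⟨hB', hr', hs', hfan', hor'⟩ := ht'
  simp only [flatTriangle] at hz hz' hzB hzB' h hB hr hs hfan hor hB' hr' hs' hfan' hor'
  obtain ⟨r1, r2, r3⟩ := recenter (mem_ball_self hr) hB hzB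
  obtain ⟨r1', r2', r3'⟩ := recenter (mem_ball_self hr') hB' hzB'
  rw [← h] at r1' r2' r3'
  have hsph : ∀ {o y w : ℂ} {r : ℝ}, y ∈ sphere o r → y - w ∈ sphere (o - w) r := fun hy => by
    simpa [mem_sphere] using hy
  have hv : ∀ {s}, s ∈ sphere (0 : ℂ) ‖η.apex v‖ \ η.expDomain v →
      s - z ∈ sphere (0 - z) ‖η.apex v‖ \ η.expDomain (η.expMap v z) :=
    fun hs => ⟨hsph hs.1, r3 _ hs.1 hs.2⟩
  have hv' : ∀ {s}, s ∈ sphere (0 : ℂ) ‖η.apex v'‖ \ η.expDomain v' →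
      s - z' ∈ sphere (0 - z') ‖η.apex v'‖ \ η.expDomain (η.expMap v z) :=
    fun hs => ⟨hsph hs.1, r3' _ hs.1 hs.2⟩
  have hne := hfan.ne
  have h0 := sub_mem_openTriangle hz z
  rw [sub_self] at h0
  have h0' : (0 : ℂ) ∈ convexHull ℝ (sphere (0 - z') ‖η.apex v'‖ \ η.expDomain (η.expMap v z)) := by
    have h1 := sub_mem_openTriangle hz' z'
    rw [sub_self] at h1
    exact openTriangle_subset_convexHull (hv' ⟨by simp, hs'⟩) (hv' hfan'.1) (hv' hfan'.2.1) h1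
  obtain ⟨hc, hrr⟩ := disk_eq_of_mem_openTriangle hr.le hr'.le r1 r1'
    (hv (s := η.apex v) ⟨by simp, hs⟩) (hv hfan.1) (hv hfan.2.1)
    (fun e => hne.1 (sub_left_injective e)) (fun e => hne.2 (sub_left_injective e))
    (fun e => hfan.2.2.1 (sub_left_injective e)) h0 h0'
  have hzz : z = z' := by linear_combination hc
  subst hzz
  have hvv : v = v' := by
    have e1 := r2 0 (mem_ball_self hr)
    have e2 := r2' 0 (mem_ball_self hr')
    rw [expMap_zero] at e1 e2
    exact e1.symm.trans e2
  subst hvv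
  refine ⟨?_, rfl⟩
  rcases hfan.eq_or_eq (fun s hs => hs.1) hfan' hz hz' with ⟨h1, h2⟩ | ⟨h1, h2⟩
  · rw [h1, h2]
  -- The sign condition in `delaunayTriangles` selects one of the two orderings of the edge.
  · exfalso
    rw [h1, h2] at hor
    simp only [cross] at hor hor'
    linarith

/-- Points on a chord between two singular boundary points of an empty disk. -/
def IsChordPoint (η : HolomorphicOneForm X) (p : X) : Prop :=
  ∃ c r, (0 : ℂ) ∈ ball c r ∧ ball c r ⊆ η.expDomain p ∧
    (∀ ε, 0 ≤ ε → ball (0 : ℂ) ε ⊆ η.expDomain p → ε ^ 2 ≤ r ^ 2 - ‖c‖ ^ 2) ∧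
    ∃ a ∈ sphere c r \ η.expDomain p, ∃ b ∈ sphere c r \ η.expDomain p, a ≠ b ∧
      ∃ t : ℝ, (0 : ℂ) = a + t • (b - a)

theorem radius_le [T2Space X] [CompactSpace X] [ConnectedSpace X] (hne : η.singularities.Nonempty)
    {p : X} {c : ℂ} {r : ℝ} (hB : ball c r ⊆ η.expDomain p) : r ≤ η.coveringRadius :=
  ((flatOn_expMap η p).mono hB).radius_le_coveringRadius hne

/-- The disk of maximal power at `p`, recentred at its own centre `v`, is the maximal disk around
`v`, and `p` lies in the hull of its singular points. -/
theorem exists_mem_flatTriangle [T2Space X] [CompactSpace X] [ConnectedSpace X]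
    (hne : η.singularities.Nonempty)
    (hord : ∀ σ ∈ η.singularities, ∃ k : ℕ, η.order σ = k) {p : X} (hp : p ∉ η.singularities)
    (hchord : ¬ η.IsChordPoint p) :
    ∃ t ∈ η.delaunayTriangles, ∃ z ∈ η.flatTriangle t, η.expMap t.1 z = p := by
  obtain ⟨c, r, h0, hB, hconv, hpow⟩ := exists_disk_maximal_power (isOpen_expDomain η p)
    (zero_mem_expDomain hp) (fun c r => radius_le hne)
    (fun c r => finite_sphere_diff_expDomain hord p)
  have hr := pos_of_mem_ball h0
  set S := sphere c r \ η.expDomain p with hS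
  set v := η.expMap p c with hv
  obtain ⟨r1, r2, r3⟩ := recenter h0 hB (mem_ball_self hr)
  rw [sub_self] at r1
  have hcB : -c ∈ ball (0 : ℂ) r := by simpa [mem_ball_iff_norm] using h0
  obtain ⟨q1, q2, q3⟩ := recenter (mem_ball_self hr) r1 hcB
  have hback : η.expMap v (-c) = p := by
    have := r2 0 h0
    rwa [zero_sub, expMap_zero] at this
  rw [hback] at q3
  have hto : ∀ s ∈ S, s - c ∈ sphere (0 : ℂ) r \ η.expDomain v := fun s hs =>
    ⟨by simpa [mem_sphere_iff_norm] using hs.1, r3 s hs.1 hs.2⟩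
  have hfrom : ∀ s ∈ sphere (0 : ℂ) r \ η.expDomain v, s + c ∈ S := fun s hs =>
    ⟨by simpa [mem_sphere_iff_norm] using hs.1, by simpa using q3 s hs.1 hs.2⟩
  obtain ⟨s, hs⟩ : S.Nonempty := convexHull_nonempty_iff.1 ⟨0, hconv⟩
  have hapex := apex_spec r1 (hto s hs)
  have hapr : ‖η.apex v‖ = r := mem_sphere_zero_iff_norm.1 hapex.1
  obtain ⟨a, b, hfan, hz⟩ := exists_isFanTriangle (finite_sphere_diff_expDomain hord p h0 hB)
    (fun s hs => hs.1) (hfrom _ hapex) hconv h0 (by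
      intro a ha b hb hab t he
      exact hchord ⟨c, r, h0, hB, hpow, a, ha, b, hb, hab, t, he⟩)
  have hfan' := hfan.sub hto hfrom
  have hz' := sub_mem_openTriangle hz c
  rw [add_sub_cancel_right] at hfan' hz'
  rw [zero_sub] at hz'
  have hbase : ∀ a b, IsFanTriangle (sphere (0 : ℂ) r \ η.expDomain v) (η.apex v) a b →
      0 < cross (a - η.apex v) (b - η.apex v) → (v, a, b) ∈ η.delaunayTriangles := by
    intro a b h1 h2
    refine ⟨?_, ?_, hapex.2, ?_, h2⟩ <;> simp only [hapr]
    · exact r1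
    · exact hr
    · exact h1
  rcases lt_or_gt_of_ne hfan'.cross_ne_zero with hlt | hgt
  · refine ⟨_, hbase _ _ hfan'.symm ?_, -c, openTriangle_swap hz', hback⟩
    simp only [cross] at hlt ⊢
    linarith
  · exact ⟨_, hbase _ _ hfan' hgt, -c, hz', hback⟩

/-- The chord points near a regular point lie on finitely many lines. -/
theorem exists_finite_lines [T2Space X] [CompactSpace X] [ConnectedSpace X]
    (hne : η.singularities.Nonempty)
    (hord : ∀ σ ∈ η.singularities, ∃ k : ℕ, η.order σ = k) {q : X} (hq : q ∉ η.singularities) :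
    ∃ ε > 0, ball (0 : ℂ) ε ⊆ η.expDomain q ∧ ∃ F : Set ℂ, F.Finite ∧ ∀ w ∈ ball (0 : ℂ) ε,
      η.IsChordPoint (η.expMap q w) → ∃ a ∈ F, ∃ b ∈ F, a ≠ b ∧ ∃ t : ℝ, w = a + t • (b - a) := by
  obtain ⟨ε₁, hε₁, hb⟩ := Metric.isOpen_iff.1 (isOpen_expDomain η q) 0 (zero_mem_expDomain hq)
  set R := η.coveringRadius with hR
  have hεR : ε₁ ≤ R := radius_le hne hb
  have hRpos : 0 < R := hε₁.trans_le hεR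
  -- The maximal power at a point near `q` is at least (ε₁/2)². Returning to `q` costs at most 2Rε +
  -- ε₁²/32 = 3ε₁²/32, so power ε₁²/16 remains and the finiteness result at `q` applies.
  set ε := ε₁ ^ 2 / (32 * R) with hε
  have hεpos : 0 < ε := by positivity
  have hεR' : R * ε = ε₁ ^ 2 / 32 := by rw [hε]; field_simp
  have hεle : ε ≤ ε₁ / 32 := by
    rw [hε, div_le_div_iff₀ (by positivity) (by norm_num)]
    nlinarith
  have hbε : ball (0 : ℂ) ε ⊆ ball 0 ε₁ := ball_subset_ball (by linarith)
  refine ⟨ε, hεpos, hbε.trans hb, _,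
    finite_singular_endpoints hord q R (show 0 < ε₁ ^ 2 / 16 by positivity), ?_⟩
  rintro w hw ⟨c, r, h0, hB, hpow, a, ha, b, hb', hab, t, ht⟩
  obtain ⟨r1, r2, r3⟩ := recenter (mem_ball_self hε₁) hb (hbε hw)
  have hwn : ‖w‖ < ε := mem_ball_zero_iff.1 hw
  have hr := pos_of_mem_ball h0
  have hrR : r ≤ R := radius_le hne hB
  have hpow' := hpow (ε₁ / 2) (by positivity) ((ball_subset (by
    rw [dist_eq_norm, zero_sub, zero_sub, neg_neg]
    linarith)).trans r1)
  have hcr : ‖c‖ < r := by simpa [mem_ball_iff_norm] using h0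
  have hcw : ‖c + w‖ ^ 2 ≤ ‖c‖ ^ 2 + 2 * (R * ε) + ε₁ ^ 2 / 32 := by
    have h1 : ‖c + w‖ ≤ ‖c‖ + ‖w‖ := norm_add_le _ _
    have h2 : ‖c‖ * ‖w‖ ≤ R * ε := by gcongr; linarith
    have h3 : ‖w‖ ^ 2 ≤ ε₁ ^ 2 / 32 := by nlinarith [norm_nonneg w]
    nlinarith [norm_nonneg (c + w)]
  have hP : ε₁ ^ 2 / 16 ≤ r ^ 2 - ‖c + w‖ ^ 2 := by nlinarith
  have hwB : -w ∈ ball c r := by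
    have := zero_mem_ball_of_power_pos hr.le (show 0 < ε₁ ^ 2 / 16 by positivity) hP
    rw [mem_ball_iff_norm] at this ⊢
    rwa [show -w - c = 0 - (c + w) by ring]
  obtain ⟨q1, q2, q3⟩ := recenter h0 hB hwB
  have hback : η.expMap (η.expMap q w) (-w) = q := by
    have := r2 0 (mem_ball_self hε₁)
    rwa [zero_sub, expMap_zero] at this
  rw [hback, sub_neg_eq_add] at q1
  rw [hback] at q3
  have hF : ∀ s ∈ sphere c r \ η.expDomain (η.expMap q w), s + w ∈
      {s : ℂ | ∃ c r, (ball c r ⊆ η.expDomain q ∧ 0 ≤ r ∧ r ≤ R ∧ ε₁ ^ 2 / 16 ≤ r ^ 2 - ‖c‖ ^ 2) ∧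
        s ∈ sphere c r \ η.expDomain q} := fun s hs =>
    ⟨c + w, r, ⟨q1, hr.le, hrR, hP⟩, by simpa [mem_sphere_iff_norm] using hs.1,
      by simpa using q3 s hs.1 hs.2⟩
  refine ⟨_, hF a ha, _, hF b hb', fun h => hab (add_left_injective w h), t, ?_⟩
  rw [add_sub_add_right_eq_sub, add_right_comm, ← ht, zero_add]

end HolomorphicOneForm

/-! ### The angle sum of a triangle, in terms of areas -/

theorem abs_cross_le (u v : ℂ) : |cross u v| ≤ 2 * (‖u‖ * ‖v‖) := by
  have h1 : |u.re * v.im| ≤ ‖u‖ * ‖v‖ := by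
    rw [abs_mul]
    exact mul_le_mul (Complex.abs_re_le_norm u) (Complex.abs_im_le_norm v) (abs_nonneg _)
      (norm_nonneg _)
  have h2 : |u.im * v.re| ≤ ‖u‖ * ‖v‖ := by
    rw [abs_mul]
    exact mul_le_mul (Complex.abs_im_le_norm u) (Complex.abs_re_le_norm v) (abs_nonneg _)
      (norm_nonneg _)
  have := abs_sub (u.re * v.im) (u.im * v.re)
  unfold cross
  linarith

theorem smul_add_smul_eq_of_cross {u w : ℂ} (h : cross u w ≠ 0) (y : ℂ) :
    y = (cross y w / cross u w) • u + (cross u y / cross u w) • w := by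
  apply Complex.ext
  · simp only [Complex.add_re, Complex.smul_re, smul_eq_mul]
    rw [div_mul_eq_mul_div, div_mul_eq_mul_div, ← add_div, eq_div_iff h]
    simp only [cross]
    ring
  · simp only [Complex.add_im, Complex.smul_im, smul_eq_mul]
    rw [div_mul_eq_mul_div, div_mul_eq_mul_div, ← add_div, eq_div_iff h]
    simp only [cross]
    ring

theorem volume_cross_eq_zero {p : ℂ} (hp : p ≠ 0) : volume {y : ℂ | cross p y = 0} = 0 := by
  have hl : IsLinearMap ℝ (cross p) :=
    ⟨fun x y => by simp [cross]; ring, fun c x => by simp [cross]; ring⟩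
  have h : {y : ℂ | cross p y = 0} = (LinearMap.ker hl.mk' : Submodule ℝ ℂ) := by
    ext y; simp
  rw [h]
  refine Measure.addHaar_submodule _ _ fun htop => hp ?_
  have h1 : Complex.I * p ∈ LinearMap.ker hl.mk' := htop ▸ Submodule.mem_top
  have h2 : Complex.normSq p = 0 := by
    rw [LinearMap.mem_ker, IsLinearMap.mk'_apply] at h1
    simp only [cross, Complex.mul_re, Complex.mul_im, Complex.I_re, Complex.I_im] at h1
    rw [Complex.normSq_apply]
    linarith
  exact Complex.normSq_eq_zero.1 h2

/-- The open convex cone spanned by two vectors. -/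
def openCone (u v : ℂ) : Set ℂ :=
  {z | ∃ α β : ℝ, 0 < α ∧ 0 < β ∧ z = α • u + β • v}

theorem exists_add_mem_openTriangle {a b c : ℂ} (h : cross (b - a) (c - a) ≠ 0) :
    ∃ ε₀ > 0, ∀ y ∈ ball (0 : ℂ) ε₀, y ∈ openCone (b - a) (c - a) → a + y ∈ openTriangle a b c := by
  set D := cross (b - a) (c - a) with hD
  have hDp : 0 < |D| := abs_pos.2 h
  refine ⟨|D| / (2 * ‖c - b‖ + 1), by positivity, ?_⟩
  rintro y hy ⟨α, β, hα, hβ, rfl⟩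
  have hlt : α + β < 1 := by
    have h1 : cross (α • (b - a) + β • (c - a)) (c - b) = (α + β) * D := by
      simp only [hD, cross, Complex.add_re, Complex.add_im, Complex.smul_re, Complex.smul_im,
        Complex.sub_re, Complex.sub_im, smul_eq_mul]
      ring
    have h2 := abs_cross_le (α • (b - a) + β • (c - a)) (c - b)
    rw [h1, abs_mul, abs_of_pos (by positivity)] at h2
    rw [mem_ball_zero_iff, lt_div_iff₀ (by positivity)] at hy
    have h3 : (α + β) * |D| < 1 * |D| := by
      nlinarith [norm_nonneg (α • (b - a) + β • (c - a))]
    exact lt_of_mul_lt_mul_right h3 hDp.le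
  refine ⟨1 - α - β, α, β, by linarith, hα, hβ, by ring, ?_⟩
  module

/-- The lines spanned by u, w and u + w cut the disk into six sectors: these three and their
negatives. -/
theorem volume_ball_le_openCone {u w : ℂ} (h : cross u w ≠ 0) (ε : ℝ) :
    volume (ball (0 : ℂ) ε) ≤ 2 * (volume (openCone u (u + w) ∩ ball 0 ε) +
      volume (openCone w (-u) ∩ ball 0 ε) + volume (openCone (-u - w) (-w) ∩ ball 0 ε)) := by
  set C₁ := openCone u (u + w) ∩ ball 0 ε
  set C₂ := openCone w (-u) ∩ ball 0 ε
  set C₃ := openCone (-u - w) (-w) ∩ ball 0 ε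
  have hu : u ≠ 0 := by rintro rfl; simp [cross] at h
  have hw : w ≠ 0 := by rintro rfl; simp [cross] at h
  have huw : u + w ≠ 0 := by
    intro h0
    rw [eq_neg_of_add_eq_zero_left h0] at h
    simp only [cross, Complex.neg_re, Complex.neg_im] at h
    exact h (by ring)
  have hcov : ball (0 : ℂ) ε ⊆ (C₁ ∪ -C₁) ∪ (C₂ ∪ -C₂) ∪ (C₃ ∪ -C₃) ∪
      ({y | cross u y = 0} ∪ {y | cross w y = 0} ∪ {y | cross (u + w) y = 0}) := by
    intro y hy
    have hny : -y ∈ ball (0 : ℂ) ε := by simpa using hy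
    have hyc := smul_add_smul_eq_of_cross h y
    set s := cross y w / cross u w with hs
    set t := cross u y / cross u w with ht
    by_cases ht0 : t = 0
    · have : cross u y = 0 := by simpa [ht, h] using ht0
      exact Or.inr (Or.inl (Or.inl this))
    by_cases hs0 : s = 0
    · have : cross y w = 0 := by simpa [hs, h] using hs0
      refine Or.inr (Or.inl (Or.inr ?_))
      simp only [cross, mem_ofPred_eq] at this ⊢
      linarith
    by_cases hst : s = t
    · have : cross y w = cross u y := by
        rw [hs, ht, div_left_inj' h] at hst
        exact hst
      refine Or.inr (Or.inr ?_)
      simp only [cross, mem_ofPred_eq, Complex.add_re, Complex.add_im] at this ⊢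
      linarith
    refine Or.inl ?_
    rcases lt_or_gt_of_ne ht0 with ht1 | ht1 <;> rcases lt_or_gt_of_ne hs0 with hs1 | hs1
    · rcases lt_or_gt_of_ne hst with h1 | h1
      · exact Or.inl (Or.inl (Or.inr ⟨⟨t - s, -t, by linarith, by linarith,
          by rw [hyc]; module⟩, hny⟩))
      · exact Or.inr (Or.inl ⟨⟨-s, s - t, by linarith, by linarith, by rw [hyc]; module⟩, hy⟩)
    · exact Or.inl (Or.inr (Or.inr ⟨⟨-t, s, by linarith, by linarith, by rw [hyc]; module⟩, hny⟩))
    · exact Or.inl (Or.inr (Or.inl ⟨⟨t, -s, by linarith, by linarith, by rw [hyc]; module⟩, hy⟩))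
    · rcases lt_or_gt_of_ne hst with h1 | h1
      · exact Or.inr (Or.inr ⟨⟨s, t - s, by linarith, by linarith, by rw [hyc]; module⟩, hny⟩)
      · exact Or.inl (Or.inl (Or.inl ⟨⟨s - t, t, by linarith, by linarith,
          by rw [hyc]; module⟩, hy⟩))
  have hdouble : ∀ C : Set ℂ, volume (C ∪ -C) ≤ 2 * volume C := fun C => by
    refine (measure_union_le _ _).trans ?_
    rw [Measure.measure_neg, two_mul]
  have hnull : volume ({y : ℂ | cross u y = 0} ∪ {y | cross w y = 0} ∪ {y | cross (u + w) y = 0})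
      = 0 :=
    measure_union_null (measure_union_null (volume_cross_eq_zero hu) (volume_cross_eq_zero hw))
      (volume_cross_eq_zero huw)
  calc volume (ball (0 : ℂ) ε) ≤ volume ((C₁ ∪ -C₁) ∪ (C₂ ∪ -C₂) ∪ (C₃ ∪ -C₃)) + 0 := by
        rw [← hnull]
        exact (measure_mono hcov).trans (measure_union_le _ _)
    _ ≤ 2 * volume C₁ + 2 * volume C₂ + 2 * volume C₃ := by
        rw [add_zero]
        exact (measure_union_le _ _).trans (add_le_add ((measure_union_le _ _).trans
          (add_le_add (hdouble _) (hdouble _))) (hdouble _))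
    _ = _ := by rw [mul_add, mul_add]

theorem openTriangle_rotate (a b c : ℂ) : openTriangle a b c = openTriangle b c a := by
  ext z
  constructor
  · rintro ⟨α, β, γ, hα, hβ, hγ, hs, he⟩
    exact ⟨β, γ, α, hβ, hγ, hα, by linarith, by rw [he]; abel⟩
  · rintro ⟨α, β, γ, hα, hβ, hγ, hs, he⟩
    exact ⟨γ, α, β, hγ, hα, hβ, by linarith, by rw [he]; abel⟩

theorem exists_volume_openCone_le {a b c : ℂ} (h : cross (b - a) (c - a) ≠ 0) :
    ∃ ε₀ > 0, ∀ ε ≤ ε₀, volume (openCone (b - a) (c - a) ∩ ball 0 ε) ≤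
      volume (openTriangle a b c ∩ ball a ε) := by
  obtain ⟨ε₀, hε₀, H⟩ := exists_add_mem_openTriangle h
  refine ⟨ε₀, hε₀, fun ε hε => ?_⟩
  rw [← measure_preimage_add volume a (openTriangle a b c ∩ ball a ε)]
  refine measure_mono fun y hy => ⟨H y (ball_subset_ball hε hy.2) hy.1, ?_⟩
  simpa [mem_ball_iff_norm] using hy.2

/-- The angles of a triangle add up to at least `π`. -/
theorem exists_volume_ball_le_corners {a b c : ℂ} (h : cross (b - a) (c - a) ≠ 0) :
    ∃ ε₀ > 0, ∀ ε ≤ ε₀, volume (ball (0 : ℂ) ε) ≤ 2 * (volume (openTriangle a b c ∩ ball a ε) +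
      volume (openTriangle a b c ∩ ball b ε) + volume (openTriangle a b c ∩ ball c ε)) := by
  have hb : cross (c - b) (a - b) ≠ 0 := by
    convert h using 1; simp only [cross, Complex.sub_re, Complex.sub_im]; ring
  have hc : cross (a - c) (b - c) ≠ 0 := by
    convert h using 1; simp only [cross, Complex.sub_re, Complex.sub_im]; ring
  have huw : cross (b - a) (c - b) ≠ 0 := by
    convert h using 1; simp only [cross, Complex.sub_re, Complex.sub_im]; ring
  obtain ⟨ε₁, h₁, H₁⟩ := exists_volume_openCone_le h
  obtain ⟨ε₂, h₂, H₂⟩ := exists_volume_openCone_le hb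
  obtain ⟨ε₃, h₃, H₃⟩ := exists_volume_openCone_le hc
  refine ⟨min ε₁ (min ε₂ ε₃), by positivity, fun ε hε => ?_⟩
  obtain ⟨hε₁, hε₂, hε₃⟩ : ε ≤ ε₁ ∧ ε ≤ ε₂ ∧ ε ≤ ε₃ := by simpa using hε
  -- For u = b - a and w = c - b the three cones are those of the triangle at `a`, `b` and `c`.
  have key := volume_ball_le_openCone huw ε
  rw [show b - a + (c - b) = c - a by ring, show -(b - a) = a - b by ring,
    show a - b - (c - b) = a - c by ring, show -(c - b) = b - c by ring] at key
  refine key.trans ?_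
  have e₂ := H₂ ε hε₂
  have e₃ := H₃ ε hε₃
  rw [← openTriangle_rotate a b c] at e₂
  rw [openTriangle_rotate c a b] at e₃
  exact mul_le_mul_right (add_le_add (add_le_add (H₁ ε hε₁) e₂) e₃) 2

theorem lintegral_norm_pow_ball (k : ℕ) {ρ : ℝ} (hρ : 0 ≤ ρ) :
    ∫⁻ z in ball (0 : ℂ) ρ, ENNReal.ofReal (‖z‖ ^ (2 * k)) =
      ENNReal.ofReal (Real.pi / (k + 1) * ρ ^ (2 * k + 2)) := by
  rw [← ofReal_integral_eq_lintegral_ofReal]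
  · congr 1
    rw [← integral_indicator measurableSet_ball]
    have h1 : (ball (0 : ℂ) ρ).indicator (fun z : ℂ => ‖z‖ ^ (2 * k)) =
        fun z => (Iio ρ).indicator (fun r : ℝ => r ^ (2 * k)) ‖z‖ := by
      ext z
      simp [indicator]
    rw [h1, integral_fun_norm_addHaar volume, Complex.finrank_real_complex]
    have h2 : volume.real (ball (0 : ℂ) 1) = Real.pi := by
      simp [Measure.real, Complex.volume_ball]
    have h3 : ∀ y : ℝ, y ^ (2 - 1) • (Iio ρ).indicator (fun r : ℝ => r ^ (2 * k)) y =
        (Iio ρ).indicator (fun r : ℝ => r ^ (2 * k + 1)) y := fun y => by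
      by_cases hy : y ∈ Iio ρ
      · rw [indicator_of_mem hy, indicator_of_mem hy, smul_eq_mul]; ring
      · rw [indicator_of_notMem hy, indicator_of_notMem hy, smul_zero]
    simp only [h3]
    rw [h2, setIntegral_indicator measurableSet_Iio, Ioi_inter_Iio, ← integral_Ioc_eq_integral_Ioo,
      ← intervalIntegral.integral_of_le hρ, integral_pow]
    simp only [nsmul_eq_mul, smul_eq_mul]
    push_cast
    field_simp
    ring
  · refine (Continuous.continuousOn (by fun_prop)).integrableOn_compact
      (isCompact_closedBall (0 : ℂ) ρ) |>.mono_set ball_subset_closedBall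
  · exact Eventually.of_forall fun z => by positivity

theorem abs_det_fderiv_of_hasDerivAt (w : ℂ) :
    |((ContinuousLinearMap.toSpanSingleton ℂ w : ℂ →L[ℂ] ℂ).restrictScalars ℝ).det| = ‖w‖ ^ 2 := by
  have h1 : ((ContinuousLinearMap.toSpanSingleton ℂ w : ℂ →L[ℂ] ℂ).restrictScalars ℝ : ℂ →ₗ[ℝ] ℂ) =
      Algebra.lmul ℝ ℂ w := by
    ext x
    simp [mul_comm]
  have h2 := Algebra.norm_complex_apply w
  rw [Algebra.norm_apply] at h2
  rw [ContinuousLinearMap.det, h1, h2, Complex.normSq_eq_norm_sq, abs_of_nonneg (by positivity)]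

/-! ### Area near a zero -/

namespace HolomorphicOneForm

variable {X : Type*} [TopologicalSpace X] [ChartedSpace ℂ X] [IsManifold 𝓘(ℂ) ω X]
variable {η : HolomorphicOneForm X} {ψ ψ' : ℂ → X} {z : ℂ}

/-- A flat injective map preserves area. -/
theorem lintegral_image_chart {p : X} {V : Set ℂ} (hV : MeasurableSet V) (hψ : η.FlatOn ψ V)
    (hp : MapsTo ψ V (chartAt ℂ p).source) (hinj : InjOn ψ V) :
    ∫⁻ z in (chartAt ℂ p ∘ ψ) '' V, ‖η.coeff p z‖ₑ ^ 2 = volume V := by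
  choose! w hw hw1 using fun z hz => (hψ z hz).hasDerivAt (p := p) (hp hz)
  rw [lintegral_image_eq_lintegral_abs_det_fderiv_mul volume hV
    (fun z hz => ((hw z hz).hasFDerivAt.restrictScalars ℝ).hasFDerivWithinAt)
    ((chartAt ℂ p).injOn.comp hinj hp)]
  rw [← setLIntegral_one]
  refine setLIntegral_congr_fun hV fun z hz => ?_
  simp only [Function.comp_apply]
  rw [abs_det_fderiv_of_hasDerivAt, ← ofReal_norm, ← ENNReal.ofReal_pow (norm_nonneg _),
    ← ENNReal.ofReal_mul (by positivity), ← mul_pow, mul_comm, ← norm_mul, hw1 z hz]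
  simp

/-- The area of the part of a chart disk around a zero of order `k` in which the primitive has
norm less than `ε`. -/
theorem exists_lintegral_prim_le {σ : X} {k : ℕ} (hk : η.order σ = k) {δ : ℝ} (hδ : 0 < δ)
    (hδ1 : δ < 1) : ∃ ρ₀ > 0, ∀ ε > 0,
      ∫⁻ z in ball (chartAt ℂ σ σ) ρ₀ ∩ {z | ‖η.prim σ z‖ < ε}, ‖η.coeff σ z‖ₑ ^ 2 ≤
        ENNReal.ofReal (((1 + δ) / (1 - δ)) ^ 2 * ((k + 1) * (Real.pi * ε ^ 2))) := by
  obtain ⟨A, hA, h⟩ := exists_bounds_prim hk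
  obtain ⟨ρ₀, hρ₀, hb⟩ := Metric.eventually_nhds_iff_ball.1 (h δ hδ)
  refine ⟨ρ₀, hρ₀, fun ε hε => ?_⟩
  set c := chartAt ℂ σ σ with hc
  have hδ' : 0 < 1 - δ := by linarith
  -- Chosen so that (1 - δ)A/(k + 1) · ρ^(k + 1) = ε: the lower bound for the primitive confines the
  -- region to the disk of radius ρ.
  set x : ℝ := ε * (k + 1) / ((1 - δ) * A) with hx
  have hx0 : 0 < x := by positivity
  obtain ⟨ρ, hρ, hρx⟩ : ∃ ρ : ℝ, 0 ≤ ρ ∧ ρ ^ (k + 1) = x :=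
    ⟨x ^ ((k + 1 : ℕ) : ℝ)⁻¹, by positivity, Real.rpow_inv_natCast_pow hx0.le (by simp)⟩
  have hsub : ball c ρ₀ ∩ {z | ‖η.prim σ z‖ < ε} ⊆ ball c ρ₀ ∩ ball c ρ := by
    rintro z ⟨hz, hzε⟩
    refine ⟨hz, ?_⟩
    rw [mem_ball_iff_norm]
    refine lt_of_pow_lt_pow_left₀ (k + 1) hρ ?_
    rw [hρx, hx, lt_div_iff₀ (by positivity)]
    have h1 := (hb z hz).2.2.trans_lt hzε
    rw [div_mul_eq_mul_div, div_lt_iff₀ (by positivity)] at h1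
    linarith
  calc _ ≤ ∫⁻ z in ball c ρ₀ ∩ ball c ρ, ‖η.coeff σ z‖ₑ ^ 2 := lintegral_mono_set hsub
    _ ≤ ∫⁻ z in ball c ρ₀ ∩ ball c ρ, ENNReal.ofReal (((1 + δ) * A) ^ 2) *
          ENNReal.ofReal (‖z - c‖ ^ (2 * k)) := by
        refine setLIntegral_mono' (measurableSet_ball.inter measurableSet_ball) fun z hz => ?_
        rw [← ofReal_norm, ← ENNReal.ofReal_pow (norm_nonneg _),
          ← ENNReal.ofReal_mul (by positivity)]
        refine ENNReal.ofReal_le_ofReal ?_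
        rw [mul_comm 2 k, pow_mul, ← mul_pow]
        exact pow_le_pow_left₀ (norm_nonneg _) (hb z hz.1).2.1 2
    _ ≤ ∫⁻ z in ball c ρ, ENNReal.ofReal (((1 + δ) * A) ^ 2) *
          ENNReal.ofReal (‖z - c‖ ^ (2 * k)) := lintegral_mono_set inter_subset_right
    _ = ENNReal.ofReal (((1 + δ) * A) ^ 2) *
          ∫⁻ z in ball (0 : ℂ) ρ, ENNReal.ofReal (‖z‖ ^ (2 * k)) := by
        rw [lintegral_const_mul' _ _ ENNReal.ofReal_ne_top]
        congr 1
        have := (measurePreserving_sub_right volume c).setLIntegral_comp_preimage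
          (s := ball (0 : ℂ) ρ) measurableSet_ball
          (f := fun z => ENNReal.ofReal (‖z‖ ^ (2 * k))) (by fun_prop)
        rw [← this]
        congr 2
        ext z
        simp [dist_eq_norm]
    _ = _ := by
        rw [lintegral_norm_pow_ball k hρ, ← ENNReal.ofReal_mul (by positivity)]
        congr 1
        rw [show 2 * k + 2 = (k + 1) * 2 by ring, pow_mul, hρx, hx]
        field_simp

end HolomorphicOneForm

theorem isOpen_openTriangle {a b c : ℂ} (h : cross (b - a) (c - a) ≠ 0) :
    IsOpen (openTriangle a b c) := by
  set D := cross (b - a) (c - a) with hD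
  have hc : ∀ f g : ℂ → ℂ, Continuous f → Continuous g → Continuous fun z => cross (f z) (g z) / D :=
    fun f g hf hg => by unfold cross; fun_prop
  have h1 := hc (fun z => z - a) (fun _ => c - a) (by fun_prop) (by fun_prop)
  have h2 := hc (fun _ => b - a) (fun z => z - a) (by fun_prop) (by fun_prop)
  have heq : openTriangle a b c = {z | 0 < cross (z - a) (c - a) / D} ∩
      {z | 0 < cross (b - a) (z - a) / D} ∩
      {z | cross (z - a) (c - a) / D + cross (b - a) (z - a) / D < 1} := by
    ext z
    constructor
    · rintro ⟨α, β, γ, hα, hβ, hγ, hs, rfl⟩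
      have e : α • a + β • b + γ • c - a = β • (b - a) + γ • (c - a) := by
        rw [show α = 1 - β - γ by linarith]; module
      have e1 : cross (α • a + β • b + γ • c - a) (c - a) / D = β := by
        rw [e, div_eq_iff h]
        simp only [hD, cross, Complex.add_re, Complex.add_im, Complex.smul_re, Complex.smul_im,
          smul_eq_mul]
        ring
      have e2 : cross (b - a) (α • a + β • b + γ • c - a) / D = γ := by
        rw [e, div_eq_iff h]
        simp only [hD, cross, Complex.add_re, Complex.add_im, Complex.smul_re, Complex.smul_im,
          smul_eq_mul]
        ring
      simp only [mem_inter_iff, mem_ofPred_eq, e1, e2]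
      exact ⟨⟨hβ, hγ⟩, by linarith⟩
    · rintro ⟨⟨hβ, hγ⟩, hs⟩
      simp only [mem_ofPred_eq] at hβ hγ hs
      refine ⟨1 - cross (z - a) (c - a) / D - cross (b - a) (z - a) / D, _, _, by linarith, hβ, hγ,
        by ring, ?_⟩
      have := smul_add_smul_eq_of_cross h (z - a)
      rw [← hD] at this
      rw [← sub_eq_zero] at this ⊢
      rw [← this]
      module
  rw [heq]
  exact ((isOpen_lt continuous_const h1).inter (isOpen_lt continuous_const h2)).inter
    (isOpen_lt (h1.add h2) continuous_const)

/-! ### Counting the triangles by angles -/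

namespace HolomorphicOneForm

variable {X : Type*} [TopologicalSpace X] [ChartedSpace ℂ X] [IsManifold 𝓘(ℂ) ω X]
variable {η : HolomorphicOneForm X} {ψ ψ' : ℂ → X} {z : ℂ}

/-- The vertices of a Delaunay triangle. -/
noncomputable def vertex (η : HolomorphicOneForm X) (t : X × ℂ × ℂ) : Fin 3 → ℂ := ![η.apex t.1, t.2.1, t.2.2]

theorem vertex_mem {t : X × ℂ × ℂ} (ht : t ∈ η.delaunayTriangles) (i : Fin 3) :
    η.vertex t i ∈ sphere (0 : ℂ) ‖η.apex t.1‖ \ η.expDomain t.1 := by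
  fin_cases i
  · exact ⟨by simp [vertex], ht.2.2.1⟩
  · exact ht.2.2.2.1.1
  · exact ht.2.2.2.1.2.1

theorem vertex_injective {t : X × ℂ × ℂ} (ht : t ∈ η.delaunayTriangles) :
    Function.Injective (η.vertex t) := by
  have h1 := ht.2.2.2.1.ne
  have h2 := ht.2.2.2.1.2.2.1
  intro i j hij
  fin_cases i <;> fin_cases j <;> simp [vertex] at hij ⊢
  · exact h1.1 hij.symm
  · exact h1.2 hij.symm
  · exact h1.1 hij
  · exact h2 hij
  · exact h1.2 hij
  · exact h2 hij.symm

theorem isOpen_flatTriangle {t : X × ℂ × ℂ} (ht : t ∈ η.delaunayTriangles) :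
    IsOpen (η.flatTriangle t) :=
  isOpen_openTriangle ht.2.2.2.2.ne'

theorem injOn_expMap_flatTriangle [T2Space X] {t : X × ℂ × ℂ} (ht : t ∈ η.delaunayTriangles) :
    InjOn (η.expMap t.1) (η.flatTriangle t) := fun _ hz _ hz' h =>
  (delaunayTriangles_injective ht ht hz hz' h).2

theorem exists_volume_ball_le_sum_corners {t : X × ℂ × ℂ} (ht : t ∈ η.delaunayTriangles) :
    ∃ ε₀ > 0, ∀ ε ≤ ε₀, volume (ball (0 : ℂ) ε) ≤
      2 * ∑ i, volume (η.flatTriangle t ∩ ball (η.vertex t i) ε) := by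
  obtain ⟨ε₀, h0, h⟩ := exists_volume_ball_le_corners ht.2.2.2.2.ne'
  refine ⟨ε₀, h0, fun ε hε => ?_⟩
  rw [Fin.sum_univ_three]
  exact h ε hε

/-- The point of the surface which a vertex of a Delaunay triangle represents. -/
theorem exists_vertex_point [T2Space X] [CompactSpace X] {t : X × ℂ × ℂ}
    (ht : t ∈ η.delaunayTriangles) (i : Fin 3) :
    ∃ σ ∈ η.singularities, ∀ ρ m, η.IsZeroDisk σ ρ m →
      ∀ z ∈ η.flatTriangle t ∩ ball (η.vertex t i) m, η.expMap t.1 z ∈ chartBall σ ρ ∧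
        η.prim σ (chartAt ℂ σ (η.expMap t.1 z)) = z - η.vertex t i := by
  obtain ⟨hs, hsE⟩ := vertex_mem ht i
  obtain ⟨σ, hσ, h⟩ := (isSingularAt_expMap ht.1 (mem_ball_self ht.2.1) hs hsE).exists_limit ht.2.1
    ((flatOn_expMap η t.1).mono ht.1) hs
  exact ⟨σ, hσ, fun ρ m hm z hz => h ρ m hm z ⟨flatTriangle_subset_ball ht hz.1, hz.2⟩⟩

/-- The ε-corners of a triangle have total area at least πε²/2. Those at a zero of order k embed
disjointly in a region of area about (k + 1)πε². A finite subfamily `F` permits a common ε;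
finiteness of the whole family follows. -/
theorem card_mul_le_of_subset_delaunayTriangles [T2Space X] [CompactSpace X] {S : Finset X}
    (hS : ∀ σ, σ ∈ S ↔ σ ∈ η.singularities) {k : X → ℕ}
    (hk : ∀ σ ∈ η.singularities, η.order σ = k σ) {F : Finset (X × ℂ × ℂ)}
    (hF : ↑F ⊆ η.delaunayTriangles) {δ : ℝ} (hδ : 0 < δ) (hδ1 : δ < 1) :
    (F.card : ℝ) ≤ 2 * (((1 + δ) / (1 - δ)) ^ 2 * ∑ σ ∈ S, ((k σ : ℝ) + 1)) := by
  classical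
  have hpoint : ∀ (t : X × ℂ × ℂ) (i : Fin 3), ∃ σ, t ∈ η.delaunayTriangles →
      σ ∈ η.singularities ∧ ∀ ρ m, η.IsZeroDisk σ ρ m →
        ∀ z ∈ η.flatTriangle t ∩ ball (η.vertex t i) m, η.expMap t.1 z ∈ chartBall σ ρ ∧
          η.prim σ (chartAt ℂ σ (η.expMap t.1 z)) = z - η.vertex t i := fun t i => by
    by_cases ht : t ∈ η.delaunayTriangles
    · obtain ⟨σ, h⟩ := exists_vertex_point ht i
      exact ⟨σ, fun _ => h⟩
    · exact ⟨t.1, fun h => absurd h ht⟩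
  choose σ hσ using hpoint
  choose! ε₀ hε₀ hcor using fun (t : X × ℂ × ℂ) (ht : t ∈ η.delaunayTriangles) =>
    exists_volume_ball_le_sum_corners ht
  choose! ρ₀ hρ₀ hint using fun (τ : X) (hτ : τ ∈ η.singularities) =>
    exists_lintegral_prim_le (hk τ hτ) hδ hδ1
  choose! ρ hρ m hm using fun (τ : X) (hτ : τ ∈ η.singularities) =>
    exists_isZeroDisk (hk τ hτ) (hρ₀ τ hτ)
  have hev : ∀ c : ℝ, 0 < c → ∀ᶠ ε : ℝ in 𝓝[>] 0, ε ≤ c := fun c hc => by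
    filter_upwards [Ioo_mem_nhdsGT hc] with ε hε using hε.2.le
  obtain ⟨ε, hεm, hεε₀, hε⟩ : ∃ ε : ℝ, (∀ τ ∈ S, ε ≤ m τ) ∧ (∀ t ∈ F, ε ≤ ε₀ t) ∧ 0 < ε := by
    refine Eventually.exists (f := 𝓝[>] 0) ?_
    refine ((Filter.eventually_all_finset S).2 fun τ hτ => hev _ ?_).and
      (((Filter.eventually_all_finset F).2 fun t ht => hev _ ?_).and self_mem_nhdsWithin)
    · exact (hm τ ((hS τ).1 hτ)).bound_pos
    · exact hε₀ t (hF ht)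
  set V : (X × ℂ × ℂ) × Fin 3 → Set ℂ := fun x =>
    η.flatTriangle x.1 ∩ ball (η.vertex x.1 x.2) ε with hV
  have hfiber : ∀ τ ∈ S, ∑ x ∈ (F ×ˢ Finset.univ) with σ x.1 x.2 = τ, volume (V x) ≤
      ENNReal.ofReal (((1 + δ) / (1 - δ)) ^ 2 * ((k τ + 1) * (Real.pi * ε ^ 2))) := by
    intro τ hτ
    have hτ' := (hS τ).1 hτ
    set G := {x ∈ F ×ˢ (Finset.univ : Finset (Fin 3)) | σ x.1 x.2 = τ} with hG
    have hGT : ∀ x ∈ G, x.1 ∈ η.delaunayTriangles ∧ σ x.1 x.2 = τ := fun x hx => by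
      simp only [hG, Finset.mem_filter, Finset.mem_product] at hx
      exact ⟨hF hx.1.1, hx.2⟩
    have hmaps : ∀ x ∈ G, ∀ z ∈ V x, η.expMap x.1.1 z ∈ chartBall τ (ρ τ) ∧
        η.prim τ (chartAt ℂ τ (η.expMap x.1.1 z)) = z - η.vertex x.1 x.2 := fun x hx z hz => by
      obtain ⟨hT, hσx⟩ := hGT x hx
      have := (hσ x.1 x.2 hT).2 (ρ τ) (m τ)
      rw [hσx] at this
      exact this (hm τ hτ') z ⟨hz.1, ball_subset_ball (hεm τ hτ) hz.2⟩
    have hopen : ∀ x ∈ G, IsOpen (V x) := fun x hx =>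
      (isOpen_flatTriangle (hGT x hx).1).inter isOpen_ball
    have hflat : ∀ x ∈ G, η.FlatOn (η.expMap x.1.1) (V x) := fun x hx =>
      (flatOn_flatTriangle (hGT x hx).1).mono inter_subset_left
    have hsrc : ∀ x ∈ G, MapsTo (η.expMap x.1.1) (V x) (chartAt ℂ τ).source := fun x hx z hz =>
      (hmaps x hx z hz).1.1
    have hinj : ∀ x ∈ G, InjOn (η.expMap x.1.1) (V x) := fun x hx =>
      (injOn_expMap_flatTriangle (hGT x hx).1).mono inter_subset_left
    have hmeas : ∀ x ∈ G, MeasurableSet ((chartAt ℂ τ ∘ η.expMap x.1.1) '' V x) := fun x hx =>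
      (hopen x hx).measurableSet.image_of_continuousOn_injOn
        ((chartAt ℂ τ).continuousOn.comp (hflat x hx).continuousOn (hsrc x hx))
        ((chartAt ℂ τ).injOn.comp (hinj x hx) (hsrc x hx))
    -- Different triangles have disjoint images. Two corners of one triangle at the same zero are
    -- told apart by the primitive, whose value at a point determines the vertex.
    have hdisj : (G : Set ((X × ℂ × ℂ) × Fin 3)).PairwiseDisjoint
        fun x => (chartAt ℂ τ ∘ η.expMap x.1.1) '' V x := by
      intro x hx y hy hxy
      refine Set.disjoint_left.2 ?_
      rintro _ ⟨z, hz, rfl⟩ ⟨w, hw, he⟩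
      have he' := (chartAt ℂ τ).injOn (hsrc y hy hw) (hsrc x hx hz) he
      obtain ⟨h1, h2⟩ := delaunayTriangles_injective (hGT y hy).1 (hGT x hx).1 hw.1 hz.1 he'
      have h3 := (hmaps x hx z hz).2
      have h4 := (hmaps y hy w hw).2
      rw [he', h3, h1, h2] at h4
      exact hxy (Prod.ext h1.symm (vertex_injective (hGT x hx).1 (sub_right_injective h4)))
    calc ∑ x ∈ G, volume (V x)
        = ∑ x ∈ G, ∫⁻ z in (chartAt ℂ τ ∘ η.expMap x.1.1) '' V x, ‖η.coeff τ z‖ₑ ^ 2 :=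
          Finset.sum_congr rfl fun x hx => (lintegral_image_chart (hopen x hx).measurableSet
            (hflat x hx) (hsrc x hx) (hinj x hx)).symm
      _ = ∫⁻ z in ⋃ x ∈ G, (chartAt ℂ τ ∘ η.expMap x.1.1) '' V x, ‖η.coeff τ z‖ₑ ^ 2 :=
          (lintegral_biUnion_finset hdisj hmeas _).symm
      _ ≤ ∫⁻ z in ball (chartAt ℂ τ τ) (ρ₀ τ) ∩ {z | ‖η.prim τ z‖ < ε}, ‖η.coeff τ z‖ₑ ^ 2 := by
          refine lintegral_mono_set (iUnion₂_subset fun x hx => ?_)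
          rintro _ ⟨z, hz, rfl⟩
          obtain ⟨h1, h2⟩ := hmaps x hx z hz
          refine ⟨ball_subset_ball (hρ τ hτ') h1.2, ?_⟩
          simp only [mem_ofPred_eq, Function.comp_apply, h2]
          exact mem_ball_iff_norm.1 hz.2
      _ ≤ _ := hint τ hτ' ε hε
  have hmain : ENNReal.ofReal (F.card * (Real.pi * ε ^ 2)) ≤ ENNReal.ofReal
      (2 * (((1 + δ) / (1 - δ)) ^ 2 * ∑ σ ∈ S, ((k σ : ℝ) + 1)) * (Real.pi * ε ^ 2)) := by
    calc ENNReal.ofReal (F.card * (Real.pi * ε ^ 2)) = ∑ t ∈ F, volume (ball (0 : ℂ) ε) := by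
          rw [Finset.sum_const, Complex.volume_ball, nsmul_eq_mul, ENNReal.ofReal_mul (by positivity),
            ENNReal.ofReal_natCast, mul_comm Real.pi, ENNReal.ofReal_mul (by positivity),
            ENNReal.ofReal_pow hε.le]
          congr 2
          exact ENNReal.ofReal_coe_nnreal (p := NNReal.pi)
      _ ≤ ∑ t ∈ F, 2 * ∑ i, volume (V (t, i)) :=
          Finset.sum_le_sum fun t ht => hcor t (hF ht) ε (hεε₀ t ht)
      _ = 2 * ∑ x ∈ F ×ˢ Finset.univ, volume (V x) := by
          rw [← Finset.mul_sum, Finset.sum_product]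
      _ = 2 * ∑ τ ∈ S, ∑ x ∈ (F ×ˢ Finset.univ) with σ x.1 x.2 = τ, volume (V x) := by
          refine congrArg (2 * ·) (Finset.sum_fiberwise_of_maps_to
            (g := fun x : (X × ℂ × ℂ) × Fin 3 => σ x.1 x.2) (fun x hx => ?_) _).symm
          exact (hS _).2 (hσ _ _ (hF (Finset.mem_product.1 hx).1)).1
      _ ≤ 2 * ∑ τ ∈ S, ENNReal.ofReal
            (((1 + δ) / (1 - δ)) ^ 2 * ((k τ + 1) * (Real.pi * ε ^ 2))) :=
          mul_le_mul_right (Finset.sum_le_sum hfiber) 2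
      _ = _ := by
          rw [← ENNReal.ofReal_sum_of_nonneg (fun τ _ => by positivity),
            show (2 : ℝ≥0∞) = ENNReal.ofReal 2 by simp, ← ENNReal.ofReal_mul (by norm_num),
            ← Finset.mul_sum, ← Finset.sum_mul]
          congr 1
          ring
  have hpi := Real.pi_pos
  rw [ENNReal.ofReal_le_ofReal_iff (by positivity)] at hmain
  exact le_of_mul_le_mul_right hmain (by positivity)

/-- The angle count: a total angle of `2π(k + 1)` at the zeros of order `k` bounds the number of
Delaunay triangles, each of which takes the angle `π`. -/
theorem card_le_of_subset_delaunayTriangles [T2Space X] [CompactSpace X] {S : Finset X}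
    (hS : ∀ σ, σ ∈ S ↔ σ ∈ η.singularities) {k : X → ℕ}
    (hk : ∀ σ ∈ η.singularities, η.order σ = k σ) {F : Finset (X × ℂ × ℂ)}
    (hF : ↑F ⊆ η.delaunayTriangles) : F.card ≤ 2 * ∑ σ ∈ S, (k σ + 1) := by
  have hlim : Tendsto (fun δ : ℝ => 2 * (((1 + δ) / (1 - δ)) ^ 2 * ∑ σ ∈ S, ((k σ : ℝ) + 1)))
      (𝓝[>] 0) (𝓝 (2 * (((1 + 0) / (1 - 0)) ^ 2 * ∑ σ ∈ S, ((k σ : ℝ) + 1)))) := by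
    refine Tendsto.mono_left ?_ nhdsWithin_le_nhds
    refine ContinuousAt.tendsto (f := fun δ : ℝ =>
      2 * (((1 + δ) / (1 - δ)) ^ 2 * ∑ σ ∈ S, ((k σ : ℝ) + 1))) ?_
    have : (1 : ℝ) - 0 ≠ 0 := by norm_num
    fun_prop (disch := assumption)
  have h := ge_of_tendsto hlim (b := (F.card : ℝ)) (by
    filter_upwards [Ioo_mem_nhdsGT (show (0 : ℝ) < 1 by norm_num)] with δ hδ
    exact card_mul_le_of_subset_delaunayTriangles hS hk hF hδ.1 hδ.2)
  norm_num at h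
  exact_mod_cast h

theorem finite_delaunayTriangles [T2Space X] [CompactSpace X] {S : Finset X}
    (hS : ∀ σ, σ ∈ S ↔ σ ∈ η.singularities) {k : X → ℕ}
    (hk : ∀ σ ∈ η.singularities, η.order σ = k σ) : η.delaunayTriangles.Finite := by
  by_contra hinf
  obtain ⟨F, hF, hc⟩ := Set.Infinite.exists_subset_card_eq hinf (2 * ∑ σ ∈ S, (k σ + 1) + 1)
  have := card_le_of_subset_delaunayTriangles hS hk hF
  omega

end HolomorphicOneForm

/-! ### Areas of plane triangles -/

theorem volume_line_eq_zero {a b : ℂ} (h : a ≠ b) :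
    volume {w : ℂ | ∃ t : ℝ, w = a + t • (b - a)} = 0 := by
  have h1 := volume_cross_eq_zero (sub_ne_zero.2 h.symm)
  rw [← measure_preimage_add volume a]
  refine measure_mono_null ?_ h1
  rintro w ⟨t, ht⟩
  rw [show w = t • (b - a) from add_left_cancel ht]
  simp only [mem_ofPred_eq, cross, Complex.smul_re, Complex.smul_im, smul_eq_mul]
  ring

/-- The triangle and its reflection in the centre of the unit square are disjoint and both lie in
the square. -/
theorem volume_unitTriangle_le :
    volume {z : ℂ | 0 < z.re ∧ 0 < z.im ∧ z.re + z.im < 1} ≤ ENNReal.ofReal (1 / 2) := by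
  set T : Set ℂ := {z | 0 < z.re ∧ 0 < z.im ∧ z.re + z.im < 1} with hT
  have hTo : IsOpen T := by
    refine (isOpen_lt continuous_const Complex.continuous_re).inter
      ((isOpen_lt continuous_const Complex.continuous_im).inter
        (isOpen_lt (Complex.continuous_re.add Complex.continuous_im) continuous_const))
  set T' : Set ℂ := (fun z => (1 + Complex.I) - z) ⁻¹' T with hT'
  have hTT' : volume T' = volume T :=
    (Measure.measurePreserving_sub_left volume (1 + Complex.I)).measure_preimage
      hTo.measurableSet.nullMeasurableSet
  have hmem : ∀ z, z ∈ T' ↔ z.re < 1 ∧ z.im < 1 ∧ 1 < z.re + z.im := fun z => by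
    simp only [hT', hT, mem_preimage, mem_ofPred_eq, Complex.sub_re, Complex.add_re, Complex.one_re,
      Complex.I_re, Complex.sub_im, Complex.add_im, Complex.one_im, Complex.I_im]
    constructor <;> rintro ⟨h1, h2, h3⟩ <;> refine ⟨?_, ?_, ?_⟩ <;> linarith
  have hdisj : Disjoint T T' := by
    refine Set.disjoint_left.2 fun z h h' => ?_
    have := ((hmem z).1 h').2.2
    have := h.2.2
    linarith
  have hsub : T ∪ T' ⊆ Complex.measurableEquivRealProd ⁻¹' (Ioo 0 1 ×ˢ Ioo 0 1) := by
    rintro z (⟨h1, h2, h3⟩ | h)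
    · exact ⟨⟨h1, by simp; linarith⟩, ⟨h2, by simp; linarith⟩⟩
    · obtain ⟨h1, h2, h3⟩ := (hmem z).1 h
      exact ⟨⟨by simp; linarith, h1⟩, ⟨by simp; linarith, h2⟩⟩
  have h1 : 2 * volume T ≤ 1 := by
    calc 2 * volume T = volume (T ∪ T') := by
          rw [measure_union' hdisj hTo.measurableSet, hTT', two_mul]
      _ ≤ volume (Complex.measurableEquivRealProd ⁻¹' (Ioo 0 1 ×ˢ Ioo 0 1)) := measure_mono hsub
      _ = 1 := by
          rw [Complex.volume_preserving_equiv_real_prod.measure_preimage_equiv,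
            Measure.volume_eq_prod, Measure.prod_prod]
          simp
  rw [one_div, ENNReal.ofReal_inv_of_pos two_pos, ENNReal.ofReal_ofNat]
  rw [mul_comm] at h1
  exact ENNReal.le_inv_iff_mul_le.2 h1

theorem volume_openTriangle_le (a b c : ℂ) :
    volume (openTriangle a b c) ≤ ENNReal.ofReal (|cross (b - a) (c - a)| / 2) := by
  have hl : IsLinearMap ℝ fun z : ℂ => z.re • (b - a) + z.im • (c - a) :=
    ⟨fun x y => by simp only [Complex.add_re, Complex.add_im]; module,
      fun t x => by simp only [Complex.smul_re, Complex.smul_im, smul_eq_mul]; module⟩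
  set L := hl.mk' with hL
  have hdet : LinearMap.det L = cross (b - a) (c - a) := by
    rw [← LinearMap.det_toMatrix Complex.basisOneI, Matrix.det_fin_two]
    simp [LinearMap.toMatrix_apply, hL, cross]
    ring
  have hsub : (fun y => a + y) ⁻¹' openTriangle a b c ⊆
      L '' {z : ℂ | 0 < z.re ∧ 0 < z.im ∧ z.re + z.im < 1} := by
    rintro y ⟨α, β, γ, hα, hβ, hγ, hs, he⟩
    refine ⟨⟨β, γ⟩, ⟨hβ, hγ, by simp only; linarith⟩, ?_⟩
    have : y = α • a + β • b + γ • c - a := by rw [← he]; ring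
    rw [this, show α = 1 - β - γ by linarith]
    simp only [hL, IsLinearMap.mk'_apply]
    module
  calc volume (openTriangle a b c) = volume ((fun y => a + y) ⁻¹' openTriangle a b c) :=
        (measure_preimage_add volume a _).symm
    _ ≤ volume (L '' {z : ℂ | 0 < z.re ∧ 0 < z.im ∧ z.re + z.im < 1}) := measure_mono hsub
    _ ≤ ENNReal.ofReal |cross (b - a) (c - a)| * ENNReal.ofReal (1 / 2) := by
        rw [Measure.addHaar_image_linearMap, hdet]
        gcongr
        exact volume_unitTriangle_le
    _ = _ := by rw [← ENNReal.ofReal_mul (abs_nonneg _)]; congr 1; ring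

/-- Among the triangles inscribed in a circle, the equilateral one has the largest area. -/
theorem cross_le_of_mem_sphere {a b c : ℂ} {r : ℝ} (ha : ‖a‖ = r) (hb : ‖b‖ = r) (hc : ‖c‖ = r) :
    cross (b - a) (c - a) ≤ 3 * Real.sqrt 3 / 2 * r ^ 2 := by
  have hs : Real.sqrt 3 * Real.sqrt 3 = 3 := Real.mul_self_sqrt (by norm_num)
  have hs0 : 0 < Real.sqrt 3 := by positivity
  have e : ∀ z : ℂ, ‖z‖ = r → z.re * z.re + z.im * z.im = r ^ 2 := fun z hz => by
    rw [← hz, ← Complex.normSq_eq_norm_sq, Complex.normSq_apply]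
  have ha' := e a ha
  have hb' := e b hb
  have hc' := e c hc
  -- This is |v - e^(iπ/3) u|² ≥ 0, with equality for equilateral triangles.
  have hw : ∀ u v : ℂ, Real.sqrt 3 * cross u v ≤
      u.re * u.re + u.im * u.im + (v.re * v.re + v.im * v.im) - (u.re * v.re + u.im * v.im) := by
    intro u v
    have h1 := sq_nonneg (v.re - (u.re / 2 - Real.sqrt 3 / 2 * u.im))
    have h2 := sq_nonneg (v.im - (Real.sqrt 3 / 2 * u.re + u.im / 2))
    simp only [cross]
    linear_combination h1 + h2 + (u.re * u.re + u.im * u.im) / 4 * hs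
  have h1 := hw (b - a) (c - a)
  simp only [Complex.sub_re, Complex.sub_im] at h1
  -- The previous bound is half the sum of the squared sides, and that sum equals 9r² - |a + b +
  -- c|².
  have h2 : Real.sqrt 3 * cross (b - a) (c - a) ≤ 9 / 2 * r ^ 2 := by
    have h3 := sq_nonneg (a.re + b.re + c.re)
    have h4 := sq_nonneg (a.im + b.im + c.im)
    linarith
  have h5 : Real.sqrt 3 * cross (b - a) (c - a) ≤ Real.sqrt 3 * (3 * Real.sqrt 3 / 2 * r ^ 2) := by
    linear_combination h2 - 3 / 2 * r ^ 2 * hs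
  exact le_of_mul_le_mul_left h5 hs0

theorem ContinuousOn.measurableSet_inter_preimage {α β : Type*} [TopologicalSpace α]
    [MeasurableSpace α] [OpensMeasurableSpace α] [TopologicalSpace β] [MeasurableSpace β]
    [BorelSpace β] {f : α → β} {s : Set α} (hf : ContinuousOn f s) (hs : MeasurableSet s) {t : Set β}
    (ht : MeasurableSet t) : MeasurableSet (s ∩ f ⁻¹' t) := by
  have h := hs.subtype_image ((continuousOn_iff_continuous_domRestrict.1 hf).measurable ht)
  convert h using 1
  ext x
  simp [and_comm]

/-! ### The triangles exhaust the area -/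

namespace HolomorphicOneForm

variable {X : Type*} [TopologicalSpace X] [ChartedSpace ℂ X] [IsManifold 𝓘(ℂ) ω X]
variable {η : HolomorphicOneForm X} {ψ ψ' : ℂ → X} {z : ℂ}

theorem FlatOn.map_nhds_eq {p : X} {V : Set ℂ} (hV : IsOpen V) (hψ : η.FlatOn ψ V) (hz : z ∈ V)
    (hp : ψ z ∈ (chartAt ℂ p).source) :
    Filter.map (chartAt ℂ p ∘ ψ) (𝓝 z) = 𝓝 (chartAt ℂ p (ψ z)) := by
  have hW : V ∩ ψ ⁻¹' (chartAt ℂ p).source ∈ 𝓝 z :=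
    (hψ.continuousOn.isOpen_inter_preimage hV (chartAt ℂ p).open_source).mem_nhds ⟨hz, hp⟩
  obtain ⟨w, hw, hw1⟩ := (hψ z hz).hasDerivAt hp
  have hd : DifferentiableOn ℂ (chartAt ℂ p ∘ ψ) (V ∩ ψ ⁻¹' (chartAt ℂ p).source) := fun y hy => by
    obtain ⟨w, hw, -⟩ := (hψ y hy.1).hasDerivAt hy.2
    exact hw.differentiableAt.differentiableWithinAt
  have hst := (hd.analyticAt hW).hasStrictDerivAt
  rw [hw.deriv] at hst
  exact hst.map_nhds_eq (right_ne_zero_of_mul_eq_one hw1)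

/-- The Delaunay triangles cover almost all of the surface. -/
theorem volume_compl_triangles_eq_zero [T2Space X] [CompactSpace X] [ConnectedSpace X]
    (hne : η.singularities.Nonempty) (hfin : η.singularities.Finite)
    (hord : ∀ σ ∈ η.singularities, ∃ k : ℕ, η.order σ = k) (p : X) :
    volume {z | z ∈ (chartAt ℂ p).target ∧ ∀ t ∈ η.delaunayTriangles, ∀ w ∈ η.flatTriangle t,
      η.expMap t.1 w ≠ (chartAt ℂ p).symm z} = 0 := by
  set B := {z | z ∈ (chartAt ℂ p).target ∧ ∀ t ∈ η.delaunayTriangles, ∀ w ∈ η.flatTriangle t,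
    η.expMap t.1 w ≠ (chartAt ℂ p).symm z} with hB
  set B' := B \ chartAt ℂ p '' η.singularities with hB'
  have h1 : volume (chartAt ℂ p '' η.singularities) = 0 := (hfin.image _).measure_zero _
  have h2 : volume B' = 0 := by
    refine measure_null_of_locally_null _ ?_
    rintro z ⟨⟨hz, -⟩, hzσ⟩
    set q := (chartAt ℂ p).symm z with hq
    have hqs : q ∈ (chartAt ℂ p).source := (chartAt ℂ p).map_target hz
    have hqz : chartAt ℂ p q = z := (chartAt ℂ p).right_inv hz
    have hqσ : q ∉ η.singularities := fun h => hzσ ⟨q, h, hqz⟩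
    obtain ⟨ε, hε, hball, F, hF, hlines⟩ := exists_finite_lines hne hord hqσ
    have hfl := (flatOn_expMap η q).mono hball
    have h0 := mem_ball_self (x := (0 : ℂ)) hε
    have h0s : η.expMap q 0 ∈ (chartAt ℂ p).source := by rwa [expMap_zero]
    set W := ball (0 : ℂ) ε ∩ η.expMap q ⁻¹' (chartAt ℂ p).source with hW
    have hWo : IsOpen W := hfl.continuousOn.isOpen_inter_preimage isOpen_ball
      (chartAt ℂ p).open_source
    set M : Set ℂ := ⋃ a ∈ F, ⋃ b ∈ F, {w | a ≠ b ∧ ∃ t : ℝ, w = a + t • (b - a)} with hM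
    have hMnull : volume M = 0 := by
      refine (measure_biUnion_null_iff hF.countable).2 fun a _ =>
        (measure_biUnion_null_iff hF.countable).2 fun b _ => ?_
      by_cases hab : a = b
      · simp [hab]
      · exact measure_mono_null (fun w hw => hw.2) (volume_line_eq_zero hab)
    -- In the flat coordinate at `q` the uncovered points are chord points and lie on the finitely
    -- many lines in `M`; a differentiable map preserves null sets.
    refine ⟨(chartAt ℂ p ∘ η.expMap q) '' (W ∩ M), ?_, ?_⟩
    · have hn : (chartAt ℂ p ∘ η.expMap q) '' W ∈ 𝓝 z := by
        have := hfl.map_nhds_eq isOpen_ball h0 h0s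
        rw [expMap_zero, hqz] at this
        rw [← this]
        exact image_mem_map (hWo.mem_nhds ⟨h0, h0s⟩)
      filter_upwards [mem_nhdsWithin_of_mem_nhds hn, self_mem_nhdsWithin]
      rintro _ ⟨w, hw, rfl⟩ ⟨⟨-, hy⟩, -⟩
      refine ⟨w, ⟨hw, ?_⟩, rfl⟩
      have hreg := (hfl w hw.1).notMem_singularities
      simp only [Function.comp_apply, (chartAt ℂ p).left_inv hw.2] at hy
      have hchord : η.IsChordPoint (η.expMap q w) := by
        by_contra hc
        obtain ⟨t, ht, y, hyt, he⟩ := exists_mem_flatTriangle hne hord hreg hc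
        exact hy t ht y hyt he
      obtain ⟨a, ha, b, hb, hab, ht⟩ := hlines w hw.1 hchord
      exact mem_biUnion ha (mem_biUnion hb ⟨hab, ht⟩)
    · refine addHaar_image_eq_zero_of_differentiableOn_of_addHaar_eq_zero volume ?_
        (measure_mono_null inter_subset_right hMnull)
      rintro w ⟨hw, -⟩
      obtain ⟨w', hw', -⟩ := (hfl w hw.1).hasDerivAt hw.2
      exact (hw'.differentiableAt.restrictScalars ℝ).differentiableWithinAt
  refine measure_mono_null ?_ (measure_union_null h1 h2)
  rw [hB', union_sdiff_self]
  exact subset_union_right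

/-- `areaMeasure` is a supremum over charts, so it suffices to dominate each chart measure by the
sum of the pushed-forward triangle measures. Only subadditivity and injectivity on each triangle are
used. -/
theorem area_le_sum_volume [T2Space X] [CompactSpace X] [ConnectedSpace X]
    (hne : η.singularities.Nonempty) (hfin : η.singularities.Finite)
    (hord : ∀ σ ∈ η.singularities, ∃ k : ℕ, η.order σ = k) {F : Finset (X × ℂ × ℂ)}
    (hF : (F : Set (X × ℂ × ℂ)) = η.delaunayTriangles) :
    η.area ≤ ∑ t ∈ F, volume (η.flatTriangle t) := by
  let := borel X
  have : BorelSpace X := ⟨rfl⟩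
  have hFT : ∀ t ∈ F, t ∈ η.delaunayTriangles := fun t ht => by rwa [← hF]
  have hmeas : ∀ t ∈ F, MeasurableSet (η.flatTriangle t) := fun t ht =>
    (isOpen_flatTriangle (hFT t ht)).measurableSet
  have hcont : ∀ t ∈ F, ContinuousOn (η.expMap t.1) (η.flatTriangle t) := fun t ht =>
    (flatOn_flatTriangle (hFT t ht)).continuousOn
  have key : η.areaMeasure ≤
      ∑ t ∈ F, Measure.map (η.expMap t.1) (volume.restrict (η.flatTriangle t)) := by
    refine iSup_le fun p => Measure.le_iff.2 fun B hB => ?_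
    set e := chartAt ℂ p
    set V : X × ℂ × ℂ → Set ℂ := fun t => η.flatTriangle t ∩ η.expMap t.1 ⁻¹' (e.source ∩ B) with hV
    have hVm : ∀ t ∈ F, MeasurableSet (V t) := fun t ht =>
      (hcont t ht).measurableSet_inter_preimage (hmeas t ht)
        (e.open_source.measurableSet.inter hB)
    have hsymm : AEMeasurable e.symm ((volume.restrict e.target).withDensity
        fun z => ‖η.coeff p z‖ₑ ^ 2) :=
      (e.continuousOn_symm.aemeasurable e.open_target.measurableSet).mono_ac
        (withDensity_absolutelyContinuous _ _)
    rw [Measure.map_apply_of_aemeasurable hsymm hB, withDensity_apply', Measure.restrict_restrict'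
      e.open_target.measurableSet, Measure.finsetSum_apply]
    set Z := {z | z ∈ e.target ∧ ∀ t ∈ η.delaunayTriangles, ∀ w ∈ η.flatTriangle t,
      η.expMap t.1 w ≠ e.symm z}
    have hsub : e.symm ⁻¹' B ∩ e.target ⊆ Z ∪ ⋃ t : F, (e ∘ η.expMap t.1.1) '' V t := by
      rintro z ⟨hzB, hz⟩
      by_cases hzZ : z ∈ Z
      · exact Or.inl hzZ
      · refine Or.inr ?_
        have : ∃ t ∈ η.delaunayTriangles, ∃ w ∈ η.flatTriangle t, η.expMap t.1 w = e.symm z := by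
          by_contra! hc
          exact hzZ ⟨hz, hc⟩
        obtain ⟨t, ht, w, hw, he⟩ := this
        have htF : t ∈ F := by rwa [← Finset.mem_coe, hF]
        refine mem_iUnion.2 ⟨⟨t, htF⟩, w, ⟨hw, ?_⟩, ?_⟩
        · rw [mem_preimage, he]
          exact ⟨e.map_target hz, hzB⟩
        · rw [Function.comp_apply, he, e.right_inv hz]
    calc _ ≤ ∫⁻ z in Z ∪ ⋃ t : F, (e ∘ η.expMap t.1.1) '' V t, ‖η.coeff p z‖ₑ ^ 2 :=
          lintegral_mono_set hsub
      _ ≤ 0 + ∑ t ∈ F, ∫⁻ z in (e ∘ η.expMap t.1) '' V t, ‖η.coeff p z‖ₑ ^ 2 := by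
          refine (lintegral_union_le _ _ _).trans (add_le_add ?_ ?_)
          · rw [setLIntegral_measure_zero _ _ (volume_compl_triangles_eq_zero hne hfin hord p)]
          · refine (lintegral_iUnion_le _ _).trans ?_
            rw [tsum_fintype, Finset.sum_coe_sort F
              fun t => ∫⁻ z in (e ∘ η.expMap t.1) '' V t, ‖η.coeff p z‖ₑ ^ 2]
      _ ≤ _ := by
          rw [zero_add]
          refine Finset.sum_le_sum fun t ht => ?_
          rw [lintegral_image_chart (hVm t ht)
            ((flatOn_flatTriangle (hFT t ht)).mono inter_subset_left) (fun z hz => hz.2.1)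
            ((injOn_expMap_flatTriangle (hFT t ht)).mono inter_subset_left),
            Measure.map_apply_of_aemeasurable ((hcont t ht).aemeasurable (hmeas t ht)) hB,
            Measure.restrict_apply' (hmeas t ht)]
          exact measure_mono fun z hz => ⟨hz.2.2, hz.1⟩
  refine (key univ).trans ?_
  rw [Measure.finsetSum_apply]
  refine Finset.sum_le_sum fun t ht => ?_
  rw [Measure.map_apply_of_aemeasurable ((hcont t ht).aemeasurable (hmeas t ht)) MeasurableSet.univ]
  simp

theorem volume_flatTriangle_le [T2Space X] [CompactSpace X] [ConnectedSpace X]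
    (hne : η.singularities.Nonempty) {t : X × ℂ × ℂ} (ht : t ∈ η.delaunayTriangles) :
    volume (η.flatTriangle t) ≤
      ENNReal.ofReal (3 * Real.sqrt 3 / 4 * η.coveringRadius ^ 2) := by
  refine (volume_openTriangle_le _ _ _).trans (ENNReal.ofReal_le_ofReal ?_)
  have hR : ‖η.apex t.1‖ ≤ η.coveringRadius := radius_le hne ht.1
  rw [abs_of_pos ht.2.2.2.2]
  have h1 := cross_le_of_mem_sphere (r := ‖η.apex t.1‖) rfl
    (mem_sphere_zero_iff_norm.1 ht.2.2.2.1.1.1) (mem_sphere_zero_iff_norm.1 ht.2.2.2.1.2.1.1)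
  have h2 : 3 * Real.sqrt 3 / 2 * ‖η.apex t.1‖ ^ 2 ≤
      3 * Real.sqrt 3 / 2 * η.coveringRadius ^ 2 := by gcongr
  linarith

end HolomorphicOneForm

/-! ### Conclusion -/

theorem mainTheorem5 {X : Type*} [TopologicalSpace X] [T2Space X] [CompactSpace X]
    [ConnectedSpace X] [ChartedSpace ℂ X] [IsManifold 𝓘(ℂ) ω X]
    (g ℓ : ℕ) (hℓ : 1 ≤ ℓ) (κ : Fin ℓ → ℕ) (hκ : ∀ i, 1 ≤ κ i)
    (hsum : ∑ i, (κ i : ℤ) = 2 * (g : ℤ) - 2)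
    (η : HolomorphicOneForm X) (hη : η.MemUnitStratum g κ) :
    Real.sqrt (2 / (3 * Real.sqrt 3 * (2 * (g : ℝ) + (ℓ : ℝ) - 2))) ≤ η.coveringRadius := by
  classical
  obtain ⟨p, hpinj, hprange, hpord⟩ := hη.exists_zeros
  have hne : η.singularities.Nonempty := hprange ▸ ⟨p ⟨0, hℓ⟩, mem_range_self _⟩
  have hfin : η.singularities.Finite := hprange ▸ finite_range p
  have hS : ∀ σ, σ ∈ Finset.univ.image p ↔ σ ∈ η.singularities := fun σ => by
    simp [← hprange]
  have hk : ∀ σ ∈ η.singularities, η.order σ = ((η.order σ).toNat : ℕ) := by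
    rw [← hprange]
    rintro _ ⟨i, rfl⟩
    rw [hpord i, ENat.toNat_natCast]
  have hord : ∀ σ ∈ η.singularities, ∃ k : ℕ, η.order σ = k := fun σ hσ => ⟨_, hk σ hσ⟩
  have hT := HolomorphicOneForm.finite_delaunayTriangles hS hk
  have hcard := HolomorphicOneForm.card_le_of_subset_delaunayTriangles hS hk
    (F := hT.toFinset) (by simp)
  rw [Finset.sum_image fun i _ j _ h => hpinj h] at hcard
  simp only [hpord, ENat.toNat_natCast] at hcard
  set R := η.coveringRadius with hR
  set N : ℝ := 2 * (g : ℝ) + (ℓ : ℝ) - 2 with hN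
  -- The genus enters only here, through Σ kᵢ = 2g - 2.
  have hNsum : ((∑ i, (κ i + 1) : ℕ) : ℝ) = N := by
    have : ((∑ i, (κ i : ℤ) : ℤ) : ℝ) = ((2 * (g : ℤ) - 2 : ℤ) : ℝ) := by rw [hsum]
    push_cast at this ⊢
    rw [Finset.sum_add_distrib, this]
    simp [hN]
    ring
  have hNpos : 0 < N := by
    rw [← hNsum]
    have : 0 < ∑ i, (κ i + 1) :=
      Finset.sum_pos (fun i _ => Nat.succ_pos _) ⟨⟨0, hℓ⟩, Finset.mem_univ _⟩
    exact_mod_cast this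
  have harea : (1 : ℝ≥0∞) ≤ ENNReal.ofReal (hT.toFinset.card * (3 * Real.sqrt 3 / 4 * R ^ 2)) := by
    calc (1 : ℝ≥0∞) = η.area := hη.area_eq.symm
      _ ≤ ∑ t ∈ hT.toFinset, volume (η.flatTriangle t) :=
          HolomorphicOneForm.area_le_sum_volume hne hfin hord (by simp)
      _ ≤ ∑ t ∈ hT.toFinset, ENNReal.ofReal (3 * Real.sqrt 3 / 4 * R ^ 2) :=
          Finset.sum_le_sum fun t ht =>
            HolomorphicOneForm.volume_flatTriangle_le hne (hT.mem_toFinset.1 ht)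
      _ = _ := by
          rw [Finset.sum_const, nsmul_eq_mul, ENNReal.ofReal_mul (Nat.cast_nonneg _),
            ENNReal.ofReal_natCast]
  rw [ENNReal.one_le_ofReal] at harea
  have hcard' : (hT.toFinset.card : ℝ) ≤ 2 * N := by
    rw [← hNsum]
    exact_mod_cast hcard
  have h1 : 1 ≤ 2 * N * (3 * Real.sqrt 3 / 4 * R ^ 2) := harea.trans (by gcongr)
  refine Real.sqrt_le_iff.2 ⟨ENNReal.toReal_nonneg, ?_⟩
  rw [div_le_iff₀ (by positivity)]
  linarith
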